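/- Let $W$ be a standard Brownian motion relative to a filtered probability space $(\Omega,\mathcal F,\{\mathcal F_t\}_{t\ge0},\mathbb P)$ satisfying the usual conditions, let $A,B,C,D,R,P,Q\in\mathbb R$, $M\ge 0$, $N>0$, $\rho>0$, and put $$b(x,u)=Ax+Bu,\quad \sigma(x,u)=Cx+Du,\quad r(x,u)=-\Big(\tfrac M2x^2+Rxu+\tfrac N2u^2+Px+Qu\Big).$$ Classical problem: $V^{\mathrm{cl}}(x)=\sup_{u\in\mathcal A^{\mathrm{cl}}(x)}\mathbb E\big[\int_0^\infty e^{-\rho t}r(x^u_t,u_t)\,dt\big]$ where $dx^u_t=b(x^u_t,u_t)\,dt+\sigma(x^u_t,u_t)\,dW_t$, $x^u_0=x$, and $\mathcal A^{\mathrm{cl}}(x)$ is the set of progressively measurable real processes $u$ with $\mathbb E\int_0^tu_s^2\,ds<\infty$ for every $t\ge 0$, $\liminf_{T\to\infty}e^{-\rho T}\mathbb E[(x^u_T)^2]=0$ and $\mathbb E\int_0^\infty e^{-\rho t}|r(x^u_t,u_t)|\,dt<\infty$. Exploratory problem with weight $\lambda>0$: $V_\lambda(x)=\sup_{\pi\in\mathcal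 A(x)}\mathbb E\big[\int_0^\infty e^{-\rho t}L_\lambda(X^\pi_t,\pi_t)\,dt\big]$ where $L_\lambda(y,\pi)=\int_{\mathbb R} r(y,u)\pi(u)\,du-\lambda\int_{\mathbb R}\pi(u)\ln\pi(u)\,du$, $$dX^\pi_t=\Big(\int_{\mathbb R} b(X^\pi_t,u)\pi_t(u)\,du\Big)dt+\Big(\int_{\mathbb R}\sigma^2(X^\pi_t,u)\pi_t(u)\,du\Big)^{1/2}dW_t,\qquad X^\pi_0=x,$$ and $\mathcal A(x)$ is the set of processes $\pi=(\pi_t)_{t\ge0}$ such that $\pi_t$ is a.s. a probability density on $\mathbb R$ for each $t$, $\int_E\pi_t(u)\,du$ is progressively measurable for each Borel set $E$, $\mathbb E\int_0^t\int_{\mathbb R}u^2\pi_s(u)\,du\,ds<\infty$ for each $t$, $\liminf_{T\to\infty}e^{-\rho T}\mathbb E[(X^\pi_T)^2]=0$, and $L_\lambda(X^\pi_t,\pi_t)$ is a.e. well defined and finite with $\mathbb E\int_0^\infty e^{-\rho t}|L_\lambda(X^\pi_t,\pi_t)|\,dt<\infty$. In either problem, a feedback control is optimal if, for every initial state, the state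 equation under it has a unique strong solution and the control process it generates is admissible and attains the value. Let $\alpha_0,\alpha_1\in\mathbb R$ and $\alpha_2<0$. Put $\boldsymbol u^*(x)=\dfrac{(\alpha_2(B+CD)-R)x+\alpha_1B-Q}{N-\alpha_2D^2}$ and let $\boldsymbol\pi^*_\lambda(\cdot;x)$ be the Gaussian distribution with mean $\boldsymbol u^*(x)$ and variance $\dfrac{\lambda}{N-\alpha_2D^2}$. Consider the statements $(a)_\lambda$: $V_\lambda(x)=\frac12\alpha_2x^2+\alpha_1x+\alpha_0+\frac{\lambda}{2\rho}\Big(\ln\frac{2\pi e\lambda}{N-\alpha_2D^2}-1\Big)$ for all $x\in\mathbb R$, and $\boldsymbol\pi^*_\lambda$ is an optimal feedback control of the exploratory problem with weight $\lambda$; $(b)$: $V^{\mathrm{cl}}(x)=\frac12\alpha_2x^2+\alpha_1x+\alpha_0$ for all $x\in\mathbb R$, and $\boldsymbol u^*$ is an optimal feedback control of the classical problem. Theorem. Suppose that $(a)_\lambda$ holds for some $\lambda>0$, or that $(b)$ holds. Then $(b)$ holds and $(a)_\lambda$ holds for every $\lambda>0$ (with the same $\alpha_0,\alpha_1,\alpha_2$),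 and for every $x\in\mathbb R$, $$\lim_{\lambda\downarrow0}\boldsymbol\pi^*_\lambda(\cdot;x)=\delta_{\boldsymbol u^*(x)}\ \text{ weakly},\qquad \lim_{\lambda\downarrow0}|V_\lambda(x)-V^{\mathrm{cl}}(x)|=0.$$ -/

import Mathlib

open MeasureTheory ProbabilityTheory Filter Topology
open scoped NNReal ENNReal

noncomputable section

namespace LQExploration

/-! ### Time, Brownian motion, stochastic integral, Itô processes -/

/-- Lebesgue measure on the time half-line `[0, ∞)`. -/
def timeMeasure : Measure ℝ≥0 :=
  (volume.restrict (Set.Ici (0 : ℝ))).map Real.toNNReal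

/-- `(Ω, 𝓕, P)` satisfies the usual conditions and `W` is a standard Brownian motion
relative to the filtration `𝓕`. -/
structure IsBrownianBasis {Ω : Type*} [MeasurableSpace Ω] (P : Measure Ω)
    (𝓕 : Filtration ℝ≥0 ‹MeasurableSpace Ω›) (W : ℝ≥0 → Ω → ℝ) : Prop where
  right_continuous : 𝓕.IsRightContinuous
  null_measurable : ∀ s : Set Ω, P s = 0 → MeasurableSet[𝓕 0] s
  brownian : IsBrownianReal W P
  adapted : StronglyAdapted 𝓕 W
  indep : ∀ s t : ℝ≥0, s ≤ t →
    Indep (MeasurableSpace.comap (fun ω => W t ω - W s ω) inferInstance) (𝓕 s) P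

/-- A simple (elementary predictable) process: the bounded `𝓕 (time i)`-measurable value `coef i`
is taken on the interval `(time i, time (i + 1)]`, for `i < size`. -/
structure SimpleProcess {Ω : Type*} [MeasurableSpace Ω]
    (𝓕 : Filtration ℝ≥0 ‹MeasurableSpace Ω›) where
  size : ℕ
  time : ℕ → ℝ≥0
  time_mono : Monotone time
  coef : ℕ → Ω → ℝ
  coef_measurable : ∀ i, StronglyMeasurable[𝓕 (time i)] (coef i)
  coef_bounded : ∃ K : ℝ, ∀ i ω, |coef i ω| ≤ K

/-- The simple process as a function of time and chance. -/
def SimpleProcess.eval {Ω : Type*} [MeasurableSpace Ω] {𝓕 : Filtration ℝ≥0 ‹MeasurableSpace Ω›}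
    (H : SimpleProcess 𝓕) (s : ℝ≥0) (ω : Ω) : ℝ :=
  ∑ i ∈ Finset.range H.size,
    (Set.Ioc (H.time i) (H.time (i + 1))).indicator (fun _ => H.coef i ω) s

/-- The elementary stochastic integral `∫₀ᵗ H dW` of a simple process. -/
def SimpleProcess.integral {Ω : Type*} [MeasurableSpace Ω]
    {𝓕 : Filtration ℝ≥0 ‹MeasurableSpace Ω›}
    (H : SimpleProcess 𝓕) (W : ℝ≥0 → Ω → ℝ) (t : ℝ≥0) (ω : Ω) : ℝ :=
  ∑ i ∈ Finset.range H.size,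
    H.coef i ω * (W (min (H.time (i + 1)) t) ω - W (min (H.time i) t) ω)

/-- `E ∫₀ᵀ f_s² ds`, with values in `[0, ∞]`. -/
def energy {Ω : Type*} [MeasurableSpace Ω] (P : Measure Ω) (f : ℝ≥0 → Ω → ℝ) (T : ℝ≥0) : ℝ≥0∞ :=
  ∫⁻ ω, ∫⁻ s in Set.Iic T, ENNReal.ofReal ((f s ω) ^ 2) ∂timeMeasure ∂P

/-- `M` is the Itô integral process `M_t = ∫₀ᵗ H dW`: `H` is progressively measurable with
`E ∫₀ᵀ H² ds < ∞` for every `T`, and `M` is the (a.s. continuous, adapted) `L²`-limit of the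
elementary integrals of simple processes that approximate `H` in `L²(Ω × [0, T])`. -/
structure IsItoIntegral {Ω : Type*} [MeasurableSpace Ω] (P : Measure Ω)
    (𝓕 : Filtration ℝ≥0 ‹MeasurableSpace Ω›) (W : ℝ≥0 → Ω → ℝ) (H M : ℝ≥0 → Ω → ℝ) : Prop where
  integrand_progressive : IsStronglyProgressive 𝓕 H
  integrand_sq : ∀ T, energy P H T < ∞
  progressive : IsStronglyProgressive 𝓕 M
  continuous : ∀ᵐ ω ∂P, Continuous (fun t => M t ω)
  limit : ∃ Hn : ℕ → SimpleProcess 𝓕, ∀ T : ℝ≥0,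
    Tendsto (fun n => energy P (fun s ω => (Hn n).eval s ω - H s ω) T) atTop (𝓝 0) ∧
    Tendsto (fun n => ∫⁻ ω, ENNReal.ofReal (((Hn n).integral W T ω - M T ω) ^ 2) ∂P)
      atTop (𝓝 0)

/-- `X` is a continuous adapted process with `dX_t = β_t dt + γ_t dW_t`, `X_0 = x`, where
`β` and `γ` are progressively measurable and square integrable on `Ω × [0, T]` for every `T`. -/
structure IsItoProcess {Ω : Type*} [MeasurableSpace Ω] (P : Measure Ω)
    (𝓕 : Filtration ℝ≥0 ‹MeasurableSpace Ω›) (W : ℝ≥0 → Ω → ℝ)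
    (x : ℝ) (β γ X : ℝ≥0 → Ω → ℝ) : Prop where
  progressive : IsStronglyProgressive 𝓕 X
  continuous : ∀ᵐ ω ∂P, Continuous (fun t => X t ω)
  drift_progressive : IsStronglyProgressive 𝓕 β
  drift_sq : ∀ T, energy P β T < ∞
  equation : ∃ M, IsItoIntegral P 𝓕 W γ M ∧
    ∀ t, ∀ᵐ ω ∂P, X t ω = x + ∫ s in Set.Iic t, β s ω ∂timeMeasure + M t ω

/-! ### The linear-quadratic data -/

/-- Coefficients of the linear-quadratic problem, with the discount rate `ρ`. -/
structure LQData where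
  A : ℝ
  B : ℝ
  C : ℝ
  D : ℝ
  M : ℝ
  N : ℝ
  R : ℝ
  P : ℝ
  Q : ℝ
  ρ : ℝ

namespace LQData

/-- `b(x, u) = A x + B u`. -/
def drift (S : LQData) (x u : ℝ) : ℝ := S.A * x + S.B * u

/-- `σ(x, u) = C x + D u`. -/
def vol (S : LQData) (x u : ℝ) : ℝ := S.C * x + S.D * u

/-- `r(x, u) = -(M x² / 2 + R x u + N u² / 2 + P x + Q u)`. -/
def reward (S : LQData) (x u : ℝ) : ℝ :=
  -(S.M / 2 * x ^ 2 + S.R * x * u + S.N / 2 * u ^ 2 + S.P * x + S.Q * u)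

/-- The exploratory drift `∫ b(y, u) π(du)`. -/
def exploratoryDrift (S : LQData) (y : ℝ) (m : Measure ℝ) : ℝ := ∫ u, S.drift y u ∂m

/-- The exploratory volatility `√(∫ σ(y, u)² π(du))`. -/
def exploratoryVol (S : LQData) (y : ℝ) (m : Measure ℝ) : ℝ := √(∫ u, (S.vol y u) ^ 2 ∂m)

end LQData

/-- The integrand `π(u) ln π(u)` of the negative differential entropy, `π(u)` being the Lebesgue
density of `m`. -/
def entropyIntegrand (m : Measure ℝ) (u : ℝ) : ℝ :=
  (m.rnDeriv volume u).toReal * Real.log (m.rnDeriv volume u).toReal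

/-- The running reward `L(y, π) = ∫ r(y, u) π(u) du - λ ∫ π(u) ln π(u) du`. -/
def LQData.runningReward (S : LQData) (lam : ℝ) (y : ℝ) (m : Measure ℝ) : ℝ :=
  ∫ u, S.reward y u ∂m - lam * ∫ u, entropyIntegrand m u

/-- `lim inf_{T → ∞} e^{-ρT} E[X_T²] = 0`. -/
def DiscountedLiminfZero {Ω : Type*} [MeasurableSpace Ω] (P : Measure Ω) (ρ : ℝ)
    (X : ℝ≥0 → Ω → ℝ) : Prop :=
  liminf (fun T : ℝ≥0 => ENNReal.ofReal (Real.exp (-ρ * T)) *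
    ∫⁻ ω, ENNReal.ofReal ((X T ω) ^ 2) ∂P) atTop = 0

/-! ### The exploratory (entropy-regularized relaxed) problem -/

/-- `X` solves the exploratory state equation, started from `x`, under the distribution-valued
control `π`. -/
def IsExploratoryState {Ω : Type*} [MeasurableSpace Ω] (P : Measure Ω)
    (𝓕 : Filtration ℝ≥0 ‹MeasurableSpace Ω›) (W : ℝ≥0 → Ω → ℝ) (S : LQData) (x : ℝ)
    (π : ℝ≥0 → Ω → Measure ℝ) (X : ℝ≥0 → Ω → ℝ) : Prop :=
  IsItoProcess P 𝓕 W x (fun t ω => S.exploratoryDrift (X t ω) (π t ω))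
    (fun t ω => S.exploratoryVol (X t ω) (π t ω)) X

/-- `π` is an admissible open-loop control distribution for the initial state `x`, and `X` is the
corresponding state process. -/
structure IsExploratoryAdmissible {Ω : Type*} [MeasurableSpace Ω] (P : Measure Ω)
    (𝓕 : Filtration ℝ≥0 ‹MeasurableSpace Ω›) (W : ℝ≥0 → Ω → ℝ) (S : LQData) (lam x : ℝ)
    (π : ℝ≥0 → Ω → Measure ℝ) (X : ℝ≥0 → Ω → ℝ) : Prop where
  density : ∀ t, ∀ᵐ ω ∂P, IsProbabilityMeasure (π t ω) ∧ π t ω ≪ volume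
  progressive : ∀ E : Set ℝ, MeasurableSet E → IsProgressive 𝓕 (fun t ω => π t ω E)
  /-- `E ∫₀ᵗ (μ_s² + σ_s²) ds < ∞`, where `μ_s² + σ_s² = ∫ u² π_s(u) du` for the mean `μ_s` and
  the variance `σ_s²` of `π_s`. -/
  moment : ∀ t, ∫⁻ ω, ∫⁻ s in Set.Iic t, ∫⁻ u, ENNReal.ofReal (u ^ 2) ∂(π s ω)
    ∂timeMeasure ∂P < ∞
  state : IsExploratoryState P 𝓕 W S x π X
  transversality : DiscountedLiminfZero P S.ρ X
  /-- The entropy is finite, so that the running reward is a well-defined real number. -/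
  entropy_finite : ∀ᵐ z : Ω × ℝ≥0 ∂(P.prod timeMeasure),
    Integrable (entropyIntegrand (π z.2 z.1)) volume
  reward_integrable : Integrable (fun z : Ω × ℝ≥0 => Real.exp (-S.ρ * z.2) *
    S.runningReward lam (X z.2 z.1) (π z.2 z.1)) (P.prod timeMeasure)

/-- `E ∫₀^∞ e^{-ρt} L(X_t, π_t) dt`. -/
def exploratoryPayoff {Ω : Type*} [MeasurableSpace Ω] (P : Measure Ω) (S : LQData) (lam : ℝ)
    (π : ℝ≥0 → Ω → Measure ℝ) (X : ℝ≥0 → Ω → ℝ) : ℝ :=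
  ∫ ω, ∫ t, Real.exp (-S.ρ * t) * S.runningReward lam (X t ω) (π t ω) ∂timeMeasure ∂P

/-- The value function of the exploratory problem with exploration weight `lam`: the supremum, in
`[-∞, ∞]`, of the payoff over the admissible control distributions. -/
def exploratoryValue {Ω : Type*} [MeasurableSpace Ω] (P : Measure Ω)
    (𝓕 : Filtration ℝ≥0 ‹MeasurableSpace Ω›) (W : ℝ≥0 → Ω → ℝ) (S : LQData) (lam x : ℝ) : EReal :=
  sSup {J : EReal | ∃ π X, IsExploratoryAdmissible P 𝓕 W S lam x π X ∧
    J = (exploratoryPayoff P S lam π X : EReal)}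

/-- `κ` is an optimal feedback control distribution: every `κ y` has a density and, for every
initial state, the state equation under the feedback `κ` has a unique strong solution, and the
open-loop control distribution so generated is admissible and attains the value. -/
def IsOptimalExploratoryFeedback {Ω : Type*} [MeasurableSpace Ω] (P : Measure Ω)
    (𝓕 : Filtration ℝ≥0 ‹MeasurableSpace Ω›) (W : ℝ≥0 → Ω → ℝ) (S : LQData) (lam : ℝ)
    (κ : ℝ → Measure ℝ) : Prop :=
  (∀ y, IsProbabilityMeasure (κ y) ∧ κ y ≪ volume) ∧
  ∀ x : ℝ, ∃ X : ℝ≥0 → Ω → ℝ,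
    IsExploratoryState P 𝓕 W S x (fun t ω => κ (X t ω)) X ∧
    (∀ Y : ℝ≥0 → Ω → ℝ, IsExploratoryState P 𝓕 W S x (fun t ω => κ (Y t ω)) Y →
      ∀ᵐ ω ∂P, ∀ t, Y t ω = X t ω) ∧
    IsExploratoryAdmissible P 𝓕 W S lam x (fun t ω => κ (X t ω)) X ∧
    (exploratoryPayoff P S lam (fun t ω => κ (X t ω)) X : EReal) =
      exploratoryValue P 𝓕 W S lam x

/-! ### The classical problem -/

/-- `X` solves the classical state equation, started from `x`, under the control `u`. -/
def IsClassicalState {Ω : Type*} [MeasurableSpace Ω] (P : Measure Ω)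
    (𝓕 : Filtration ℝ≥0 ‹MeasurableSpace Ω›) (W : ℝ≥0 → Ω → ℝ) (S : LQData) (x : ℝ)
    (u X : ℝ≥0 → Ω → ℝ) : Prop :=
  IsItoProcess P 𝓕 W x (fun t ω => S.drift (X t ω) (u t ω)) (fun t ω => S.vol (X t ω) (u t ω)) X

/-- `u` is an admissible classical control for the initial state `x`, and `X` is the corresponding
state process. -/
structure IsClassicalAdmissible {Ω : Type*} [MeasurableSpace Ω] (P : Measure Ω)
    (𝓕 : Filtration ℝ≥0 ‹MeasurableSpace Ω›) (W : ℝ≥0 → Ω → ℝ) (S : LQData) (x : ℝ)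
    (u X : ℝ≥0 → Ω → ℝ) : Prop where
  progressive : IsStronglyProgressive 𝓕 u
  moment : ∀ t, energy P u t < ∞
  state : IsClassicalState P 𝓕 W S x u X
  transversality : DiscountedLiminfZero P S.ρ X
  reward_integrable : Integrable (fun z : Ω × ℝ≥0 => Real.exp (-S.ρ * z.2) *
    S.reward (X z.2 z.1) (u z.2 z.1)) (P.prod timeMeasure)

/-- `E ∫₀^∞ e^{-ρt} r(X_t, u_t) dt`. -/
def classicalPayoff {Ω : Type*} [MeasurableSpace Ω] (P : Measure Ω) (S : LQData)
    (u X : ℝ≥0 → Ω → ℝ) : ℝ :=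
  ∫ ω, ∫ t, Real.exp (-S.ρ * t) * S.reward (X t ω) (u t ω) ∂timeMeasure ∂P

/-- The value function of the classical problem. -/
def classicalValue {Ω : Type*} [MeasurableSpace Ω] (P : Measure Ω)
    (𝓕 : Filtration ℝ≥0 ‹MeasurableSpace Ω›) (W : ℝ≥0 → Ω → ℝ) (S : LQData) (x : ℝ) : EReal :=
  sSup {J : EReal | ∃ u X, IsClassicalAdmissible P 𝓕 W S x u X ∧
    J = (classicalPayoff P S u X : EReal)}

/-- `f` is an optimal feedback control of the classical problem. -/
def IsOptimalClassicalFeedback {Ω : Type*} [MeasurableSpace Ω] (P : Measure Ω)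
    (𝓕 : Filtration ℝ≥0 ‹MeasurableSpace Ω›) (W : ℝ≥0 → Ω → ℝ) (S : LQData)
    (f : ℝ → ℝ) : Prop :=
  ∀ x : ℝ, ∃ X : ℝ≥0 → Ω → ℝ,
    IsClassicalState P 𝓕 W S x (fun t ω => f (X t ω)) X ∧
    (∀ Y : ℝ≥0 → Ω → ℝ, IsClassicalState P 𝓕 W S x (fun t ω => f (Y t ω)) Y →
      ∀ᵐ ω ∂P, ∀ t, Y t ω = X t ω) ∧
    IsClassicalAdmissible P 𝓕 W S x (fun t ω => f (X t ω)) X ∧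
    (classicalPayoff P S (fun t ω => f (X t ω)) X : EReal) = classicalValue P 𝓕 W S x

/-! ### The two solvability statements -/

/-- The affine feedback `u*(x) = ((α₂(B + CD) - R) x + α₁ B - Q) / (N - α₂ D²)`. -/
def affineFeedback (S : LQData) (α₁ α₂ x : ℝ) : ℝ :=
  ((α₂ * (S.B + S.C * S.D) - S.R) * x + α₁ * S.B - S.Q) / (S.N - α₂ * S.D ^ 2)

/-- The Gaussian feedback `π*(·; x)`, with mean `u*(x)` and variance `λ / (N - α₂ D²)`. -/
def gaussianFeedback (S : LQData) (α₁ α₂ lam x : ℝ) : ProbabilityMeasure ℝ :=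
  ⟨gaussianReal (affineFeedback S α₁ α₂ x) (lam / (S.N - α₂ * S.D ^ 2)).toNNReal, inferInstance⟩

/-- The exploratory problem with weight `lam` has the value function
`α₂ x² / 2 + α₁ x + α₀ + λ / (2ρ) (ln (2πeλ / (N - α₂ D²)) - 1)` and the optimal feedback control
distribution `π*`. -/
def ExploratorySolution {Ω : Type*} [MeasurableSpace Ω] (P : Measure Ω)
    (𝓕 : Filtration ℝ≥0 ‹MeasurableSpace Ω›) (W : ℝ≥0 → Ω → ℝ) (S : LQData)
    (α₀ α₁ α₂ lam : ℝ) : Prop :=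
  (∀ x : ℝ, exploratoryValue P 𝓕 W S lam x =
    ((1 / 2 * α₂ * x ^ 2 + α₁ * x + α₀ + lam / (2 * S.ρ) *
      (Real.log (2 * Real.pi * Real.exp 1 * lam / (S.N - α₂ * S.D ^ 2)) - 1) : ℝ) : EReal)) ∧
  IsOptimalExploratoryFeedback P 𝓕 W S lam
    (fun x => (gaussianFeedback S α₁ α₂ lam x : Measure ℝ))

/-- The classical problem has the value function `α₂ x² / 2 + α₁ x + α₀` and the optimal feedback
control `u*`. -/
def ClassicalSolution {Ω : Type*} [MeasurableSpace Ω] (P : Measure Ω)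
    (𝓕 : Filtration ℝ≥0 ‹MeasurableSpace Ω›) (W : ℝ≥0 → Ω → ℝ) (S : LQData)
    (α₀ α₁ α₂ : ℝ) : Prop :=
  (∀ x : ℝ, classicalValue P 𝓕 W S x =
    ((1 / 2 * α₂ * x ^ 2 + α₁ * x + α₀ : ℝ) : EReal)) ∧
  IsOptimalClassicalFeedback P 𝓕 W S (affineFeedback S α₁ α₂)

end LQExploration

end

/-!
Write `n = N - α₂ D²` and let `v(y) = α₂ y² / 2 + α₁ y + α₀`. The Hamiltonian
`r(y, u) + v'(y) b(y, u) + v''(y) σ(y, u)² / 2 - ρ v(y)` is a concave quadratic polynomial in `u`;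
completing the square, it equals `g(y) - n / 2 * (u - u*(y))²` with `g` quadratic
(`LQData.hamiltonian_eq`). Both solvability statements are equivalent to one condition that
does not mention the weight, `LQData.SolvesHJB`: `g` vanishes identically, and the closed loop
`dX = (a X + b) dt + ...`, whose squared volatility is `(c X + d)² + e`, satisfies `2 a + c² < ρ`.
Here `e = 0` for the classical problem, and `e` is proportional to the weight for the exploratory
one; `a`, `b`, `c`, `d` are the same in both. This gives the equivalence.

*Sufficiency.* Itô's formula in expectation for quadratic test functions
(`IsItoProcess.discounted_quadratic`) and transversality bound the payoff of an admissible control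
by the value at the initial state of any quadratic function whose discounted generator plus the
running reward is at most zero, with equality if the sum vanishes (`IsItoProcess.payoff_le`,
`IsItoProcess.payoff_eq`, where an additive constant accounts for the entropy bonus). The classical
control enters through `-n / 2 * (u - u*)² ≤ 0`, the exploratory one through the Gibbs variational
inequality (`LQData.entropy_sub_penalty_le`), whose maximizer is the Gaussian with mean `u*` and
variance `λ / n`. The closed-loop equation has Lipschitz coefficients, so that its strong solution
exists and is unique (`exists_isItoProcess`, `IsItoProcess.unique`), and the growth condition
`2 a + c² < ρ` makes the feedback control admissible.

*Necessity.* If the feedback is optimal, the closed-loop solutions satisfy the transversality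
condition from every initial state, which forces `2 a + c² < ρ` (`IsClosedLoop.rate_lt`). There is
then a quadratic polynomial `w` whose discounted generator is `-g`. The payoff of the feedback from
`x` is `v(x) + w(x)`, plus the entropy bonus `λ / (2ρ) (ln (2πeλ / n) - 1)` in the exploratory
problem, so that equality with the value function for all `x` forces `w = 0`, and hence `g = 0`
(`IsClosedLoop.residual_eq_zero`).

*Vanishing exploration.* The entropy bonus tends to zero with the weight, and Gaussian measures
with fixed mean and vanishing variance tend to the Dirac measure.

The stochastic calculus is built from simple processes: the Itô isometry and the martingale
property pass to `L²` limits, and Doob's maximal inequality to continuous time. Strong solutions are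
limits of a Picard iteration in which the volatility is replaced in each step by a simple process,
so that only elementary stochastic integrals occur.
-/

noncomputable section

namespace LQExploration

/-! ### Lebesgue measure on the half-line -/

instance : SFinite timeMeasure := by unfold timeMeasure; infer_instance

lemma timeMeasure_apply_Ioc (u v : ℝ≥0) : timeMeasure (Set.Ioc u v) = ENNReal.ofReal (v - u) := by
  unfold timeMeasure
  rw [Measure.map_apply measurable_real_toNNReal measurableSet_Ioc,
    Measure.restrict_apply (measurable_real_toNNReal measurableSet_Ioc)]
  have : Real.toNNReal ⁻¹' Set.Ioc u v ∩ Set.Ici 0 = Set.Ioc (u : ℝ) v := by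
    ext x
    simp only [Set.mem_inter_iff, Set.mem_preimage, Set.mem_Ioc, Set.mem_Ici]
    constructor
    · rintro ⟨⟨h1, h2⟩, h3⟩
      exact ⟨Real.lt_toNNReal_iff_coe_lt.1 h1, Real.toNNReal_le_iff_le_coe.1 h2⟩
    · rintro ⟨h1, h2⟩
      exact ⟨⟨Real.lt_toNNReal_iff_coe_lt.2 h1, Real.toNNReal_le_iff_le_coe.2 h2⟩,
        le_trans u.2 h1.le⟩
  rw [this, Real.volume_Ioc]

lemma timeMeasure_singleton (u : ℝ≥0) : timeMeasure {u} = 0 := by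
  unfold timeMeasure
  rw [Measure.map_apply measurable_real_toNNReal (measurableSet_singleton u),
    Measure.restrict_apply (measurable_real_toNNReal (measurableSet_singleton u))]
  refine measure_mono_null (t := {(u : ℝ)}) ?_ (by simp)
  rintro x ⟨h1, h2⟩
  simp only [Set.mem_preimage, Set.mem_singleton_iff] at h1
  simp [← h1, Set.mem_Ici.1 h2]

instance : NullSingletonClass timeMeasure := ⟨timeMeasure_singleton⟩

lemma timeMeasure_apply_Iic (v : ℝ≥0) : timeMeasure (Set.Iic v) = v := by
  have h : Set.Iic v = {0} ∪ Set.Ioc 0 v := by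
    ext x
    simp only [Set.mem_Iic, Set.singleton_union, Set.mem_insert_iff, Set.mem_Ioc]
    rcases eq_or_ne x 0 with rfl | hx
    · simp
    · simp [hx, pos_iff_ne_zero]
  apply le_antisymm
  · rw [h]
    refine (measure_union_le _ _).trans ?_
    simp [timeMeasure_apply_Ioc]
  · rw [h]
    refine le_trans ?_ (measure_mono Set.subset_union_right)
    simp [timeMeasure_apply_Ioc]

instance (T : ℝ≥0) : IsFiniteMeasure (timeMeasure.restrict (Set.Iic T)) :=
  ⟨by simp [timeMeasure_apply_Iic]⟩

instance : IsLocallyFiniteMeasure timeMeasure :=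
  ⟨fun x => ⟨Set.Iic (x + 1), Iic_mem_nhds (lt_add_of_pos_right x one_pos),
    by simp [timeMeasure_apply_Iic]⟩⟩

lemma map_coe_timeMeasure :
    (timeMeasure : Measure ℝ≥0).map (fun x : ℝ≥0 => (x : ℝ)) = volume.restrict (Set.Ici 0) := by
  unfold timeMeasure
  rw [Measure.map_map measurable_coe_nnreal_real measurable_real_toNNReal]
  have : (volume.restrict (Set.Ici (0 : ℝ))).map ((fun x : ℝ≥0 => (x : ℝ)) ∘ Real.toNNReal)
      = (volume.restrict (Set.Ici (0 : ℝ))).map id := by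
    apply Measure.map_congr
    filter_upwards [ae_restrict_mem measurableSet_Ici] with x hx
    simp [Set.mem_Ici.1 hx]
  rw [this, Measure.map_id]

/-- Integrals over `[0, T]` of functions given on the real line. -/
lemma setIntegral_timeMeasure (f : ℝ → ℝ) (u v : ℝ≥0) (huv : u ≤ v) :
    ∫ s in Set.Ioc u v, f s ∂timeMeasure = ∫ x in (u : ℝ)..v, f x := by
  have hemb : MeasurableEmbedding (fun x : ℝ≥0 => (x : ℝ)) :=
    MeasurableEmbedding.subtype_coe measurableSet_Ici
  have h1 : Set.Ioc u v = (fun x : ℝ≥0 => (x : ℝ)) ⁻¹' Set.Ioc (u : ℝ) v := by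
    ext x; simp
  rw [h1, ← hemb.setIntegral_map, map_coe_timeMeasure, Measure.restrict_restrict measurableSet_Ioc,
    intervalIntegral.integral_of_le (by exact_mod_cast huv)]
  congr 2
  ext x
  simp only [Set.mem_inter_iff, Set.mem_Ioc, Set.mem_Ici, and_iff_left_iff_imp]
  exact fun h => le_trans u.2 h.1.le

lemma Iic_ae_eq_Ioc (T : ℝ≥0) : Set.Iic T =ᵐ[timeMeasure] Set.Ioc 0 T := by
  have h : Set.Ioc 0 T = Set.Iic T \ {0} := by
    ext x; simp [pos_iff_ne_zero, and_comm]
  rw [h]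
  exact (sdiff_null_ae_eq_self (timeMeasure_singleton 0)).symm

lemma setIntegral_Iic_timeMeasure (f : ℝ → ℝ) (T : ℝ≥0) :
    ∫ s in Set.Iic T, f s ∂timeMeasure = ∫ x in (0 : ℝ)..T, f x := by
  rw [setIntegral_congr_set (Iic_ae_eq_Ioc T)]
  exact setIntegral_timeMeasure f 0 T zero_le

lemma mul_intervalIntegral_exp (δ u v : ℝ) :
    ∫ x in u..v, δ * Real.exp (-δ * x) = Real.exp (-δ * u) - Real.exp (-δ * v) := by
  rw [intervalIntegral.integral_eq_sub_of_hasDerivAt (f := fun x => -Real.exp (-δ * x))]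
  · ring
  · intro x _
    have h := ((hasDerivAt_id' x).const_mul (-δ)).exp.fun_neg
    exact h.congr_deriv (by ring)
  · exact Continuous.intervalIntegrable (by fun_prop) _ _

lemma integral_exp_Iic (δ : ℝ) (T : ℝ≥0) :
    ∫ s in Set.Iic T, δ * Real.exp (-δ * s) ∂timeMeasure = 1 - Real.exp (-δ * T) := by
  rw [setIntegral_Iic_timeMeasure (fun x => δ * Real.exp (-δ * x)), mul_intervalIntegral_exp]
  simp

/-- Integration by parts for primitives, by Fubini's theorem on the two halves of a square. -/
lemma integral_mul_integral {f g : ℝ≥0 → ℝ} {T : ℝ≥0} (hf : IntegrableOn f (Set.Iic T) timeMeasure)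
    (hg : IntegrableOn g (Set.Iic T) timeMeasure) :
    (∫ s in Set.Iic T, f s ∂timeMeasure) * ∫ s in Set.Iic T, g s ∂timeMeasure =
      (∫ s in Set.Iic T, f s * ∫ r in Set.Iic s, g r ∂timeMeasure ∂timeMeasure) +
      ∫ s in Set.Iic T, g s * ∫ r in Set.Iic s, f r ∂timeMeasure ∂timeMeasure := by
  set ν := timeMeasure.restrict (Set.Iic T) with hν
  have hfg : Integrable (fun z : ℝ≥0 × ℝ≥0 => f z.1 * g z.2) (ν.prod ν) := hf.mul_prod hg
  have hA : MeasurableSet {z : ℝ≥0 × ℝ≥0 | z.2 ≤ z.1} :=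
    measurableSet_le measurable_snd measurable_fst
  have hB : MeasurableSet {z : ℝ≥0 × ℝ≥0 | z.1 ≤ z.2} :=
    measurableSet_le measurable_fst measurable_snd
  have hnull : (ν.prod ν) {z : ℝ≥0 × ℝ≥0 | z.1 = z.2} = 0 := by
    rw [Measure.prod_apply (measurableSet_eq_fun measurable_fst measurable_snd)]
    have : ∀ x : ℝ≥0, (Prod.mk x ⁻¹' {z : ℝ≥0 × ℝ≥0 | z.1 = z.2}) = {x} := by
      intro x; ext y; simp [eq_comm]
    simp only [this, measure_singleton, lintegral_zero]
  have inner : ∀ h : ℝ≥0 → ℝ, ∀ s ≤ T, ∫ r in Set.Iic s, h r ∂timeMeasure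
      = ∫ r, (Set.Iic s).indicator h r ∂ν := by
    intro h s hs
    rw [integral_indicator measurableSet_Iic, hν, Measure.restrict_restrict measurableSet_Iic,
      Set.inter_eq_left.2 (Set.Iic_subset_Iic.2 hs)]
  have e1 : (∫ s in Set.Iic T, f s * ∫ r in Set.Iic s, g r ∂timeMeasure ∂timeMeasure)
      = ∫ z in {z : ℝ≥0 × ℝ≥0 | z.2 ≤ z.1}, f z.1 * g z.2 ∂(ν.prod ν) := by
    rw [← integral_indicator hA, integral_prod _ (hfg.indicator hA)]
    refine setIntegral_congr_fun measurableSet_Iic fun s hs => ?_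
    rw [inner g s hs, ← integral_const_mul]
    refine integral_congr_ae (Eventually.of_forall fun r => ?_)
    by_cases hr : r ≤ s <;> simp [Set.indicator, hr]
  have e2 : (∫ s in Set.Iic T, g s * ∫ r in Set.Iic s, f r ∂timeMeasure ∂timeMeasure)
      = ∫ z in {z : ℝ≥0 × ℝ≥0 | z.1 ≤ z.2}, f z.1 * g z.2 ∂(ν.prod ν) := by
    rw [← integral_indicator hB, integral_prod_symm _ (hfg.indicator hB)]
    refine setIntegral_congr_fun measurableSet_Iic fun s hs => ?_
    rw [inner f s hs, ← integral_const_mul]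
    refine integral_congr_ae (Eventually.of_forall fun r => ?_)
    by_cases hr : r ≤ s <;> simp [Set.indicator, hr, mul_comm]
  rw [e1, e2, ← integral_prod_mul, ← integral_add_compl hA hfg]
  congr 1
  refine setIntegral_congr_set ?_
  rw [ae_eq_set]
  constructor
  · refine measure_mono_null ?_ hnull
    rintro ⟨a, b⟩ ⟨h1, h2⟩
    simp only [Set.mem_compl_iff, Set.mem_ofPred_eq, not_le] at h1 h2
    exact absurd h1 (not_lt.2 h2.le)
  · refine measure_mono_null ?_ hnull
    rintro ⟨a, b⟩ ⟨h1, h2⟩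
    simp only [Set.mem_compl_iff, Set.mem_ofPred_eq, not_le, not_lt] at h1 h2 ⊢
    exact le_antisymm h1 h2

/-- The weighted supremum argument behind Gronwall's inequality, in integrated form: integration
gains a factor `1 / θ` in `L¹` with weight `e^{-θt}`. -/
lemma lintegral_exp_primitive_le {f : ℝ≥0 → ℝ≥0∞} (hf : Measurable f) {θ : ℝ} (hθ : 0 < θ)
    (T : ℝ≥0) :
    ENNReal.ofReal θ * ∫⁻ t in Set.Iic T, ENNReal.ofReal (Real.exp (-θ * t)) *
        ∫⁻ s in Set.Iic t, f s ∂timeMeasure ∂timeMeasure ≤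
      ∫⁻ s in Set.Iic T, ENNReal.ofReal (Real.exp (-θ * s)) * f s ∂timeMeasure := by
  set ν := timeMeasure.restrict (Set.Iic T) with hν
  have hm : Measurable fun z : ℝ≥0 × ℝ≥0 => {z : ℝ≥0 × ℝ≥0 | z.2 ≤ z.1}.indicator
      (fun z => ENNReal.ofReal (Real.exp (-θ * z.1)) * f z.2) z := by
    refine Measurable.indicator ?_ (measurableSet_le measurable_snd measurable_fst)
    fun_prop
  have e1 : ∫⁻ t, ENNReal.ofReal (Real.exp (-θ * t)) * ∫⁻ s in Set.Iic t, f s ∂timeMeasure ∂ν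
      = ∫⁻ t, ∫⁻ s, {z : ℝ≥0 × ℝ≥0 | z.2 ≤ z.1}.indicator
        (fun z => ENNReal.ofReal (Real.exp (-θ * z.1)) * f z.2) (t, s) ∂ν ∂ν := by
    refine setLIntegral_congr_fun measurableSet_Iic fun t ht => ?_
    rw [← lintegral_const_mul _ hf, ← Set.inter_eq_left.2 (Set.Iic_subset_Iic.2 ht),
      ← Measure.restrict_restrict measurableSet_Iic, ← lintegral_indicator measurableSet_Iic]
    refine lintegral_congr fun s => ?_
    by_cases hs : s ≤ t <;> simp [Set.indicator, hs]
  rw [e1, lintegral_lintegral_swap hm.aemeasurable, ← lintegral_const_mul]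
  swap
  · exact Measurable.lintegral_prod_right' (f := fun z : ℝ≥0 × ℝ≥0 =>
      {z : ℝ≥0 × ℝ≥0 | z.2 ≤ z.1}.indicator
        (fun z => ENNReal.ofReal (Real.exp (-θ * z.1)) * f z.2) z.swap) (hm.comp measurable_swap)
  refine lintegral_mono fun s => ?_
  have hs : ∀ t : ℝ≥0, {z : ℝ≥0 × ℝ≥0 | z.2 ≤ z.1}.indicator
      (fun z => ENNReal.ofReal (Real.exp (-θ * z.1)) * f z.2) (t, s)
      = (Set.Ici s).indicator (fun t : ℝ≥0 => ENNReal.ofReal (Real.exp (-θ * t))) t * f s := by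
    intro t
    by_cases h : s ≤ t <;> simp [Set.indicator, h]
  simp_rw [hs]
  have hm2 : Measurable fun t : ℝ≥0 => ENNReal.ofReal (Real.exp (-θ * t)) := by fun_prop
  rw [lintegral_mul_const _ (hm2.indicator measurableSet_Ici), ← mul_assoc]
  gcongr
  rw [lintegral_indicator measurableSet_Ici, hν, Measure.restrict_restrict measurableSet_Ici]
  by_cases hsT : s ≤ T
  · have : (Set.Ici s ∩ Set.Iic T : Set ℝ≥0) =ᵐ[timeMeasure] Set.Ioc s T :=
      (Ioc_ae_eq_Icc (μ := timeMeasure)).symm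
    rw [setLIntegral_congr this, ← ofReal_integral_eq_lintegral_ofReal, ← ENNReal.ofReal_mul hθ.le]
    · refine ENNReal.ofReal_le_ofReal ?_
      rw [← integral_const_mul, setIntegral_timeMeasure (fun x => θ * Real.exp (-θ * x)) s T hsT,
        mul_intervalIntegral_exp]
      exact sub_le_self _ (Real.exp_pos _).le
    · exact (Continuous.integrableOn_Icc (by fun_prop)).mono_set Set.Ioc_subset_Icc_self
    · exact Eventually.of_forall fun _ => (Real.exp_pos _).le
  · have : (Set.Ici s ∩ Set.Iic T : Set ℝ≥0) = ∅ := by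
      ext x
      simp only [Set.mem_inter_iff, Set.mem_Ici, Set.mem_Iic, Set.mem_empty_iff_false, iff_false,
        not_and, not_le]
      exact fun h => lt_of_lt_of_le (not_le.1 hsT) h
    simp [this]

/-- Primitives of locally integrable functions are continuous. -/
lemma continuous_primitive {f : ℝ≥0 → ℝ} (hf : ∀ T, IntegrableOn f (Set.Iic T) timeMeasure) :
    Continuous fun t => ∫ s in Set.Iic t, f s ∂timeMeasure := by
  rw [continuous_iff_continuousAt]
  intro t
  have h1 : (fun t => ∫ s in Set.Iic t, f s ∂timeMeasure) =ᶠ[𝓝 t]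
      fun t' => ∫ s in Set.Iic (t + 1), (Set.Iic t').indicator f s ∂timeMeasure := by
    filter_upwards [Iic_mem_nhds (lt_add_of_pos_right t one_pos)] with t' ht'
    rw [integral_indicator measurableSet_Iic, Measure.restrict_restrict measurableSet_Iic,
      Set.inter_eq_left.2 (Set.Iic_subset_Iic.2 ht')]
  refine ContinuousAt.congr ?_ h1.symm
  refine tendsto_integral_filter_of_dominated_convergence (fun s => ‖f s‖)
    (Eventually.of_forall fun t' => (hf (t + 1)).aestronglyMeasurable.indicator measurableSet_Iic)
    (Eventually.of_forall fun t' => Eventually.of_forall fun s => norm_indicator_le_norm_self _ _)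
    (hf (t + 1)).norm ?_
  have h2 : ∀ᵐ s ∂(timeMeasure.restrict (Set.Iic (t + 1))), s ≠ t := by
    refine ae_restrict_of_ae ?_
    rw [ae_iff]
    simp
  filter_upwards [h2] with s hs
  refine Tendsto.congr' ?_ tendsto_const_nhds
  rcases lt_or_gt_of_ne hs with h | h
  · filter_upwards [Ici_mem_nhds h] with t' ht'
    simp [Set.indicator, h.le, Set.mem_Ici.1 ht']
  · filter_upwards [Iio_mem_nhds h] with t' ht'
    simp [Set.indicator, not_le.2 h, not_le.2 (Set.mem_Iio.1 ht')]

/-! ### Second moments and joint measurability -/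

lemma eLpNorm_two_sq {α : Type*} [MeasurableSpace α] (μ : Measure α) (f : α → ℝ) :
    eLpNorm f 2 μ ^ 2 = ∫⁻ x, ENNReal.ofReal (f x ^ 2) ∂μ := by
  have h := eLpNorm_nnreal_pow_eq_lintegral (μ := μ) (f := f) (p := 2) (by norm_num)
  have h2 : ((2 : ℝ≥0) : ℝ) = ((2 : ℕ) : ℝ) := by norm_num
  rw [h2, ENNReal.rpow_natCast] at h
  refine Eq.trans (by norm_num) (h.trans (lintegral_congr fun x => ?_))
  rw [ENNReal.rpow_natCast, Real.enorm_eq_ofReal_abs, ← ENNReal.ofReal_pow (abs_nonneg _), sq_abs]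

lemma eLpNorm_two_sq_eq_ofReal {α : Type*} [MeasurableSpace α] {μ : Measure α} {f : α → ℝ}
    (hf : MemLp f 2 μ) : eLpNorm f 2 μ ^ 2 = ENNReal.ofReal (∫ x, f x ^ 2 ∂μ) := by
  rw [eLpNorm_two_sq, ofReal_integral_eq_lintegral_ofReal hf.integrable_sq
    (Eventually.of_forall fun _ => sq_nonneg _)]

lemma eLpNorm_two_eq_of_integral_sq_eq {α β : Type*} [MeasurableSpace α] [MeasurableSpace β]
    {μ : Measure α} {ν : Measure β} {f : α → ℝ} {g : β → ℝ} (hf : MemLp f 2 μ) (hg : MemLp g 2 ν)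
    (h : ∫ x, f x ^ 2 ∂μ = ∫ x, g x ^ 2 ∂ν) : eLpNorm f 2 μ = eLpNorm g 2 ν := by
  refine (ENNReal.pow_right_strictMono two_ne_zero).injective ?_
  rw [eLpNorm_two_sq_eq_ofReal hf, eLpNorm_two_sq_eq_ofReal hg, h]

lemma memLp_two_bdd_mul {α : Type*} [MeasurableSpace α] {μ : Measure α} {f g : α → ℝ} {K : ℝ}
    (hf : MemLp f 2 μ) (hg : AEStronglyMeasurable g μ) (hK : ∀ x, |g x| ≤ K) :
    MemLp (fun x => g x * f x) 2 μ :=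
  MemLp.mul' (p := ∞) (q := 2) hf (memLp_top_of_bound hg K (Eventually.of_forall hK))

variable {Ω : Type*} [mΩ : MeasurableSpace Ω] {P : Measure Ω} {𝓕 : Filtration ℝ≥0 mΩ}
  {W : ℝ≥0 → Ω → ℝ}

lemma _root_.MeasureTheory.IsProgressive.measurable_uncurry {β : Type*} [MeasurableSpace β]
    {f : ℝ≥0 → Ω → β}
    (hf : IsProgressive 𝓕 f) : Measurable fun z : Ω × ℝ≥0 => f z.2 z.1 := by
  intro A hA
  have hU : (fun z : Ω × ℝ≥0 => f z.2 z.1) ⁻¹' A =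
      ⋃ n : ℕ, ((fun z : Ω × ℝ≥0 => f z.2 z.1) ⁻¹' A ∩ {z | z.2 ≤ (n : ℝ≥0)}) := by
    ext z
    simp only [Set.mem_preimage, Set.mem_iUnion, Set.mem_inter_iff, Set.mem_ofPred_eq,
      exists_and_left]
    exact ⟨fun h => ⟨h, exists_nat_ge z.2⟩, fun h => h.1⟩
  rw [hU]
  refine MeasurableSet.iUnion fun n => ?_
  have h1 : Measurable fun p : Set.Iic (n : ℝ≥0) × Ω => f p.1 p.2 :=
    (hf n).mono (sup_le_sup le_rfl (MeasurableSpace.comap_mono (𝓕.le n))) le_rfl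
  have hemb : MeasurableEmbedding
      (fun p : Ω × Set.Iic (n : ℝ≥0) => ((p.1, (p.2 : ℝ≥0)) : Ω × ℝ≥0)) :=
    MeasurableEmbedding.id.prodMap (MeasurableEmbedding.subtype_coe measurableSet_Iic)
  have h2 := hemb.measurableSet_image.2 ((h1.comp measurable_swap) hA)
  convert h2 using 1
  ext ⟨ω, t⟩
  simp only [Set.mem_inter_iff, Set.mem_preimage, Set.mem_ofPred_eq, Set.mem_image, Prod.exists,
    Prod.mk.injEq, Function.comp_apply, Prod.swap_prod_mk, Subtype.exists, Set.mem_Iic]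
  constructor
  · rintro ⟨h, h'⟩
    exact ⟨ω, t, h', h, rfl, rfl⟩
  · rintro ⟨_, _, h', h, rfl, rfl⟩
    exact ⟨h, h'⟩

lemma _root_.MeasureTheory.IsStronglyProgressive.measurable_uncurry {f : ℝ≥0 → Ω → ℝ}
    (hf : IsStronglyProgressive 𝓕 f) : Measurable fun z : Ω × ℝ≥0 => f z.2 z.1 :=
  hf.isProgressive.measurable_uncurry

/-- `P ⊗ dt` on `Ω × [0, T]`. -/
def pathMeasure (P : Measure Ω) (T : ℝ≥0) : Measure (Ω × ℝ≥0) :=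
  P.prod (timeMeasure.restrict (Set.Iic T))

instance [IsFiniteMeasure P] (T : ℝ≥0) : IsFiniteMeasure (pathMeasure P T) := by
  unfold pathMeasure; infer_instance

lemma energy_eq_lintegral [SFinite P] {f : ℝ≥0 → Ω → ℝ}
    (hf : Measurable fun z : Ω × ℝ≥0 => f z.2 z.1) (T : ℝ≥0) :
    energy P f T = ∫⁻ z, ENNReal.ofReal (f z.2 z.1 ^ 2) ∂(pathMeasure P T) := by
  rw [pathMeasure, lintegral_prod _ (hf.pow_const 2).ennreal_ofReal.aemeasurable]
  rfl

lemma energy_eq [SFinite P] {f : ℝ≥0 → Ω → ℝ}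
    (hf : Measurable fun z : Ω × ℝ≥0 => f z.2 z.1) (T : ℝ≥0) :
    energy P f T = eLpNorm (fun z : Ω × ℝ≥0 => f z.2 z.1) 2 (pathMeasure P T) ^ 2 := by
  rw [energy_eq_lintegral hf, eLpNorm_two_sq]

lemma memLp_of_energy_lt_top [SFinite P] {f : ℝ≥0 → Ω → ℝ}
    (hf : Measurable fun z : Ω × ℝ≥0 => f z.2 z.1) {T : ℝ≥0} (h : energy P f T < ∞) :
    MemLp (fun z : Ω × ℝ≥0 => f z.2 z.1) 2 (pathMeasure P T) := by
  refine ⟨hf.aestronglyMeasurable, ?_⟩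
  rw [energy_eq hf] at h
  by_contra hc
  simp only [not_lt, top_le_iff] at hc
  simp [hc] at h

/-! ### Brownian increments -/

namespace IsBrownianBasis

lemma memLp_increment (hW : IsBrownianBasis P 𝓕 W) (s t : ℝ≥0) :
    MemLp (fun ω => W t ω - W s ω) 2 P := by
  have hl := (hW.brownian.toIsPreBrownianReal).hasLaw_sub t s
  have h : MemLp id 2 (P.map (W t - W s)) := by
    rw [hl.map_eq]
    exact memLp_id_gaussianReal 2
  rw [memLp_map_measure_iff aestronglyMeasurable_id hl.aemeasurable] at h
  exact h

lemma indepFun_increment (hW : IsBrownianBasis P 𝓕 W) {s t : ℝ≥0} (hst : s ≤ t) {Z : Ω → ℝ}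
    (hZ : StronglyMeasurable[𝓕 s] Z) : IndepFun Z (fun ω => W t ω - W s ω) P := by
  rw [IndepFun_iff_Indep]
  exact indep_of_indep_of_le_left (hW.indep s t hst).symm hZ.measurable.comap_le

lemma integrable_mul_increment [IsProbabilityMeasure P] (hW : IsBrownianBasis P 𝓕 W) {s t : ℝ≥0}
    (hst : s ≤ t) {Z : Ω → ℝ} (hZ : StronglyMeasurable[𝓕 s] Z) (hZi : Integrable Z P) :
    Integrable (fun ω => Z ω * (W t ω - W s ω)) P :=
  (hW.indepFun_increment hst hZ).integrable_mul hZi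
    ((hW.memLp_increment s t).integrable one_le_two)

lemma integral_mul_increment [IsProbabilityMeasure P] (hW : IsBrownianBasis P 𝓕 W) {s t : ℝ≥0}
    (hst : s ≤ t) {Z : Ω → ℝ} (hZ : StronglyMeasurable[𝓕 s] Z) :
    ∫ ω, Z ω * (W t ω - W s ω) ∂P = 0 := by
  have h := (hW.indepFun_increment hst hZ).integral_mul_eq_mul_integral
    ((hZ.mono (𝓕.le s)).aestronglyMeasurable) (hW.memLp_increment s t).aestronglyMeasurable
  have h0 : ∫ ω, (W t ω - W s ω) ∂P = 0 := by
    have hB := hW.brownian.toIsPreBrownianReal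
    rw [integral_sub (hB.integrable_eval t) (hB.integrable_eval s), hB.integral_eval t,
      hB.integral_eval s, sub_zero]
  rw [h0, mul_zero] at h
  exact h

lemma integrable_mul_increment_sq [IsProbabilityMeasure P] (hW : IsBrownianBasis P 𝓕 W) {s t : ℝ≥0}
    (hst : s ≤ t) {Z : Ω → ℝ} (hZ : StronglyMeasurable[𝓕 s] Z) (hZi : Integrable Z P) :
    Integrable (fun ω => Z ω * (W t ω - W s ω) ^ 2) P :=
  ((hW.indepFun_increment hst hZ).comp measurable_id
    (measurable_id.pow_const 2 : Measurable fun x : ℝ => x ^ 2)).integrable_mul hZi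
    (hW.memLp_increment s t).integrable_sq

lemma integral_increment_sq [IsProbabilityMeasure P] (hW : IsBrownianBasis P 𝓕 W) {s t : ℝ≥0}
    (hst : s ≤ t) : ∫ ω, (W t ω - W s ω) ^ 2 ∂P = t - s := by
  have hl := (hW.brownian.toIsPreBrownianReal).hasLaw_sub t s
  have h := hl.variance_eq
  rw [variance_id_gaussianReal, variance_eq_integral hl.aemeasurable,
    hl.integral_eq, integral_id_gaussianReal] at h
  simp only [Pi.sub_apply, sub_zero] at h
  rw [h, coe_nndist]
  change |(t : ℝ) - s| = t - s
  exact abs_of_nonneg (sub_nonneg.2 (by exact_mod_cast hst))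

lemma integral_mul_increment_sq [IsProbabilityMeasure P] (hW : IsBrownianBasis P 𝓕 W) {s t : ℝ≥0}
    (hst : s ≤ t) {Z : Ω → ℝ} (hZ : StronglyMeasurable[𝓕 s] Z) :
    ∫ ω, Z ω * (W t ω - W s ω) ^ 2 ∂P = (∫ ω, Z ω ∂P) * (t - s) := by
  have h := ((hW.indepFun_increment hst hZ).comp measurable_id
    (measurable_id.pow_const 2 : Measurable fun x : ℝ => x ^ 2)).integral_mul_eq_mul_integral
    ((hZ.mono (𝓕.le s)).aestronglyMeasurable)
    (hW.memLp_increment s t).integrable_sq.aestronglyMeasurable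
  have h2 := hW.integral_increment_sq hst
  simp only [Function.comp_def, id_eq] at h
  rw [h2] at h
  exact h

/-- The covariance of two elementary integrals `ξ (W_v - W_u)` and `ξ' (W_{v'} - W_{u'})`, when
the first interval begins first. -/
lemma integral_elementary_mul_of_le [IsProbabilityMeasure P] (hW : IsBrownianBasis P 𝓕 W)
    {u v u' v' : ℝ≥0} (huv' : u' ≤ v') (huu' : u ≤ u') {ξ ξ' : Ω → ℝ}
    (hξ : StronglyMeasurable[𝓕 u] ξ) (hξ' : StronglyMeasurable[𝓕 u'] ξ')
    {K K' : ℝ} (hK : ∀ ω, |ξ ω| ≤ K) (hK' : ∀ ω, |ξ' ω| ≤ K') :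
    ∫ ω, ξ ω * (W v ω - W u ω) * (ξ' ω * (W v' ω - W u' ω)) ∂P =
      (∫ ω, ξ ω * ξ' ω ∂P) * (timeMeasure (Set.Ioc u v ∩ Set.Ioc u' v')).toReal := by
  have hprod : StronglyMeasurable[𝓕 u'] fun ω => ξ ω * ξ' ω := (hξ.mono (𝓕.mono huu')).mul hξ'
  have hbdd : ∀ ω, ‖ξ ω * ξ' ω‖ ≤ K * K' := fun ω => by
    rw [norm_mul]
    exact mul_le_mul (hK ω) (hK' ω) (abs_nonneg _) ((abs_nonneg _).trans (hK ω))
  have hint : ∀ (a b : ℝ≥0), Integrable (fun ω => ξ ω * ξ' ω * (W b ω - W a ω)) P := fun a b =>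
    ((hW.memLp_increment a b).integrable one_le_two).bdd_mul
      (hprod.mono (𝓕.le u')).aestronglyMeasurable (Eventually.of_forall hbdd)
  have hmeas : ∀ {a b c : ℝ≥0}, a ≤ c → b ≤ c → u' ≤ c →
      StronglyMeasurable[𝓕 c] fun ω => ξ ω * ξ' ω * (W b ω - W a ω) := fun {a b c} ha hb hc =>
    (hprod.mono (𝓕.mono hc)).mul (((hW.adapted b).mono (𝓕.mono hb)).sub
      ((hW.adapted a).mono (𝓕.mono ha)))
  rcases le_or_gt v u' with h | h
  · have h0 : Set.Ioc u v ∩ Set.Ioc u' v' = ∅ := by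
      ext x
      simp only [Set.mem_inter_iff, Set.mem_Ioc, Set.mem_empty_iff_false, iff_false]
      rintro ⟨⟨_, h1⟩, h2, _⟩
      exact absurd (h1.trans h) (not_le.2 h2)
    rw [h0, measure_empty, ENNReal.toReal_zero, mul_zero,
      ← hW.integral_mul_increment huv' (hmeas huu' h le_rfl)]
    exact integral_congr_ae (Eventually.of_forall fun ω => by ring)
  · set b := min v v' with hb
    have hub : u' ≤ b := le_min h.le huv'
    have h0 : Set.Ioc u v ∩ Set.Ioc u' v' = Set.Ioc u' b := by
      rw [Set.Ioc_inter_Ioc, sup_eq_right.2 huu']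
    have hz : ∀ ω, (W v ω - W b ω) * (W v' ω - W b ω) = 0 := fun ω => by
      rcases le_total v v' with h' | h'
      · simp [hb, h']
      · simp [hb, h']
    have e : ∀ ω, ξ ω * (W v ω - W u ω) * (ξ' ω * (W v' ω - W u' ω)) =
        ξ ω * ξ' ω * (W b ω - W u' ω) * (W v ω - W b ω) +
        ξ ω * ξ' ω * (W b ω - W u' ω) * (W v' ω - W b ω) +
        ξ ω * ξ' ω * (W u' ω - W u ω) * (W v' ω - W u' ω) +
        ξ ω * ξ' ω * (W b ω - W u' ω) ^ 2 := fun ω => by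
      linear_combination (ξ ω * ξ' ω) * hz ω
    have hbv : b ≤ v := min_le_left _ _
    have hbv' : b ≤ v' := min_le_right _ _
    have m1 := hmeas (a := u') (b := b) (c := b) hub le_rfl hub
    have m2 := hmeas (a := u) (b := u') (c := u') huu' le_rfl le_rfl
    have hi : Integrable (fun ω => ξ ω * ξ' ω) P := Integrable.of_bound
      (hprod.mono (𝓕.le u')).aestronglyMeasurable (K * K') (Eventually.of_forall hbdd)
    have i1 := hW.integrable_mul_increment hbv m1 (hint _ _)
    have i2 := hW.integrable_mul_increment hbv' m1 (hint _ _)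
    have i3 := hW.integrable_mul_increment huv' m2 (hint _ _)
    have i4 := hW.integrable_mul_increment_sq hub hprod hi
    simp_rw [e]
    rw [integral_add ((i1.fun_add i2).fun_add i3) i4, integral_add (i1.fun_add i2) i3,
      integral_add i1 i2,
      hW.integral_mul_increment hbv m1, hW.integral_mul_increment hbv' m1,
      hW.integral_mul_increment huv' m2, hW.integral_mul_increment_sq hub hprod, h0,
      timeMeasure_apply_Ioc, ENNReal.toReal_ofReal (sub_nonneg.2 (by exact_mod_cast hub))]
    ring

lemma integral_elementary_mul [IsProbabilityMeasure P] (hW : IsBrownianBasis P 𝓕 W)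
    {u v u' v' : ℝ≥0} (huv : u ≤ v) (huv' : u' ≤ v') {ξ ξ' : Ω → ℝ}
    (hξ : StronglyMeasurable[𝓕 u] ξ) (hξ' : StronglyMeasurable[𝓕 u'] ξ')
    {K K' : ℝ} (hK : ∀ ω, |ξ ω| ≤ K) (hK' : ∀ ω, |ξ' ω| ≤ K') :
    ∫ ω, ξ ω * (W v ω - W u ω) * (ξ' ω * (W v' ω - W u' ω)) ∂P =
      (∫ ω, ξ ω * ξ' ω ∂P) * (timeMeasure (Set.Ioc u v ∩ Set.Ioc u' v')).toReal := by
  rcases le_total u u' with h | h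
  · exact hW.integral_elementary_mul_of_le huv' h hξ hξ' hK hK'
  · have := hW.integral_elementary_mul_of_le (v := v') huv h hξ' hξ hK' hK
    rw [Set.inter_comm]
    simp_rw [mul_comm (ξ _) (ξ' _)]
    rw [← this]
    exact integral_congr_ae (Eventually.of_forall fun ω => by ring)

end IsBrownianBasis

/-! ### The elementary stochastic integral -/

lemma Ioc_inter_Iic_eq (u v T : ℝ≥0) : Set.Ioc u v ∩ Set.Iic T = Set.Ioc (min u T) (min v T) := by
  ext x
  simp only [Set.mem_inter_iff, Set.mem_Ioc, Set.mem_Iic, min_lt_iff, le_min_iff]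
  constructor
  · rintro ⟨⟨h1, h2⟩, h3⟩
    exact ⟨Or.inl h1, h2, h3⟩
  · rintro ⟨h1 | h1, h2, h3⟩
    · exact ⟨⟨h1, h2⟩, h3⟩
    · exact absurd h3 (not_le.2 h1)

namespace SimpleProcess

lemma stronglyMeasurable_integral (hW : IsBrownianBasis P 𝓕 W) (H : SimpleProcess 𝓕) (t : ℝ≥0) :
    StronglyMeasurable[𝓕 t] (H.integral W t) := by
  refine Finset.stronglyMeasurable_fun_sum _ fun i _ => ?_
  rcases le_or_gt (H.time i) t with h | h
  · exact ((H.coef_measurable i).mono (𝓕.mono h)).mul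
      (((hW.adapted _).mono (𝓕.mono (min_le_right _ _))).sub
        ((hW.adapted _).mono (𝓕.mono (min_le_right _ _))))
  · have h2 : t ≤ H.time (i + 1) := h.le.trans (H.time_mono (Nat.le_succ i))
    simp only [min_eq_right h.le, min_eq_right h2, sub_self, mul_zero]
    exact stronglyMeasurable_const

lemma memLp_integral (hW : IsBrownianBasis P 𝓕 W) (H : SimpleProcess 𝓕) (t : ℝ≥0) :
    MemLp (H.integral W t) 2 P := by
  obtain ⟨K, hK⟩ := H.coef_bounded
  refine memLp_finsetSum _ fun i _ => ?_
  exact memLp_two_bdd_mul (hW.memLp_increment _ _)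
    ((H.coef_measurable i).mono (𝓕.le _)).aestronglyMeasurable (hK i)

lemma measurable_eval (H : SimpleProcess 𝓕) : Measurable fun z : Ω × ℝ≥0 => H.eval z.2 z.1 := by
  refine Finset.measurable_sum _ fun i _ => ?_
  have h1 : Measurable fun z : Ω × ℝ≥0 => H.coef i z.1 :=
    ((H.coef_measurable i).mono (𝓕.le _)).measurable.comp measurable_fst
  exact h1.indicator (measurable_snd (measurableSet_Ioc (a := H.time i) (b := H.time (i + 1))))

lemma exists_eval_bound (H : SimpleProcess 𝓕) : ∃ K : ℝ, ∀ s ω, |H.eval s ω| ≤ K := by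
  obtain ⟨K, hK⟩ := H.coef_bounded
  refine ⟨∑ i ∈ Finset.range H.size, |K|, fun s ω => (Finset.abs_sum_le_sum_abs _ _).trans
    (Finset.sum_le_sum fun i _ => ?_)⟩
  rw [Set.indicator_apply]
  split_ifs
  · exact (hK i ω).trans (le_abs_self K)
  · simp

lemma memLp_eval [IsFiniteMeasure P] (H : SimpleProcess 𝓕) (T : ℝ≥0) :
    MemLp (fun z : Ω × ℝ≥0 => H.eval z.2 z.1) 2 (pathMeasure P T) := by
  obtain ⟨K, hK⟩ := H.exists_eval_bound
  exact MemLp.of_bound H.measurable_eval.aestronglyMeasurable K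
    (Eventually.of_forall fun z => hK _ _)

/-- **Itô isometry** for elementary integrals, in polarized form. -/
lemma integral_mul_integral_eq [IsProbabilityMeasure P] (hW : IsBrownianBasis P 𝓕 W)
    (H G : SimpleProcess 𝓕) (T : ℝ≥0) :
    ∫ ω, H.integral W T ω * G.integral W T ω ∂P =
      ∫ z, H.eval z.2 z.1 * G.eval z.2 z.1 ∂(pathMeasure P T) := by
  obtain ⟨K, hK⟩ := H.coef_bounded
  obtain ⟨K', hK'⟩ := G.coef_bounded
  have hmH : ∀ i, AEStronglyMeasurable (H.coef i) P := fun i =>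
    ((H.coef_measurable i).mono (𝓕.le _)).aestronglyMeasurable
  have hmG : ∀ i, AEStronglyMeasurable (G.coef i) P := fun i =>
    ((G.coef_measurable i).mono (𝓕.le _)).aestronglyMeasurable
  have hc : ∀ i j, Integrable (fun ω => H.coef i ω * G.coef j ω) P := fun i j =>
    (Integrable.of_bound (hmG j) K' (Eventually.of_forall (hK' j))).bdd_mul (hmH i)
      (Eventually.of_forall (hK i))
  have e1 : ∀ ω, H.integral W T ω * G.integral W T ω =
      ∑ i ∈ Finset.range H.size, ∑ j ∈ Finset.range G.size,
        H.coef i ω * (W (min (H.time (i + 1)) T) ω - W (min (H.time i) T) ω) *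
        (G.coef j ω * (W (min (G.time (j + 1)) T) ω - W (min (G.time j) T) ω)) := fun ω => by
    rw [SimpleProcess.integral, SimpleProcess.integral, Finset.sum_mul_sum]
  have e2 : ∀ z : Ω × ℝ≥0, H.eval z.2 z.1 * G.eval z.2 z.1 =
      ∑ i ∈ Finset.range H.size, ∑ j ∈ Finset.range G.size, H.coef i z.1 * G.coef j z.1 *
        (Set.Ioc (H.time i) (H.time (i + 1)) ∩ Set.Ioc (G.time j) (G.time (j + 1))).indicator
          (fun _ => (1 : ℝ)) z.2 := fun z => by
    rw [SimpleProcess.eval, SimpleProcess.eval, Finset.sum_mul_sum]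
    refine Finset.sum_congr rfl fun i _ => Finset.sum_congr rfl fun j _ => ?_
    by_cases h1 : z.2 ∈ Set.Ioc (H.time i) (H.time (i + 1)) <;>
    by_cases h2 : z.2 ∈ Set.Ioc (G.time j) (G.time (j + 1)) <;> simp [Set.indicator, h1, h2]
  simp_rw [e1, e2]
  have hind : ∀ i j, Integrable ((Set.Ioc (H.time i) (H.time (i + 1)) ∩
      Set.Ioc (G.time j) (G.time (j + 1))).indicator (fun _ => (1 : ℝ)))
        (timeMeasure.restrict (Set.Iic T)) := fun i j =>
    (integrable_const _).indicator (measurableSet_Ioc.inter measurableSet_Ioc)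
  rw [integral_finsetSum, integral_finsetSum]
  rotate_left
  · exact fun i _ => integrable_finsetSum _ fun j _ => (hc i j).mul_prod (hind i j)
  · refine fun i _ => integrable_finsetSum _ fun j _ => ?_
    refine MemLp.integrable_mul (p := 2) (q := 2) ?_ ?_
    · exact memLp_two_bdd_mul (hW.memLp_increment _ _) (hmH i) (hK i)
    · exact memLp_two_bdd_mul (hW.memLp_increment _ _) (hmG j) (hK' j)
  refine Finset.sum_congr rfl fun i _ => ?_
  rw [integral_finsetSum, integral_finsetSum]
  rotate_left
  · exact fun j _ => (hc i j).mul_prod (hind i j)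
  · refine fun j _ => ?_
    refine MemLp.integrable_mul (p := 2) (q := 2) ?_ ?_
    · exact memLp_two_bdd_mul (hW.memLp_increment _ _) (hmH i) (hK i)
    · exact memLp_two_bdd_mul (hW.memLp_increment _ _) (hmG j) (hK' j)
  refine Finset.sum_congr rfl fun j _ => ?_
  rw [pathMeasure, integral_prod_mul (fun ω => H.coef i ω * G.coef j ω)]
  rw [integral_indicator_const _ (measurableSet_Ioc.inter measurableSet_Ioc), smul_eq_mul, mul_one,
    Measure.real, Measure.restrict_apply (measurableSet_Ioc.inter measurableSet_Ioc)]
  have hset : Set.Ioc (H.time i) (H.time (i + 1)) ∩ Set.Ioc (G.time j) (G.time (j + 1)) ∩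
      Set.Iic T = Set.Ioc (min (H.time i) T) (min (H.time (i + 1)) T) ∩
        Set.Ioc (min (G.time j) T) (min (G.time (j + 1)) T) := by
    rw [← Ioc_inter_Iic_eq, ← Ioc_inter_Iic_eq, ← Set.inter_inter_distrib_right]
  rw [hset]
  have hH := H.time_mono (Nat.le_succ i)
  have hG := G.time_mono (Nat.le_succ j)
  rcases le_or_gt T (H.time i) with h | h
  · simp [min_eq_right h, min_eq_right (h.trans hH)]
  rcases le_or_gt T (G.time j) with h' | h'
  · simp [min_eq_right h', min_eq_right (h'.trans hG)]
  exact hW.integral_elementary_mul (min_le_min_right _ hH) (min_le_min_right _ hG)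
    (by rw [min_eq_left h.le]; exact H.coef_measurable i)
    (by rw [min_eq_left h'.le]; exact G.coef_measurable j) (hK i) (hK' j)

/-- **Itô isometry** for the difference of two elementary integrals. -/
lemma eLpNorm_integral_sub [IsProbabilityMeasure P] (hW : IsBrownianBasis P 𝓕 W)
    (H G : SimpleProcess 𝓕) (T : ℝ≥0) :
    eLpNorm (fun ω => H.integral W T ω - G.integral W T ω) 2 P =
      eLpNorm (fun z : Ω × ℝ≥0 => H.eval z.2 z.1 - G.eval z.2 z.1) 2 (pathMeasure P T) := by
  have m1 := H.memLp_integral hW T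
  have m2 := G.memLp_integral hW T
  have n1 := H.memLp_eval (P := P) T
  have n2 := G.memLp_eval (P := P) T
  refine eLpNorm_two_eq_of_integral_sq_eq (m1.sub m2) (n1.sub n2) ?_
  have e : ∀ a b : ℝ, (a - b) ^ 2 = a * a - 2 * (a * b) + b * b := fun a b => by ring
  simp_rw [e]
  have i1 := m1.integrable_mul m1
  have i2 := (m1.integrable_mul m2).const_mul 2
  have i3 := m2.integrable_mul m2
  have j1 := n1.integrable_mul n1
  have j2 := (n1.integrable_mul n2).const_mul 2
  have j3 := n2.integrable_mul n2
  rw [integral_add, integral_sub, integral_add, integral_sub, integral_const_mul,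
    integral_const_mul, integral_mul_integral_eq hW, integral_mul_integral_eq hW,
    integral_mul_integral_eq hW]
  exacts [j1, j2, j1.sub j2, j3, i1, i2, i1.sub i2, i3]

/-- The elementary integral is a martingale. -/
lemma integral_mul_integral_sub [IsProbabilityMeasure P] (hW : IsBrownianBasis P 𝓕 W)
    (H : SimpleProcess 𝓕) {s t : ℝ≥0} (hst : s ≤ t) {Z : Ω → ℝ} (hZ : StronglyMeasurable[𝓕 s] Z)
    (hZ2 : MemLp Z 2 P) :
    ∫ ω, Z ω * (H.integral W t ω - H.integral W s ω) ∂P = 0 := by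
  obtain ⟨K, hK⟩ := H.coef_bounded
  have e : ∀ ω, Z ω * (H.integral W t ω - H.integral W s ω) = ∑ i ∈ Finset.range H.size,
      Z ω * (H.coef i ω * (W (min (H.time (i + 1)) t) ω - W (min (H.time i) t) ω) -
        H.coef i ω * (W (min (H.time (i + 1)) s) ω - W (min (H.time i) s) ω)) := fun ω => by
    rw [SimpleProcess.integral, SimpleProcess.integral, ← Finset.sum_sub_distrib, Finset.mul_sum]
  simp_rw [e]
  rw [integral_finsetSum]
  · refine Finset.sum_eq_zero fun i _ => ?_
    set u := H.time i with hu
    set v := H.time (i + 1) with hv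
    have huv : u ≤ v := H.time_mono (Nat.le_succ i)
    rcases le_or_gt t u with h | h
    · simp [min_eq_right h, min_eq_right (h.trans huv), min_eq_right (hst.trans h),
        min_eq_right ((hst.trans h).trans huv)]
    rcases le_or_gt v s with h' | h'
    · simp [min_eq_left h', min_eq_left (h'.trans hst), min_eq_left (huv.trans h'),
        min_eq_left ((huv.trans h').trans hst)]
    rw [min_eq_left h.le, min_eq_right h'.le]
    have hm : max u s ≤ min v t := max_le (le_min huv h.le) (le_min h'.le hst)
    have hZm : StronglyMeasurable[𝓕 (max u s)] fun ω => Z ω * H.coef i ω :=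
      (hZ.mono (𝓕.mono (le_max_right _ _))).mul
        ((H.coef_measurable i).mono (𝓕.mono (le_max_left _ _)))
    rw [← hW.integral_mul_increment hm hZm]
    refine integral_congr_ae (Eventually.of_forall fun ω => ?_)
    have h2 : W u ω + W s ω = W (max u s) ω + W (min u s) ω := by
      rcases le_total u s with h | h <;> simp [h, add_comm]
    beta_reduce
    linear_combination (-Z ω * H.coef i ω) * h2
  · refine fun i _ => MemLp.integrable_mul (p := 2) (q := 2) hZ2 ?_
    have hm := ((H.coef_measurable i).mono (𝓕.le _)).aestronglyMeasurable (μ := P)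
    exact (memLp_two_bdd_mul (hW.memLp_increment _ _) hm (hK i)).sub
      (memLp_two_bdd_mul (hW.memLp_increment _ _) hm (hK i))

lemma continuous_integral (H : SimpleProcess 𝓕) {ω : Ω} (h : Continuous fun t => W t ω) :
    Continuous fun t => H.integral W t ω := by
  unfold SimpleProcess.integral
  refine continuous_finsetSum _ fun i _ => continuous_const.mul ?_
  exact (h.comp (continuous_const.min continuous_id)).sub
    (h.comp (continuous_const.min continuous_id))

end SimpleProcess

/-! ### The Itô integral: isometry and martingale property -/

lemma tendsto_zero_of_sq_tendsto_zero {ι : Type*} {l : Filter ι} {a : ι → ℝ≥0∞}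
    (h : Tendsto (fun i => a i ^ 2) l (𝓝 0)) : Tendsto a l (𝓝 0) := by
  have h2 := ((ENNReal.continuous_rpow_const (y := 1 / 2)).tendsto 0).comp h
  rw [ENNReal.zero_rpow_of_pos (by norm_num)] at h2
  refine h2.congr fun i => ?_
  simp only [Function.comp_apply]
  rw [← ENNReal.rpow_natCast, ← ENNReal.rpow_mul]
  norm_num

lemma le_of_forall_le_add_of_tendsto {a b : ℝ≥0∞} {e : ℕ → ℝ≥0∞} (h : ∀ n, a ≤ b + e n)
    (he : Tendsto e atTop (𝓝 0)) : a ≤ b := by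
  have h2 : Tendsto (fun n => b + e n) atTop (𝓝 (b + 0)) := tendsto_const_nhds.add he
  rw [add_zero] at h2
  exact ge_of_tendsto' h2 h

lemma eLpNorm_two_sub_comm {α : Type*} [MeasurableSpace α] (μ : Measure α) (f g : α → ℝ) :
    eLpNorm (fun x => f x - g x) 2 μ = eLpNorm (fun x => g x - f x) 2 μ :=
  eLpNorm_sub_comm f g 2 μ

lemma eLpNorm_two_sub_le {α : Type*} [MeasurableSpace α] {μ : Measure α} {f g h : α → ℝ}
    (hf : AEStronglyMeasurable f μ) (hg : AEStronglyMeasurable g μ)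
    (hh : AEStronglyMeasurable h μ) :
    eLpNorm (fun x => f x - h x) 2 μ ≤
      eLpNorm (fun x => f x - g x) 2 μ + eLpNorm (fun x => g x - h x) 2 μ := by
  refine le_trans (le_of_eq ?_) (eLpNorm_add_le (hf.sub hg) (hg.sub hh) one_le_two)
  congr 1
  ext x
  simp

lemma ofReal_abs_integral_mul_le {α : Type*} [MeasurableSpace α] {μ : Measure α} {f g : α → ℝ}
    (hf : AEStronglyMeasurable f μ) (hg : AEStronglyMeasurable g μ) :
    ENNReal.ofReal |∫ x, f x * g x ∂μ| ≤ eLpNorm f 2 μ * eLpNorm g 2 μ := by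
  rw [← Real.enorm_eq_ofReal_abs]
  refine (enorm_integral_le_lintegral_enorm _).trans ?_
  rw [← eLpNorm_one_eq_lintegral_enorm]
  have h := eLpNorm_smul_le_mul_eLpNorm (p := 2) (q := 2) (r := 1) hg hf
  exact h

namespace SimpleProcess

/-- The zero process. -/
def zero (𝓕 : Filtration ℝ≥0 mΩ) : SimpleProcess 𝓕 where
  size := 0
  time _ := 0
  time_mono := monotone_const
  coef _ _ := 0
  coef_measurable _ := stronglyMeasurable_const
  coef_bounded := ⟨0, by simp⟩

lemma eval_zero (s : ℝ≥0) (ω : Ω) : (zero 𝓕).eval s ω = 0 := by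
  simp [zero, SimpleProcess.eval]

lemma integral_zero (s : ℝ≥0) (ω : Ω) : (zero 𝓕).integral W s ω = 0 := by
  simp [zero, SimpleProcess.integral]

end SimpleProcess

lemma isItoIntegral_zero (P : Measure Ω) (𝓕 : Filtration ℝ≥0 mΩ) (W : ℝ≥0 → Ω → ℝ) :
    IsItoIntegral P 𝓕 W (fun _ _ => 0) (fun _ _ => 0) where
  integrand_progressive := isStronglyProgressive_const 𝓕 0
  integrand_sq T := by simp [energy]
  progressive := isStronglyProgressive_const 𝓕 0
  continuous := by simp [continuous_const]
  limit := ⟨fun _ => SimpleProcess.zero 𝓕, fun T => by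
    simp [SimpleProcess.eval_zero, SimpleProcess.integral_zero, energy]⟩

namespace IsItoIntegral

variable {H M H' M' : ℝ≥0 → Ω → ℝ}

lemma aestronglyMeasurable (hM : IsItoIntegral P 𝓕 W H M) (t : ℝ≥0) :
    AEStronglyMeasurable (M t) P :=
  ((hM.progressive.stronglyAdapted t).mono (𝓕.le t)).aestronglyMeasurable

/-- The defining approximation, in terms of `L²`-seminorms. -/
lemma exists_approx [IsProbabilityMeasure P] (hM : IsItoIntegral P 𝓕 W H M) :
    ∃ Hn : ℕ → SimpleProcess 𝓕, ∀ T : ℝ≥0,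
      Tendsto (fun n => eLpNorm (fun z : Ω × ℝ≥0 => (Hn n).eval z.2 z.1 - H z.2 z.1) 2
        (pathMeasure P T)) atTop (𝓝 0) ∧
      Tendsto (fun n => eLpNorm (fun ω => (Hn n).integral W T ω - M T ω) 2 P) atTop (𝓝 0) := by
  obtain ⟨Hn, h⟩ := hM.limit
  refine ⟨Hn, fun T => ⟨?_, ?_⟩⟩
  · refine tendsto_zero_of_sq_tendsto_zero ((h T).1.congr fun n => ?_)
    rw [energy_eq ((Hn n).measurable_eval.sub hM.integrand_progressive.measurable_uncurry)]
  · refine tendsto_zero_of_sq_tendsto_zero ((h T).2.congr fun n => ?_)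
    rw [eLpNorm_two_sq]

lemma memLp [IsProbabilityMeasure P] (hW : IsBrownianBasis P 𝓕 W)
    (hM : IsItoIntegral P 𝓕 W H M) (t : ℝ≥0) : MemLp (M t) 2 P := by
  obtain ⟨Hn, h⟩ := hM.exists_approx
  obtain ⟨n, hn⟩ := ((h t).2.eventually_lt_const ENNReal.zero_lt_top).exists
  have h1 : MemLp (fun ω => (Hn n).integral W t ω - M t ω) 2 P :=
    ⟨((Hn n).memLp_integral hW t).aestronglyMeasurable.sub (hM.aestronglyMeasurable t), hn⟩
  refine (((Hn n).memLp_integral hW t).sub h1).ae_eq (Eventually.of_forall fun ω => ?_)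
  simp

lemma memLp_integrand [IsProbabilityMeasure P] (hM : IsItoIntegral P 𝓕 W H M) (T : ℝ≥0) :
    MemLp (fun z : Ω × ℝ≥0 => H z.2 z.1) 2 (pathMeasure P T) :=
  memLp_of_energy_lt_top hM.integrand_progressive.measurable_uncurry (hM.integrand_sq T)

/-- **Itô isometry** for differences. -/
lemma eLpNorm_sub [IsProbabilityMeasure P] (hW : IsBrownianBasis P 𝓕 W)
    (hM : IsItoIntegral P 𝓕 W H M) (hM' : IsItoIntegral P 𝓕 W H' M') (T : ℝ≥0) :
    eLpNorm (fun ω => M T ω - M' T ω) 2 P =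
      eLpNorm (fun z : Ω × ℝ≥0 => H z.2 z.1 - H' z.2 z.1) 2 (pathMeasure P T) := by
  obtain ⟨Hn, h⟩ := hM.exists_approx
  obtain ⟨Gn, g⟩ := hM'.exists_approx
  have a1 := fun n => ((Hn n).memLp_integral hW T).aestronglyMeasurable
  have a2 := fun n => ((Gn n).memLp_integral hW T).aestronglyMeasurable
  have a3 := hM.aestronglyMeasurable T
  have a4 := hM'.aestronglyMeasurable T
  have b1 := fun n => ((Hn n).memLp_eval (P := P) T).aestronglyMeasurable
  have b2 := fun n => ((Gn n).memLp_eval (P := P) T).aestronglyMeasurable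
  have b3 := (hM.memLp_integrand T).aestronglyMeasurable
  have b4 := (hM'.memLp_integrand T).aestronglyMeasurable
  have he := ((h T).1.add (g T).1).add ((h T).2.add (g T).2)
  simp only [add_zero] at he
  apply le_antisymm
  · refine le_of_forall_le_add_of_tendsto (fun n => ?_) he
    have e1 := eLpNorm_two_sub_le a3 (a1 n) a4
    have e2 := eLpNorm_two_sub_le (a1 n) (a2 n) a4
    have e3 := eLpNorm_two_sub_le (b1 n) b3 (b2 n)
    have e4 := eLpNorm_two_sub_le b3 b4 (b2 n)
    rw [(Hn n).eLpNorm_integral_sub hW] at e2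
    rw [eLpNorm_two_sub_comm _ (M T) ((Hn n).integral W T)] at e1
    rw [eLpNorm_two_sub_comm _ (fun z : Ω × ℝ≥0 => H' z.2 z.1)
      (fun z : Ω × ℝ≥0 => (Gn n).eval z.2 z.1)] at e4
    refine e1.trans ((add_le_add_right (e2.trans (add_le_add_left
      (e3.trans (add_le_add_right e4 _)) _)) _).trans (le_of_eq ?_))
    ring
  · refine le_of_forall_le_add_of_tendsto (fun n => ?_) he
    have e1 := eLpNorm_two_sub_le b3 (b1 n) b4
    have e2 := eLpNorm_two_sub_le (b1 n) (b2 n) b4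
    have e3 := eLpNorm_two_sub_le (a1 n) a3 (a2 n)
    have e4 := eLpNorm_two_sub_le a3 a4 (a2 n)
    rw [← (Hn n).eLpNorm_integral_sub hW] at e2
    rw [eLpNorm_two_sub_comm _ (fun z : Ω × ℝ≥0 => H z.2 z.1)
      (fun z : Ω × ℝ≥0 => (Hn n).eval z.2 z.1)] at e1
    rw [eLpNorm_two_sub_comm _ (M' T) ((Gn n).integral W T)] at e4
    refine e1.trans ((add_le_add_right (e2.trans (add_le_add_left
      (e3.trans (add_le_add_right e4 _)) _)) _).trans (le_of_eq ?_))
    ring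

/-- **Itô isometry**: comparison with the zero process. -/
lemma eLpNorm_eq [IsProbabilityMeasure P] (hW : IsBrownianBasis P 𝓕 W)
    (hM : IsItoIntegral P 𝓕 W H M) (T : ℝ≥0) :
    eLpNorm (M T) 2 P = eLpNorm (fun z : Ω × ℝ≥0 => H z.2 z.1) 2 (pathMeasure P T) := by
  have h := hM.eLpNorm_sub hW (isItoIntegral_zero P 𝓕 W) T
  simpa using h

lemma integral_sq [IsProbabilityMeasure P] (hW : IsBrownianBasis P 𝓕 W)
    (hM : IsItoIntegral P 𝓕 W H M) (T : ℝ≥0) :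
    ∫ ω, M T ω ^ 2 ∂P = ∫ z : Ω × ℝ≥0, H z.2 z.1 ^ 2 ∂(pathMeasure P T) := by
  have h := congrArg (· ^ 2) (hM.eLpNorm_eq hW T)
  beta_reduce at h
  rw [eLpNorm_two_sq_eq_ofReal (hM.memLp hW T),
    eLpNorm_two_sq_eq_ofReal (hM.memLp_integrand T)] at h
  exact (ENNReal.ofReal_eq_ofReal_iff (integral_nonneg fun _ => sq_nonneg _)
    (integral_nonneg fun _ => sq_nonneg _)).1 h

lemma ae_eq_zero_time [IsProbabilityMeasure P] (hW : IsBrownianBasis P 𝓕 W)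
    (hM : IsItoIntegral P 𝓕 W H M) : M 0 =ᵐ[P] 0 := by
  rw [← eLpNorm_eq_zero_iff (hM.aestronglyMeasurable 0) two_ne_zero, hM.eLpNorm_eq hW]
  have : pathMeasure P 0 = 0 := by
    have h0 : timeMeasure.restrict (Set.Iic 0) = 0 := by
      rw [Measure.restrict_eq_zero, timeMeasure_apply_Iic]; simp
    rw [pathMeasure, h0, Measure.prod_zero]
  simp [this]

/-- The Itô integral is a martingale. -/
lemma integral_mul_sub [IsProbabilityMeasure P] (hW : IsBrownianBasis P 𝓕 W)
    (hM : IsItoIntegral P 𝓕 W H M) {s t : ℝ≥0} (hst : s ≤ t) {Z : Ω → ℝ}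
    (hZ : StronglyMeasurable[𝓕 s] Z) (hZ2 : MemLp Z 2 P) :
    ∫ ω, Z ω * (M t ω - M s ω) ∂P = 0 := by
  obtain ⟨Hn, h⟩ := hM.exists_approx
  have key : ∀ n, ENNReal.ofReal |∫ ω, Z ω * (M t ω - M s ω) ∂P| ≤ 0 + eLpNorm Z 2 P *
      (eLpNorm (fun ω => (Hn n).integral W t ω - M t ω) 2 P +
        eLpNorm (fun ω => (Hn n).integral W s ω - M s ω) 2 P) := fun n => by
    have i1 := ((Hn n).memLp_integral hW t).sub (hM.memLp hW t)
    have i2 := ((Hn n).memLp_integral hW s).sub (hM.memLp hW s)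
    have e : ∫ ω, Z ω * (M t ω - M s ω) ∂P = -∫ ω, Z ω * (((Hn n).integral W t ω - M t ω) -
        ((Hn n).integral W s ω - M s ω)) ∂P := by
      have h0 := (Hn n).integral_mul_integral_sub hW hst hZ hZ2
      rw [← zero_sub, ← h0, ← integral_sub]
      · exact integral_congr_ae (Eventually.of_forall fun ω => by ring)
      · exact hZ2.integrable_mul (((Hn n).memLp_integral hW t).sub ((Hn n).memLp_integral hW s))
      · exact hZ2.integrable_mul (i1.sub i2)
    rw [e, abs_neg, zero_add]
    refine (ofReal_abs_integral_mul_le hZ2.aestronglyMeasurable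
      (i1.sub i2).aestronglyMeasurable).trans ?_
    gcongr
    exact eLpNorm_sub_le i1.aestronglyMeasurable i2.aestronglyMeasurable one_le_two
  have ht : Tendsto (fun n => eLpNorm Z 2 P *
      (eLpNorm (fun ω => (Hn n).integral W t ω - M t ω) 2 P +
        eLpNorm (fun ω => (Hn n).integral W s ω - M s ω) 2 P)) atTop (𝓝 0) := by
    have := ENNReal.Tendsto.const_mul (a := eLpNorm Z 2 P) ((h t).2.add (h s).2)
      (Or.inr hZ2.eLpNorm_ne_top)
    simpa using this
  have := le_of_forall_le_add_of_tendsto key ht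
  simpa using this

lemma integral_eq_zero [IsProbabilityMeasure P] (hW : IsBrownianBasis P 𝓕 W)
    (hM : IsItoIntegral P 𝓕 W H M) (t : ℝ≥0) : ∫ ω, M t ω ∂P = 0 := by
  have h := hM.integral_mul_sub hW (zero_le : 0 ≤ t) (Z := fun _ => 1)
    stronglyMeasurable_const (memLp_const 1)
  rw [← h]
  refine integral_congr_ae ?_
  filter_upwards [hM.ae_eq_zero_time hW] with ω hω
  simp [hω]

end IsItoIntegral

/-! ### Doob's maximal inequality in continuous time -/

/-- A weak form of Doob's maximal inequality, obtained from the discrete one on dyadic grids. -/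
lemma maximal_inequality [IsProbabilityMeasure P] {N : ℝ≥0 → Ω → ℝ}
    (hc : ∀ ω, Continuous fun t => N t ω) (ha : StronglyAdapted 𝓕 N) (h2 : ∀ t, MemLp (N t) 2 P)
    (hmart : ∀ s t : ℝ≥0, s ≤ t → ∀ Z : Ω → ℝ, StronglyMeasurable[𝓕 s] Z → MemLp Z 2 P →
      ∫ ω, Z ω * (N t ω - N s ω) ∂P = 0) (T ε : ℝ≥0) :
    ε * P {ω | ∃ t ≤ T, (ε : ℝ) < |N t ω|} ≤ eLpNorm (N T) 2 P := by
  have hce : ∀ s t : ℝ≥0, s ≤ t → P[N t | 𝓕 s] =ᵐ[P] N s := by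
    intro s t hst
    symm
    refine ae_eq_condExp_of_forall_setIntegral_eq (𝓕.le s) ((h2 t).integrable one_le_two)
      (fun _ _ _ => ((h2 s).integrable one_le_two).integrableOn) (fun A hA _ => ?_)
      (ha s).aestronglyMeasurable
    have h := hmart s t hst (A.indicator fun _ => 1) (stronglyMeasurable_const.indicator hA)
      ((memLp_const 1).indicator (𝓕.le s A hA))
    have e : ∀ ω, A.indicator (fun _ => (1 : ℝ)) ω * (N t ω - N s ω) =
        A.indicator (fun ω => N t ω - N s ω) ω := fun ω => by
      by_cases hω : ω ∈ A <;> simp [hω]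
    simp_rw [e] at h
    rw [integral_indicator (𝓕.le s A hA), integral_sub
      ((h2 t).integrable one_le_two).integrableOn ((h2 s).integrable one_le_two).integrableOn] at h
    linarith
  -- the times `T k / 2ⁿ`, stopped at `T`
  let g : ℕ → ℕ → ℝ≥0 := fun n k => min T (k * (T / 2 ^ n))
  have hg : ∀ n, Monotone (g n) := fun n i j hij => by
    refine min_le_min_left _ (mul_le_mul_left ?_ _)
    exact_mod_cast hij
  have hgT : ∀ n, g n (2 ^ n) = T := fun n => by
    have : ((2 ^ n : ℕ) : ℝ≥0) * (T / 2 ^ n) = T := by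
      push_cast; field_simp
    simp only [g, this, min_self]
  have grid : ∀ n, ε * P {ω | ∃ k ≤ 2 ^ n, (ε : ℝ) < |N (g n k) ω|} ≤ eLpNorm (N T) 2 P := by
    intro n
    let 𝓖 : Filtration ℕ mΩ := ⟨fun k => 𝓕 (g n k), fun i j hij => 𝓕.mono (hg n hij),
      fun k => 𝓕.le _⟩
    have hmar : Martingale (fun k => N (g n k)) 𝓖 P :=
      ⟨fun k => ha (g n k), fun i j hij => hce _ _ (hg n hij)⟩
    have hsub : Submartingale (fun k ω => |N (g n k) ω|) 𝓖 P := by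
      have := hmar.submartingale.sup hmar.neg.submartingale
      exact this
    have hmax := maximal_ineq hsub (fun k ω => abs_nonneg _) (ε := ε) (2 ^ n)
    calc (ε : ℝ≥0∞) * P {ω | ∃ k ≤ 2 ^ n, (ε : ℝ) < |N (g n k) ω|}
        ≤ ε * P {ω | (ε : ℝ) ≤ (Finset.range (2 ^ n + 1)).sup' Finset.nonempty_range_add_one
            fun k => |N (g n k) ω|} := by
          gcongr
          rintro ⟨k, hk, h⟩
          rw [Finset.le_sup'_iff]
          exact ⟨k, Finset.mem_range.2 (Nat.lt_succ_of_le hk), h.le⟩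
      _ ≤ ENNReal.ofReal (∫ ω, |N T ω| ∂P) := by
          refine hmax.trans (ENNReal.ofReal_le_ofReal ?_)
          rw [hgT n]
          exact setIntegral_le_integral ((h2 T).integrable one_le_two).abs
            (Eventually.of_forall fun _ => abs_nonneg _)
      _ = eLpNorm (N T) 1 P := by
          rw [eLpNorm_one_eq_lintegral_enorm, ofReal_integral_eq_lintegral_ofReal
            ((h2 T).integrable one_le_two).abs (Eventually.of_forall fun _ => abs_nonneg _)]
          simp_rw [Real.enorm_eq_ofReal_abs]
      _ ≤ eLpNorm (N T) 2 P :=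
          eLpNorm_le_eLpNorm_of_exponent_le one_le_two (h2 T).aestronglyMeasurable
  have hmono : Monotone fun n => {ω | ∃ k ≤ 2 ^ n, (ε : ℝ) < |N (g n k) ω|} := by
    refine monotone_nat_of_le_succ fun n ω => ?_
    rintro ⟨k, hk, h⟩
    refine ⟨2 * k, by rw [pow_succ]; omega, ?_⟩
    have : g (n + 1) (2 * k) = g n k := by
      have : ((2 * k : ℕ) : ℝ≥0) * (T / 2 ^ (n + 1)) = k * (T / 2 ^ n) := by
        push_cast; field_simp; ring
      simp only [g, this]
    rwa [this]
  have hsub : {ω | ∃ t ≤ T, (ε : ℝ) < |N t ω|} ⊆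
      ⋃ n, {ω | ∃ k ≤ 2 ^ n, (ε : ℝ) < |N (g n k) ω|} := by
    rintro ω ⟨t, ht, h⟩
    rw [Set.mem_iUnion]
    rcases eq_or_ne T 0 with rfl | hT
    · obtain rfl : t = 0 := le_antisymm ht zero_le
      exact ⟨0, 0, by simp, by simpa [g] using h⟩
    -- dyadic approximations of `t` from above
    have hlim : Tendsto (fun n : ℕ => g n ⌈t / (T / 2 ^ n)⌉₊) atTop (𝓝 t) := by
      have h0 : Tendsto (fun n : ℕ => t + T / 2 ^ n) atTop (𝓝 t) := by
        have h1 : Tendsto (fun n : ℕ => T * (1 / 2) ^ n) atTop (𝓝 (T * 0)) :=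
          (NNReal.tendsto_pow_atTop_nhds_zero_of_lt_one
            (half_lt_self one_pos : (1 / 2 : ℝ≥0) < 1)).const_mul T
        have h3 := (tendsto_const_nhds (x := t)).add h1
        rw [mul_zero, add_zero] at h3
        refine h3.congr fun n => ?_
        rw [div_pow, one_pow, mul_one_div]
      refine tendsto_of_tendsto_of_tendsto_of_le_of_le tendsto_const_nhds h0 (fun n => ?_)
        (fun n => ?_)
      · have hp : 0 < T / 2 ^ n := by positivity
        refine le_min ht ?_
        have := Nat.le_ceil (t / (T / 2 ^ n))
        rwa [div_le_iff₀ hp] at this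
      · have hp : 0 < T / 2 ^ n := by positivity
        refine (min_le_right _ _).trans ?_
        have := (Nat.ceil_lt_add_one (zero_le : 0 ≤ t / (T / 2 ^ n))).le
        calc (⌈t / (T / 2 ^ n)⌉₊ : ℝ≥0) * (T / 2 ^ n) ≤ (t / (T / 2 ^ n) + 1) * (T / 2 ^ n) := by
              gcongr
          _ = t + T / 2 ^ n := by
              rw [add_mul, div_mul_cancel₀ _ hp.ne', one_mul]
    have hl2 : Tendsto (fun n : ℕ => |N (g n ⌈t / (T / 2 ^ n)⌉₊) ω|) atTop (𝓝 |N t ω|) :=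
      (((hc ω).tendsto t).comp hlim).abs
    obtain ⟨n, hn⟩ := (hl2.eventually_const_lt h).exists
    refine ⟨n, ⌈t / (T / 2 ^ n)⌉₊, ?_, hn⟩
    refine Nat.ceil_le.2 ?_
    have hp : 0 < T / 2 ^ n := by positivity
    rw [div_le_iff₀ hp]
    push_cast
    rw [mul_div_cancel₀ _ (by positivity)]
    exact ht
  calc (ε : ℝ≥0∞) * P {ω | ∃ t ≤ T, (ε : ℝ) < |N t ω|}
      ≤ ε * P (⋃ n, {ω | ∃ k ≤ 2 ^ n, (ε : ℝ) < |N (g n k) ω|}) := by gcongr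
    _ = ⨆ n, ε * P {ω | ∃ k ≤ 2 ^ n, (ε : ℝ) < |N (g n k) ω|} := by
        rw [hmono.measure_iUnion, ENNReal.mul_iSup]
    _ ≤ eLpNorm (N T) 2 P := iSup_le grid

/-! ### Primitives of square integrable processes -/

lemma ofReal_sq_setIntegral_le {f : ℝ≥0 → ℝ} (hf : Measurable f) (t : ℝ≥0) :
    ENNReal.ofReal ((∫ s in Set.Iic t, f s ∂timeMeasure) ^ 2) ≤
      t * ∫⁻ s in Set.Iic t, ENNReal.ofReal (f s ^ 2) ∂timeMeasure := by
  rw [← eLpNorm_two_sq, ← sq_abs, ENNReal.ofReal_pow (abs_nonneg _), ← Real.enorm_eq_ofReal_abs]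
  have h1 := (enorm_integral_le_lintegral_enorm (μ := timeMeasure.restrict (Set.Iic t)) f)
  rw [← eLpNorm_one_eq_lintegral_enorm] at h1
  have h2 := eLpNorm_le_eLpNorm_mul_rpow_measure_univ (μ := timeMeasure.restrict (Set.Iic t))
    (one_le_two : (1 : ℝ≥0∞) ≤ 2) hf.aestronglyMeasurable
  rw [Measure.restrict_apply_univ, timeMeasure_apply_Iic] at h2
  refine (pow_le_pow_left₀ zero_le (h1.trans h2) 2).trans (le_of_eq ?_)
  rw [mul_pow, mul_comm, ← ENNReal.rpow_natCast ((t : ℝ≥0∞) ^ _), ← ENNReal.rpow_mul]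
  norm_num

lemma measurable_primitive {f : ℝ≥0 → Ω → ℝ} (hf : Measurable fun z : Ω × ℝ≥0 => f z.2 z.1) :
    Measurable fun z : Ω × ℝ≥0 => ∫ s in Set.Iic z.2, f s z.1 ∂timeMeasure := by
  have h : Measurable fun y : (Ω × ℝ≥0) × ℝ≥0 =>
      {y : (Ω × ℝ≥0) × ℝ≥0 | y.2 ≤ y.1.2}.indicator (fun y => f y.2 y.1.1) y :=
    Measurable.indicator (hf.comp ((measurable_fst.comp measurable_fst).prodMk measurable_snd))
      (measurableSet_le measurable_snd (measurable_snd.comp measurable_fst))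
  have h2 := (h.stronglyMeasurable.integral_prod_right' (ν := timeMeasure)).measurable
  convert h2 using 2 with z
  rw [← integral_indicator measurableSet_Iic]
  rfl

/-- The primitive of a progressive process is adapted. -/
lemma stronglyAdapted_primitive {f : ℝ≥0 → Ω → ℝ} (hf : IsStronglyProgressive 𝓕 f) :
    StronglyAdapted 𝓕 fun t ω => ∫ s in Set.Iic t, f s ω ∂timeMeasure := by
  intro t
  have h : (fun ω => ∫ s in Set.Iic t, f s ω ∂timeMeasure) = fun ω =>
      ∫ s : Set.Iic t, f s ω ∂(timeMeasure.comap Subtype.val) := by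
    ext ω
    rw [integral_subtype_comap measurableSet_Iic (fun s => f s ω)]
  have : IsFiniteMeasure (timeMeasure.comap (Subtype.val : Set.Iic t → ℝ≥0)) := ⟨by
    rw [(MeasurableEmbedding.subtype_coe measurableSet_Iic).comap_apply, Set.image_univ,
      Subtype.range_coe, timeMeasure_apply_Iic]
    exact ENNReal.coe_lt_top⟩
  change StronglyMeasurable[𝓕 t] (fun ω => ∫ s in Set.Iic t, f s ω ∂timeMeasure)
  rw [h]
  exact @StronglyMeasurable.integral_prod_left' _ _ ℝ _ (𝓕 t) (timeMeasure.comap Subtype.val)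
    _ _ inferInstance _ (hf t)

lemma ae_pathMeasure_of_forall [SFinite P] {p : Ω × ℝ≥0 → Prop} (hp : MeasurableSet {z | p z})
    (h : ∀ t, ∀ᵐ ω ∂P, p (ω, t)) (T : ℝ≥0) : ∀ᵐ z ∂(pathMeasure P T), p z := by
  have hc : MeasurableSet {z | ¬ p z} := hp.compl
  rw [ae_iff, pathMeasure, Measure.prod_apply_symm hc]
  have : ∀ t : ℝ≥0, P ((fun ω => (ω, t)) ⁻¹' {z | ¬ p z}) = 0 := fun t => ae_iff.1 (h t)
  simp_rw [this, lintegral_zero]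

lemma ae_pathMeasure_le (P : Measure Ω) [SFinite P] (T : ℝ≥0) : ∀ᵐ z ∂(pathMeasure P T), z.2 ≤ T :=
  (Measure.ae_prod_mem_iff_ae_ae_mem
    (measurableSet_le measurable_snd measurable_const : MeasurableSet {z : Ω × ℝ≥0 | z.2 ≤ T})).2
    (Eventually.of_forall fun _ => ae_restrict_mem measurableSet_Iic)

lemma energy_mono {f : ℝ≥0 → Ω → ℝ} {s t : ℝ≥0} (hst : s ≤ t) : energy P f s ≤ energy P f t :=
  lintegral_mono fun _ => lintegral_mono_set (Set.Iic_subset_Iic.2 hst)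

lemma energy_eq_lintegral_time [SFinite P] {f : ℝ≥0 → Ω → ℝ}
    (hf : Measurable fun z : Ω × ℝ≥0 => f z.2 z.1) (T : ℝ≥0) :
    energy P f T = ∫⁻ t in Set.Iic T, eLpNorm (f t) 2 P ^ 2 ∂timeMeasure := by
  rw [energy_eq_lintegral hf, pathMeasure, lintegral_prod_symm' _ (hf.pow_const 2).ennreal_ofReal]
  simp_rw [eLpNorm_two_sq]

lemma energy_lt_top_of_bound [SFinite P] {f : ℝ≥0 → Ω → ℝ}
    (hf : Measurable fun z : Ω × ℝ≥0 => f z.2 z.1) {T : ℝ≥0} {K : ℝ≥0∞} (hK : K ≠ ∞)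
    (h : ∀ t ≤ T, eLpNorm (f t) 2 P ^ 2 ≤ K) : energy P f T < ∞ := by
  rw [energy_eq_lintegral_time hf]
  refine (setLIntegral_mono (s := Set.Iic T) measurable_const h).trans_lt ?_
  rw [setLIntegral_const, timeMeasure_apply_Iic]
  exact ENNReal.mul_lt_top hK.lt_top ENNReal.coe_lt_top

lemma eLpNorm_primitive_sq_le [SFinite P] {f : ℝ≥0 → Ω → ℝ}
    (hf : Measurable fun z : Ω × ℝ≥0 => f z.2 z.1) (t : ℝ≥0) :
    eLpNorm (fun ω => ∫ s in Set.Iic t, f s ω ∂timeMeasure) 2 P ^ 2 ≤ t * energy P f t := by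
  rw [eLpNorm_two_sq, energy, ← lintegral_const_mul]
  · exact lintegral_mono fun ω => ofReal_sq_setIntegral_le (hf.comp measurable_prodMk_left) t
  · exact (hf.pow_const 2).ennreal_ofReal.lintegral_prod_right'

lemma memLp_primitive [SFinite P] {f : ℝ≥0 → Ω → ℝ}
    (hf : Measurable fun z : Ω × ℝ≥0 => f z.2 z.1) {t : ℝ≥0} (h : energy P f t < ∞) :
    MemLp (fun ω => ∫ s in Set.Iic t, f s ω ∂timeMeasure) 2 P := by
  refine ⟨((measurable_primitive hf).comp measurable_prodMk_right).aestronglyMeasurable, ?_⟩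
  by_contra hc
  simp only [not_lt, top_le_iff] at hc
  have h2 := eLpNorm_primitive_sq_le (P := P) hf t
  rw [hc] at h2
  simp only [ne_eq, OfNat.ofNat_ne_zero, not_false_eq_true, ENNReal.top_pow, top_le_iff] at h2
  exact ENNReal.mul_ne_top ENNReal.coe_ne_top h.ne h2

lemma energy_primitive_lt_top [SFinite P] {f : ℝ≥0 → Ω → ℝ}
    (hf : Measurable fun z : Ω × ℝ≥0 => f z.2 z.1) {T : ℝ≥0} (h : energy P f T < ∞) :
    energy P (fun t ω => ∫ s in Set.Iic t, f s ω ∂timeMeasure) T < ∞ := by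
  refine energy_lt_top_of_bound (measurable_primitive hf) (K := T * energy P f T)
    (ENNReal.mul_ne_top ENNReal.coe_ne_top h.ne) fun t ht => ?_
  refine (eLpNorm_primitive_sq_le hf t).trans ?_
  gcongr
  exact energy_mono ht

lemma IsItoIntegral.energy_lt_top [IsProbabilityMeasure P] {H M : ℝ≥0 → Ω → ℝ}
    (hW : IsBrownianBasis P 𝓕 W) (hM : IsItoIntegral P 𝓕 W H M) (T : ℝ≥0) : energy P M T < ∞ := by
  refine energy_lt_top_of_bound hM.progressive.measurable_uncurry (hM.integrand_sq T).ne
    fun t ht => ?_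
  rw [hM.eLpNorm_eq hW, ← energy_eq hM.integrand_progressive.measurable_uncurry]
  exact energy_mono ht

/-! ### Itô processes: moments and Itô's formula in expectation -/

namespace IsItoProcess

variable {x : ℝ} {β γ X : ℝ≥0 → Ω → ℝ}

lemma memLp [IsProbabilityMeasure P] (hW : IsBrownianBasis P 𝓕 W)
    (hX : IsItoProcess P 𝓕 W x β γ X) (t : ℝ≥0) : MemLp (X t) 2 P := by
  obtain ⟨M, hM, h⟩ := hX.equation
  have hβ := hX.drift_progressive.measurable_uncurry
  refine (((memLp_const x).add (memLp_primitive hβ (hX.drift_sq t))).add (hM.memLp hW t)).ae_eq ?_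
  filter_upwards [h t] with ω hω
  simp [hω]

lemma ae_pathMeasure_eq [IsProbabilityMeasure P]
    (hX : IsItoProcess P 𝓕 W x β γ X) {M : ℝ≥0 → Ω → ℝ} (hM : IsItoIntegral P 𝓕 W γ M)
    (h : ∀ t, ∀ᵐ ω ∂P, X t ω = x + ∫ s in Set.Iic t, β s ω ∂timeMeasure + M t ω) (T : ℝ≥0) :
    ∀ᵐ z ∂(pathMeasure P T),
      X z.2 z.1 = x + ∫ s in Set.Iic z.2, β s z.1 ∂timeMeasure + M z.2 z.1 := by
  refine ae_pathMeasure_of_forall ?_ h T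
  exact measurableSet_eq_fun hX.progressive.measurable_uncurry
    ((measurable_const.add (measurable_primitive hX.drift_progressive.measurable_uncurry)).add
      hM.progressive.measurable_uncurry)

lemma memLp_path [IsProbabilityMeasure P] (hW : IsBrownianBasis P 𝓕 W)
    (hX : IsItoProcess P 𝓕 W x β γ X) (T : ℝ≥0) :
    MemLp (fun z : Ω × ℝ≥0 => X z.2 z.1) 2 (pathMeasure P T) := by
  obtain ⟨M, hM, h⟩ := hX.equation
  have hβ := hX.drift_progressive.measurable_uncurry
  have m1 := memLp_of_energy_lt_top (measurable_primitive hβ)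
    (energy_primitive_lt_top hβ (hX.drift_sq T))
  have m2 := memLp_of_energy_lt_top hM.progressive.measurable_uncurry (hM.energy_lt_top hW T)
  refine (((memLp_const x).add m1).add m2).ae_eq ?_
  filter_upwards [hX.ae_pathMeasure_eq hM h T] with z hz
  simp [hz]

lemma memLp_drift [IsProbabilityMeasure P] (hX : IsItoProcess P 𝓕 W x β γ X) (T : ℝ≥0) :
    MemLp (fun z : Ω × ℝ≥0 => β z.2 z.1) 2 (pathMeasure P T) :=
  memLp_of_energy_lt_top hX.drift_progressive.measurable_uncurry (hX.drift_sq T)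

lemma memLp_vol [IsProbabilityMeasure P] (hX : IsItoProcess P 𝓕 W x β γ X) (T : ℝ≥0) :
    MemLp (fun z : Ω × ℝ≥0 => γ z.2 z.1) 2 (pathMeasure P T) := by
  obtain ⟨M, hM, h⟩ := hX.equation
  exact hM.memLp_integrand T

lemma integral_eq [IsProbabilityMeasure P] (hW : IsBrownianBasis P 𝓕 W)
    (hX : IsItoProcess P 𝓕 W x β γ X) (T : ℝ≥0) :
    ∫ ω, X T ω ∂P = x + ∫ z, β z.2 z.1 ∂(pathMeasure P T) := by
  obtain ⟨M, hM, h⟩ := hX.equation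
  have hβ := hX.drift_progressive.measurable_uncurry
  have i1 := (memLp_primitive hβ (hX.drift_sq T)).integrable one_le_two
  have i2 := (hM.memLp hW T).integrable one_le_two
  rw [integral_congr_ae (h T), integral_add ((integrable_const x).fun_add i1) i2,
    integral_add (integrable_const x) i1, hM.integral_eq_zero hW, pathMeasure,
    integral_prod _ ((hX.memLp_drift T).integrable one_le_two)]
  simp

/-- The second moment of an Itô process: Itô's formula for `y ↦ y²`, in expectation. -/
lemma integral_sq_eq [IsProbabilityMeasure P] (hW : IsBrownianBasis P 𝓕 W)
    (hX : IsItoProcess P 𝓕 W x β γ X) (T : ℝ≥0) :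
    ∫ ω, X T ω ^ 2 ∂P =
      x ^ 2 + ∫ z, (2 * X z.2 z.1 * β z.2 z.1 + γ z.2 z.1 ^ 2) ∂(pathMeasure P T) := by
  obtain ⟨M, hM, h⟩ := hX.equation
  have hβ := hX.drift_progressive.measurable_uncurry
  set B : ℝ≥0 → Ω → ℝ := fun t ω => ∫ s in Set.Iic t, β s ω ∂timeMeasure with hB
  have mβ := hX.memLp_drift T
  have mB : MemLp (B T) 2 P := memLp_primitive hβ (hX.drift_sq T)
  have mBp : MemLp (fun z : Ω × ℝ≥0 => B z.2 z.1) 2 (pathMeasure P T) :=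
    memLp_of_energy_lt_top (measurable_primitive hβ) (energy_primitive_lt_top hβ (hX.drift_sq T))
  have mM := hM.memLp hW T
  have mMp : MemLp (fun z : Ω × ℝ≥0 => M z.2 z.1) 2 (pathMeasure P T) :=
    memLp_of_energy_lt_top hM.progressive.measurable_uncurry (hM.energy_lt_top hW T)
  have iβ := mβ.integrable one_le_two
  have iβB : Integrable (fun z : Ω × ℝ≥0 => β z.2 z.1 * B z.2 z.1) (pathMeasure P T) :=
    mβ.integrable_mul mBp
  have iβM : Integrable (fun z : Ω × ℝ≥0 => β z.2 z.1 * M z.2 z.1) (pathMeasure P T) :=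
    mβ.integrable_mul mMp
  -- the square of the drift part, pathwise
  have e1 : ∫ ω, B T ω ^ 2 ∂P = 2 * ∫ z, β z.2 z.1 * B z.2 z.1 ∂(pathMeasure P T) := by
    rw [← integral_const_mul]
    unfold pathMeasure at iβ iβB ⊢
    rw [integral_prod _ (iβB.const_mul 2)]
    refine integral_congr_ae ?_
    filter_upwards [iβ.prod_right_ae] with ω hω
    have := integral_mul_integral hω hω
    rw [integral_const_mul, sq, two_mul]
    exact this
  -- the cross term, by the martingale property
  have e2 : ∫ ω, B T ω * M T ω ∂P = ∫ z, β z.2 z.1 * M z.2 z.1 ∂(pathMeasure P T) := by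
    have mMT : MemLp (fun z : Ω × ℝ≥0 => M T z.1) 2 (pathMeasure P T) := mM.comp_fst _
    have iβMT : Integrable (fun z : Ω × ℝ≥0 => β z.2 z.1 * M T z.1) (pathMeasure P T) :=
      mβ.integrable_mul mMT
    have iβsq := mβ.integrable_sq
    unfold pathMeasure at iβMT iβM iβsq ⊢
    have : ∫ ω, B T ω * M T ω ∂P = ∫ z, β z.2 z.1 * M T z.1
        ∂(P.prod (timeMeasure.restrict (Set.Iic T))) := by
      rw [integral_prod _ iβMT]
      refine integral_congr_ae (Eventually.of_forall fun ω => ?_)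
      exact (integral_mul_const _ _).symm
    rw [this, integral_prod_symm _ iβMT, integral_prod_symm _ iβM]
    refine integral_congr_ae ?_
    filter_upwards [iβsq.prod_left_ae, ae_restrict_mem measurableSet_Iic] with s hs hsT
    have hsm := hX.drift_progressive.stronglyAdapted s
    have hm : MemLp (β s) 2 P :=
      (memLp_two_iff_integrable_sq (hsm.mono (𝓕.le s)).aestronglyMeasurable).2 hs
    have h0 := hM.integral_mul_sub hW (Set.mem_Iic.1 hsT) hsm hm
    have i1 : Integrable (fun ω => β s ω * M T ω) P := hm.integrable_mul mM
    have i2 : Integrable (fun ω => β s ω * M s ω) P := hm.integrable_mul (hM.memLp hW s)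
    rw [← sub_eq_zero, ← integral_sub i1 i2, ← h0]
    exact integral_congr_ae (Eventually.of_forall fun ω => by ring)
  have e3 : ∫ ω, B T ω ∂P = ∫ z, β z.2 z.1 ∂(pathMeasure P T) := by
    unfold pathMeasure at iβ ⊢
    rw [integral_prod _ iβ]
  have iB := mB.integrable one_le_two
  have iM := mM.integrable one_le_two
  have iB2 := mB.integrable_sq
  have iM2 := mM.integrable_sq
  have iBM : Integrable (fun ω => B T ω * M T ω) P := mB.integrable_mul mM
  have l1 : ∫ ω, X T ω ^ 2 ∂P = x ^ 2 + 2 * x * (∫ ω, B T ω ∂P) + 2 * x * (∫ ω, M T ω ∂P) +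
      (∫ ω, B T ω ^ 2 ∂P) + 2 * (∫ ω, B T ω * M T ω ∂P) + ∫ ω, M T ω ^ 2 ∂P := by
    have : ∀ᵐ ω ∂P, X T ω ^ 2 = x ^ 2 + 2 * x * B T ω + 2 * x * M T ω + B T ω ^ 2 +
        2 * (B T ω * M T ω) + M T ω ^ 2 := by
      filter_upwards [h T] with ω hω
      rw [hω]; ring
    rw [integral_congr_ae this, integral_add _ iM2, integral_add _ (iBM.const_mul 2),
      integral_add _ iB2, integral_add _ (iM.const_mul _), integral_add _ (iB.const_mul _),
      integral_const_mul, integral_const_mul, integral_const_mul]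
    · simp
    all_goals fun_prop
  have iγ := (hX.memLp_vol T).integrable_sq
  have l2 : ∫ z, (2 * X z.2 z.1 * β z.2 z.1 + γ z.2 z.1 ^ 2) ∂(pathMeasure P T) =
      2 * x * (∫ z, β z.2 z.1 ∂(pathMeasure P T)) +
      2 * (∫ z, β z.2 z.1 * B z.2 z.1 ∂(pathMeasure P T)) +
      2 * (∫ z, β z.2 z.1 * M z.2 z.1 ∂(pathMeasure P T)) +
      ∫ z, γ z.2 z.1 ^ 2 ∂(pathMeasure P T) := by
    have : ∀ᵐ z ∂(pathMeasure P T), 2 * X z.2 z.1 * β z.2 z.1 + γ z.2 z.1 ^ 2 =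
        2 * x * β z.2 z.1 + 2 * (β z.2 z.1 * B z.2 z.1) + 2 * (β z.2 z.1 * M z.2 z.1) +
          γ z.2 z.1 ^ 2 := by
      filter_upwards [hX.ae_pathMeasure_eq hM h T] with z hz
      rw [hz]; ring
    have j1 := iβ.const_mul (2 * x)
    have j2 := j1.fun_add (iβB.const_mul 2)
    rw [integral_congr_ae this, integral_add (j2.fun_add (iβM.const_mul 2)) iγ,
      integral_add j2 (iβM.const_mul 2), integral_add j1 (iβB.const_mul 2),
      integral_const_mul, integral_const_mul, integral_const_mul]
  rw [l1, l2, e1, e2, e3, hM.integral_eq_zero hW, hM.integral_sq hW]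
  ring

/-- The drift of `e^{-δt} p(X_t)` (up to the factor `e^{-δt}`) for the quadratic polynomial
`p(y) = p₂ y² / 2 + p₁ y + p₀`. -/
def quadraticDrift (β γ X : ℝ≥0 → Ω → ℝ) (δ p₂ p₁ p₀ : ℝ) (z : Ω × ℝ≥0) : ℝ :=
  (p₂ * X z.2 z.1 + p₁) * β z.2 z.1 + 1 / 2 * p₂ * γ z.2 z.1 ^ 2 -
    δ * (1 / 2 * p₂ * X z.2 z.1 ^ 2 + p₁ * X z.2 z.1 + p₀)

lemma integrable_quadraticDrift [IsProbabilityMeasure P] (hW : IsBrownianBasis P 𝓕 W)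
    (hX : IsItoProcess P 𝓕 W x β γ X) (δ p₂ p₁ p₀ : ℝ) (T : ℝ≥0) :
    Integrable (quadraticDrift β γ X δ p₂ p₁ p₀) (pathMeasure P T) := by
  have mX := hX.memLp_path hW T
  have mβ := hX.memLp_drift T
  have i1 : Integrable (fun z : Ω × ℝ≥0 => (p₂ * X z.2 z.1 + p₁) * β z.2 z.1) (pathMeasure P T) :=
    ((mX.const_mul p₂).add (memLp_const p₁)).integrable_mul mβ
  have i2 := (hX.memLp_vol T).integrable_sq
  have i3 := mX.integrable_sq
  have i4 := mX.integrable one_le_two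
  exact (i1.add (i2.const_mul (1 / 2 * p₂))).sub
    ((((i3.const_mul (1 / 2 * p₂)).add (i4.const_mul p₁)).add (integrable_const p₀)).const_mul δ)

/-- **Itô's formula** in expectation, for the discounted quadratic `e^{-δt} p(X_t)`. -/
lemma discounted_quadratic [IsProbabilityMeasure P] (hW : IsBrownianBasis P 𝓕 W)
    (hX : IsItoProcess P 𝓕 W x β γ X) (δ p₂ p₁ p₀ : ℝ) (T : ℝ≥0) :
    Real.exp (-δ * T) * ∫ ω, (1 / 2 * p₂ * X T ω ^ 2 + p₁ * X T ω + p₀) ∂P =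
      (1 / 2 * p₂ * x ^ 2 + p₁ * x + p₀) +
      ∫ z, Real.exp (-δ * z.2) * quadraticDrift β γ X δ p₂ p₁ p₀ z ∂(pathMeasure P T) := by
  have hφi : ∀ T, Integrable (quadraticDrift β γ X 0 p₂ p₁ p₀) (pathMeasure P T) :=
    fun T => hX.integrable_quadraticDrift hW 0 p₂ p₁ p₀ T
  set φ : ℝ≥0 → ℝ := fun s => ∫ ω, quadraticDrift β γ X 0 p₂ p₁ p₀ (ω, s) ∂P with hφ
  set E : ℝ≥0 → ℝ := fun t => ∫ ω, (1 / 2 * p₂ * X t ω ^ 2 + p₁ * X t ω + p₀) ∂P with hE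
  -- the undiscounted formula
  have hEt : ∀ t, E t = (1 / 2 * p₂ * x ^ 2 + p₁ * x + p₀) +
      ∫ s in Set.Iic t, φ s ∂timeMeasure := by
    intro t
    have m := hX.memLp hW t
    have i1 := m.integrable_sq
    have i2 := m.integrable one_le_two
    have e1 : E t = 1 / 2 * p₂ * (∫ ω, X t ω ^ 2 ∂P) + p₁ * (∫ ω, X t ω ∂P) + p₀ := by
      rw [hE]
      beta_reduce
      rw [integral_add _ (integrable_const _), integral_add (i1.const_mul _) (i2.const_mul _),
        integral_const_mul, integral_const_mul]
      · simp
      · fun_prop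
    have e2 : ∫ s in Set.Iic t, φ s ∂timeMeasure =
        ∫ z, quadraticDrift β γ X 0 p₂ p₁ p₀ z ∂(pathMeasure P t) := by
      rw [pathMeasure, integral_prod_symm _ (hφi t)]
    have mX := hX.memLp_path hW t
    have mβ := hX.memLp_drift t
    have j1 : Integrable (fun z : Ω × ℝ≥0 => X z.2 z.1 * β z.2 z.1) (pathMeasure P t) :=
      mX.integrable_mul mβ
    have j2 := (hX.memLp_vol t).integrable_sq
    have j3 := mβ.integrable one_le_two
    have e3 : ∫ z, quadraticDrift β γ X 0 p₂ p₁ p₀ z ∂(pathMeasure P t) =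
        1 / 2 * p₂ * (∫ z, (2 * X z.2 z.1 * β z.2 z.1 + γ z.2 z.1 ^ 2) ∂(pathMeasure P t)) +
        p₁ * ∫ z, β z.2 z.1 ∂(pathMeasure P t) := by
      rw [← integral_const_mul, ← integral_const_mul, ← integral_add]
      · refine integral_congr_ae (Eventually.of_forall fun z => ?_)
        simp only [quadraticDrift]
        ring
      · have : Integrable (fun z : Ω × ℝ≥0 => 2 * (X z.2 z.1 * β z.2 z.1) + γ z.2 z.1 ^ 2)
          (pathMeasure P t) := by fun_prop
        refine Integrable.const_mul (this.congr (Eventually.of_forall fun z => ?_)) _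
        beta_reduce
        ring
      · exact j3.const_mul _
    rw [e1, e2, e3, hX.integral_sq_eq hW, hX.integral_eq hW]
    ring
  have hφT : IntegrableOn φ (Set.Iic T) timeMeasure := (hφi T).integral_prod_right
  have hexp : IntegrableOn (fun s : ℝ≥0 => δ * Real.exp (-δ * s)) (Set.Iic T) timeMeasure :=
    (Continuous.integrableOn_Icc (a := 0) (b := T) (by fun_prop)).mono_set
      (fun s hs => ⟨zero_le, hs⟩)
  have hparts := integral_mul_integral hφT hexp
  simp_rw [integral_exp_Iic] at hparts
  -- the discounted integrand, integrated in `ω`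
  have hpt : ∀ᵐ s : ℝ≥0 ∂(timeMeasure.restrict (Set.Iic T)),
      ∫ ω, Real.exp (-δ * s) * quadraticDrift β γ X δ p₂ p₁ p₀ (ω, s) ∂P =
        Real.exp (-δ * s) * φ s - δ * Real.exp (-δ * s) * E s := by
    have := hφi T
    filter_upwards [this.prod_left_ae] with s hs
    have m := hX.memLp hW s
    have i1 := m.integrable_sq
    have i2 := m.integrable one_le_two
    have i3 : Integrable (fun ω => 1 / 2 * p₂ * X s ω ^ 2 + p₁ * X s ω + p₀) P := by fun_prop
    rw [hφ, hE]
    beta_reduce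
    rw [mul_assoc, mul_left_comm, ← mul_sub, ← integral_const_mul δ, ← integral_sub hs
      (i3.const_mul δ), ← integral_const_mul]
    refine integral_congr_ae (Eventually.of_forall fun ω => ?_)
    simp only [quadraticDrift]
    ring
  have hdisc : Integrable (fun z : Ω × ℝ≥0 => Real.exp (-δ * z.2) *
      quadraticDrift β γ X δ p₂ p₁ p₀ z) (pathMeasure P T) := by
    refine (hX.integrable_quadraticDrift hW δ p₂ p₁ p₀ T).bdd_mul (c := Real.exp (|δ| * T)) ?_ ?_
    · exact (Measurable.aestronglyMeasurable (by fun_prop))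
    · filter_upwards [ae_pathMeasure_le P T] with z hz
      rw [Real.norm_eq_abs, abs_of_pos (Real.exp_pos _), Real.exp_le_exp]
      refine mul_le_mul (neg_le_abs δ) (by exact_mod_cast hz) z.2.2 (abs_nonneg _)
  have hint : ∫ z, Real.exp (-δ * z.2) * quadraticDrift β γ X δ p₂ p₁ p₀ z ∂(pathMeasure P T) =
      ∫ s in Set.Iic T, (Real.exp (-δ * s) * φ s - δ * Real.exp (-δ * s) * E s) ∂timeMeasure := by
    unfold pathMeasure at hdisc ⊢
    rw [integral_prod_symm _ hdisc]
    exact integral_congr_ae hpt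
  have hEc : ContinuousOn (fun s => ∫ r in Set.Iic s, φ r ∂timeMeasure) (Set.Icc 0 T) :=
    (continuous_primitive fun t => (hφi t).integral_prod_right).continuousOn
  have hexpE : IntegrableOn (fun s : ℝ≥0 => δ * Real.exp (-δ * s) *
      ∫ r in Set.Iic s, φ r ∂timeMeasure) (Set.Iic T) timeMeasure :=
    (ContinuousOn.integrableOn_Icc (ContinuousOn.mul (by fun_prop) hEc)).mono_set
      (fun s hs => ⟨zero_le, hs⟩)
  have hexpφ : IntegrableOn (fun s : ℝ≥0 => φ s * (1 - Real.exp (-δ * s))) (Set.Iic T)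
      timeMeasure := by
    have hc : IntegrableOn (fun s : ℝ≥0 => φ s * (1 - Real.exp (-δ * s))) (Set.Icc 0 T)
        timeMeasure :=
      (hφT.mono_set fun s hs => hs.2).mul_continuousOn (by fun_prop) isCompact_Icc
    exact hc.mono_set (fun s hs => ⟨zero_le, hs⟩)
  have hfin : ∫ s in Set.Iic T, (Real.exp (-δ * s) * φ s - δ * Real.exp (-δ * s) * E s) ∂timeMeasure
      = (∫ s in Set.Iic T, φ s ∂timeMeasure) -
        (∫ s in Set.Iic T, φ s * (1 - Real.exp (-δ * s)) ∂timeMeasure) -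
        (1 / 2 * p₂ * x ^ 2 + p₁ * x + p₀) *
          (∫ s in Set.Iic T, δ * Real.exp (-δ * s) ∂timeMeasure) -
        ∫ s in Set.Iic T, δ * Real.exp (-δ * s) * ∫ r in Set.Iic s, φ r ∂timeMeasure
          ∂timeMeasure := by
    rw [← integral_const_mul, ← integral_sub hφT hexpφ, ← integral_sub (hφT.fun_sub hexpφ)
      (hexp.const_mul _), ← integral_sub ((hφT.fun_sub hexpφ).fun_sub (hexp.const_mul _)) hexpE]
    refine integral_congr_ae (Eventually.of_forall fun s => ?_)
    beta_reduce
    rw [hEt]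
    ring
  rw [hint, hfin, integral_exp_Iic]
  have := hEt T
  change Real.exp (-δ * T) * E T = _
  rw [this]
  linear_combination -hparts

end IsItoProcess

/-! ### Gronwall-type estimates -/

lemma add_sq_le_two_mul (p q : ℝ≥0∞) : (p + q) ^ 2 ≤ 2 * (p ^ 2 + q ^ 2) := by
  have h := ENNReal.rpow_add_le_mul_rpow_add_rpow p q (p := 2) one_le_two
  norm_num at h
  exact_mod_cast h

lemma lintegral_exp_mul_le (f : ℝ≥0 → ℝ≥0∞) {θ : ℝ} (hθ : 0 ≤ θ) (T : ℝ≥0) :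
    ∫⁻ s in Set.Iic T, ENNReal.ofReal (Real.exp (-θ * s)) * f s ∂timeMeasure ≤
      ∫⁻ s in Set.Iic T, f s ∂timeMeasure := by
  refine lintegral_mono fun s => ?_
  calc ENNReal.ofReal (Real.exp (-θ * s)) * f s ≤ 1 * f s := by
        gcongr
        rw [← ENNReal.ofReal_one]
        exact ENNReal.ofReal_le_ofReal (Real.exp_le_one_iff.2 (by
          nlinarith [s.2, mul_nonneg hθ s.2]))
    _ = f s := one_mul _

lemma lintegral_le_exp_mul {f : ℝ≥0 → ℝ≥0∞} (hf : Measurable f) {θ : ℝ} (hθ : 0 ≤ θ) (T : ℝ≥0) :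
    ∫⁻ s in Set.Iic T, f s ∂timeMeasure ≤ ENNReal.ofReal (Real.exp (θ * T)) *
      ∫⁻ s in Set.Iic T, ENNReal.ofReal (Real.exp (-θ * s)) * f s ∂timeMeasure := by
  have hm : Measurable fun s : ℝ≥0 => ENNReal.ofReal (Real.exp (-θ * s)) := by fun_prop
  rw [← lintegral_const_mul _ (hm.fun_mul hf)]
  refine setLIntegral_mono' measurableSet_Iic fun s hs => ?_
  rw [← mul_assoc, ← ENNReal.ofReal_mul (Real.exp_pos _).le, ← Real.exp_add]
  calc f s = 1 * f s := (one_mul _).symm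
    _ ≤ _ := by
        gcongr
        rw [← ENNReal.ofReal_one]
        refine ENNReal.ofReal_le_ofReal (Real.one_le_exp ?_)
        have : (s : ℝ) ≤ T := by exact_mod_cast hs
        nlinarith

/-- The estimate for a Picard iteration whose steps are perturbed by a geometrically small error. -/
lemma picard_bound {f : ℕ → ℝ≥0 → ℝ≥0∞} (hf : ∀ k, Measurable (f k)) {T K C : ℝ≥0} {k₀ : ℕ}
    (hfin : ∫⁻ s in Set.Iic T, f k₀ s ∂timeMeasure ≠ ∞)
    (h : ∀ k ≥ k₀, ∀ t ≤ T, f (k + 1) t ≤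
      K * ∫⁻ s in Set.Iic t, f k s ∂timeMeasure + C * (16⁻¹) ^ k) :
    ∃ A : ℝ≥0, ∀ k ≥ k₀, ∫⁻ s in Set.Iic T, f k s ∂timeMeasure ≤ A * (16⁻¹) ^ k := by
  -- For this weight `K / θ < 1 / 32`, so that the weighted integrals contract faster than the
  -- error terms decay.
  set θ : ℝ := 32 * K + 1 with hθ
  have hθ0 : 0 < θ := by positivity
  set I : ℕ → ℝ≥0∞ := fun k =>
    ∫⁻ s in Set.Iic T, ENNReal.ofReal (Real.exp (-θ * s)) * f k s ∂timeMeasure with hI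
  have hIfin : I k₀ ≠ ∞ := ne_top_of_le_ne_top hfin (lintegral_exp_mul_le _ hθ0.le T)
  have hstep : ∀ k ≥ k₀, 32 * I (k + 1) ≤ I k + 32 * C * T * (16⁻¹) ^ k := by
    intro k hk
    have hm : Measurable fun s : ℝ≥0 => ENNReal.ofReal (Real.exp (-θ * s)) := by fun_prop
    have e1 : I (k + 1) ≤ K * (∫⁻ t in Set.Iic T, ENNReal.ofReal (Real.exp (-θ * t)) *
        ∫⁻ s in Set.Iic t, f k s ∂timeMeasure ∂timeMeasure) + C * (16⁻¹) ^ k * T := by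
      have hmono : Measurable fun t : ℝ≥0 => ∫⁻ s in Set.Iic t, f k s ∂timeMeasure :=
        Monotone.measurable fun s t hst => lintegral_mono_set (Set.Iic_subset_Iic.2 hst)
      calc I (k + 1) ≤ ∫⁻ t in Set.Iic T, (K * (ENNReal.ofReal (Real.exp (-θ * t)) *
            ∫⁻ s in Set.Iic t, f k s ∂timeMeasure) +
              ENNReal.ofReal (Real.exp (-θ * t)) * (C * (16⁻¹) ^ k)) ∂timeMeasure := by
            refine setLIntegral_mono' measurableSet_Iic fun t ht => ?_
            refine (mul_le_mul_right (h k hk t ht) _).trans (le_of_eq ?_)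
            ring
        _ = K * (∫⁻ t in Set.Iic T, ENNReal.ofReal (Real.exp (-θ * t)) *
            ∫⁻ s in Set.Iic t, f k s ∂timeMeasure ∂timeMeasure) +
            ∫⁻ t in Set.Iic T, ENNReal.ofReal (Real.exp (-θ * t)) * (C * (16⁻¹) ^ k)
              ∂timeMeasure := by
            rw [lintegral_add_left (by fun_prop), lintegral_const_mul _ (hm.fun_mul hmono)]
        _ ≤ _ := by
            gcongr
            refine (lintegral_exp_mul_le _ hθ0.le T).trans (le_of_eq ?_)
            rw [setLIntegral_const, timeMeasure_apply_Iic]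
    have e2 := lintegral_exp_primitive_le (hf k) hθ0 T
    have e3 : (32 * K : ℝ≥0∞) ≤ ENNReal.ofReal θ := by
      rw [hθ, ← ENNReal.ofReal_coe_nnreal, ← ENNReal.ofReal_ofNat 32,
        ← ENNReal.ofReal_mul (by norm_num)]
      exact ENNReal.ofReal_le_ofReal (by linarith)
    calc 32 * I (k + 1) ≤ 32 * (K * (∫⁻ t in Set.Iic T, ENNReal.ofReal (Real.exp (-θ * t)) *
        ∫⁻ s in Set.Iic t, f k s ∂timeMeasure ∂timeMeasure) + C * (16⁻¹) ^ k * T) := by gcongr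
      _ = 32 * K * (∫⁻ t in Set.Iic T, ENNReal.ofReal (Real.exp (-θ * t)) *
        ∫⁻ s in Set.Iic t, f k s ∂timeMeasure ∂timeMeasure) + 32 * C * T * (16⁻¹) ^ k := by ring
      _ ≤ I k + 32 * C * T * (16⁻¹) ^ k := by
        gcongr
        exact (mul_le_mul_left e3 _).trans e2
  set A₀ : ℝ≥0∞ := 32 * C * T + 16 ^ k₀ * I k₀ with hA₀
  have hA₀fin : A₀ ≠ ∞ := by finiteness
  have h16 : (16 : ℝ≥0∞) * 16⁻¹ = 1 := ENNReal.mul_inv_cancel (by norm_num) (by norm_num)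
  have key : ∀ k ≥ k₀, I k ≤ A₀ * (16⁻¹) ^ k := by
    intro k hk
    induction k, hk using Nat.le_induction with
    | base =>
      calc I k₀ = 16 ^ k₀ * I k₀ * (16⁻¹) ^ k₀ := by
            rw [mul_right_comm, ← mul_pow, h16, one_pow, one_mul]
        _ ≤ _ := by gcongr; exact le_add_self
    | succ k hk ih =>
      have h32 : (32 : ℝ≥0∞) * I (k + 1) ≤ 32 * (A₀ * (16⁻¹) ^ (k + 1)) := by
        calc 32 * I (k + 1) ≤ I k + 32 * C * T * (16⁻¹) ^ k := hstep k hk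
          _ ≤ A₀ * (16⁻¹) ^ k + A₀ * (16⁻¹) ^ k := by gcongr; exact le_self_add
          _ = 2 * (16 * 16⁻¹) * (A₀ * (16⁻¹) ^ k) := by rw [h16, mul_one, two_mul]
          _ = _ := by rw [pow_succ]; ring
      exact (ENNReal.mul_le_mul_iff_right (by norm_num) (by norm_num)).1 h32
  refine ⟨(ENNReal.ofReal (Real.exp (θ * T)) * A₀).toNNReal, fun k hk => ?_⟩
  rw [ENNReal.coe_toNNReal (ENNReal.mul_ne_top ENNReal.ofReal_ne_top hA₀fin), mul_assoc]
  exact (lintegral_le_exp_mul (hf k) hθ0.le T).trans (mul_le_mul_right (key k hk) _)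

/-- Gronwall's inequality for a nonnegative function bounded by its own primitive, as the case of a
constant sequence without error term in `picard_bound`. -/
lemma gronwall_zero {f : ℝ≥0 → ℝ≥0∞} (hf : Measurable f) {T K : ℝ≥0}
    (hfin : ∫⁻ s in Set.Iic T, f s ∂timeMeasure ≠ ∞)
    (h : ∀ t ≤ T, f t ≤ K * ∫⁻ s in Set.Iic t, f s ∂timeMeasure) : f T = 0 := by
  obtain ⟨A, hA⟩ := picard_bound (f := fun _ => f) (fun _ => hf) (T := T) (K := K) (C := 0)
    (k₀ := 0) hfin (fun k _ t ht => by simpa using h t ht)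
  have h0 : ∫⁻ s in Set.Iic T, f s ∂timeMeasure = 0 := by
    have ht : Tendsto (fun k : ℕ => (A : ℝ≥0∞) * (16⁻¹) ^ k) atTop (𝓝 ((A : ℝ≥0∞) * 0)) :=
      ENNReal.Tendsto.const_mul (ENNReal.tendsto_pow_atTop_nhds_zero_of_lt_one
        (ENNReal.inv_lt_one.2 (by norm_num))) (Or.inr ENNReal.coe_ne_top)
    rw [mul_zero] at ht
    exact le_antisymm (ge_of_tendsto' ht fun k => hA k (Nat.zero_le k)) zero_le
  have := h T le_rfl
  rw [h0, mul_zero] at this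
  exact le_antisymm this zero_le

/-! ### Approximation by simple processes -/

lemma tendsto_eLpNorm_two_of_dominated {α : Type*} [MeasurableSpace α] {μ : Measure α}
    {F : ℕ → α → ℝ} {g : α → ℝ} (hF : ∀ n, Measurable (F n)) (hg : MemLp g 2 μ)
    (hb : ∀ n x, |F n x| ≤ |g x|) (hl : ∀ᵐ x ∂μ, Tendsto (fun n => F n x) atTop (𝓝 0)) :
    Tendsto (fun n => eLpNorm (F n) 2 μ) atTop (𝓝 0) := by
  refine tendsto_zero_of_sq_tendsto_zero ?_
  simp_rw [eLpNorm_two_sq]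
  have h := tendsto_lintegral_of_dominated_convergence (μ := μ)
    (F := fun n x => ENNReal.ofReal (F n x ^ 2)) (f := fun _ => 0)
    (fun x => ENNReal.ofReal (g x ^ 2)) (fun n => ((hF n).pow_const 2).ennreal_ofReal)
    (fun n => Eventually.of_forall fun x => ENNReal.ofReal_le_ofReal (sq_le_sq.2 (hb n x)))
    (by rw [← eLpNorm_two_sq]; exact ENNReal.pow_ne_top hg.eLpNorm_ne_top) ?_
  · simpa using h
  · filter_upwards [hl] with x hx
    have := ENNReal.tendsto_ofReal (hx.pow 2)
    simpa using this

/-- Truncation at the levels `± K`. -/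
def truncate (K : ℝ) (y : ℝ) : ℝ := max (-K) (min K y)

lemma continuous_truncate (K : ℝ) : Continuous (truncate K) := by
  unfold truncate; fun_prop

lemma abs_truncate_le {K : ℝ} (hK : 0 ≤ K) (y : ℝ) : |truncate K y| ≤ K :=
  abs_le.2 ⟨le_max_left _ _, max_le (by linarith) (min_le_left _ _)⟩

lemma truncate_of_abs_le {K y : ℝ} (h : |y| ≤ K) : truncate K y = y := by
  rw [truncate, min_eq_right (abs_le.1 h).2, max_eq_right (abs_le.1 h).1]

lemma abs_truncate_sub_le {K : ℝ} (hK : 0 ≤ K) (y : ℝ) : |truncate K y - y| ≤ |y| := by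
  unfold truncate
  rcases le_total K y with h | h
  · rw [min_eq_left h, max_eq_right (by linarith), abs_of_nonpos (by linarith),
      abs_of_nonneg (by linarith)]
    linarith
  rw [min_eq_right h]
  rcases le_total (-K) y with h' | h'
  · rw [max_eq_right h']; simp
  · rw [max_eq_left h', abs_of_nonneg (by linarith), abs_of_nonpos (by linarith)]
    linarith

/-- The truncation at level `K` of the adapted process `H`, frozen on a grid of `n + 1`
subintervals of `[0, T]`. -/
def gridProcess {H : ℝ≥0 → Ω → ℝ} (hH : StronglyAdapted 𝓕 H) (T K : ℝ≥0) (n : ℕ) :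
    SimpleProcess 𝓕 where
  size := n + 1
  time i := i * (T / (n + 1))
  time_mono i j hij := by
    have : (i : ℝ≥0) ≤ j := by exact_mod_cast hij
    exact mul_le_mul_left this _
  coef i ω := truncate K (H (i * (T / (n + 1))) ω)
  coef_measurable i := (continuous_truncate K).comp_stronglyMeasurable (hH _)
  coef_bounded := ⟨K, fun _ _ => abs_truncate_le K.2 _⟩

lemma tendsto_gridProcess_eval {H : ℝ≥0 → Ω → ℝ} (hH : StronglyAdapted 𝓕 H) {T : ℝ≥0} (K : ℝ≥0)
    {ω : Ω} (hc : Continuous fun t => H t ω) {s : ℝ≥0} (hs : 0 < s) (hsT : s ≤ T) :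
    Tendsto (fun n => (gridProcess hH T K n).eval s ω) atTop (𝓝 (truncate K (H s ω))) := by
  have hT : 0 < T := hs.trans_le hsT
  have key : ∀ n : ℕ, ∃ r : ℝ≥0, r ≤ s ∧ s ≤ r + T / (n + 1) ∧
      (gridProcess hH T K n).eval s ω = truncate K (H r ω) := by
    intro n
    set d : ℝ≥0 := T / (n + 1) with hd
    have hd0 : 0 < d := by positivity
    have hceil : 0 < ⌈s / d⌉₊ := Nat.ceil_pos.2 (by positivity)
    obtain ⟨i, hi⟩ := Nat.exists_eq_succ_of_ne_zero hceil.ne'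
    have h1 : i * d < s := by
      have : (i : ℝ≥0) < s / d := Nat.lt_ceil.1 (by omega)
      rwa [lt_div_iff₀ hd0] at this
    have h2 : s ≤ (i + 1 : ℕ) * d := by
      have : s / d ≤ (i + 1 : ℕ) := Nat.ceil_le.1 (by omega)
      rwa [div_le_iff₀ hd0] at this
    have hin : i ∈ Finset.range (n + 1) := by
      rw [Finset.mem_range]
      by_contra hcon
      have : ((n + 1 : ℕ) : ℝ≥0) ≤ i := by exact_mod_cast not_lt.1 hcon
      have h3 : T ≤ i * d := by
        calc T = ((n + 1 : ℕ) : ℝ≥0) * d := by rw [hd]; push_cast; field_simp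
          _ ≤ i * d := by gcongr
      exact absurd (hsT.trans h3) (not_le.2 h1)
    refine ⟨i * d, h1.le, ?_, ?_⟩
    · push_cast at h2
      rwa [add_mul, one_mul] at h2
    · have hmem : s ∈ Set.Ioc ((gridProcess hH T K n).time i)
          ((gridProcess hH T K n).time (i + 1)) := ⟨h1, h2⟩
      rw [SimpleProcess.eval, Finset.sum_eq_single i]
      · rw [Set.indicator_of_mem hmem]
        rfl
      · intro j _ hji
        refine Set.indicator_of_notMem (fun hj => ?_) _
        exact Set.disjoint_left.1
          ((gridProcess hH T K n).time_mono.pairwise_disjoint_on_Ioc_succ hji)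
          hj hmem
      · exact fun h => absurd hin h
  choose r hr1 hr2 hr3 using key
  have hlim : Tendsto r atTop (𝓝 s) := by
    have h0 : Tendsto (fun n : ℕ => s - T / (n + 1)) atTop (𝓝 s) := by
      have h1 : Tendsto (fun n : ℕ => T / ((n : ℝ≥0) + 1)) atTop (𝓝 0) := by
        have := (tendsto_const_div_atTop_nhds_zero_nat (T : ℝ)).comp (tendsto_add_atTop_nat 1)
        rw [← NNReal.tendsto_coe]
        refine this.congr fun n => ?_
        simp
      have h2 := (tendsto_const_nhds (x := s)).sub h1
      rwa [tsub_zero] at h2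
    exact tendsto_of_tendsto_of_tendsto_of_le_of_le h0 tendsto_const_nhds
      (fun n => tsub_le_iff_right.2 (hr2 n)) hr1
  simp_rw [hr3]
  exact (((continuous_truncate K).comp hc).tendsto s).comp hlim

/-- Continuous adapted processes with finite energy are limits of simple processes. -/
lemma exists_simpleProcess_approx [IsProbabilityMeasure P] {H : ℝ≥0 → Ω → ℝ}
    (hc : ∀ ω, Continuous fun t => H t ω) (hH : StronglyAdapted 𝓕 H) {T : ℝ≥0}
    (hE : energy P H T < ∞) {ε : ℝ≥0∞} (hε : 0 < ε) :
    ∃ G : SimpleProcess 𝓕,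
      eLpNorm (fun z : Ω × ℝ≥0 => G.eval z.2 z.1 - H z.2 z.1) 2 (pathMeasure P T) ≤ ε := by
  have hHm := (hH.isStronglyProgressive_of_continuous hc).measurable_uncurry
  have hH2 := memLp_of_energy_lt_top hHm hE
  have hε2 : 0 < ε / 2 := ENNReal.half_pos hε.ne'
  have htm : ∀ K : ℝ, Measurable fun z : Ω × ℝ≥0 => truncate K (H z.2 z.1) := fun K =>
    (continuous_truncate K).measurable.comp hHm
  -- truncate first
  have l1 : Tendsto (fun K : ℕ => eLpNorm (fun z : Ω × ℝ≥0 =>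
      truncate K (H z.2 z.1) - H z.2 z.1) 2 (pathMeasure P T)) atTop (𝓝 0) := by
    refine tendsto_eLpNorm_two_of_dominated (fun K => (htm K).sub hHm) hH2
      (fun K z => abs_truncate_sub_le K.cast_nonneg _) (Eventually.of_forall fun z => ?_)
    refine tendsto_const_nhds.congr' ?_
    filter_upwards [eventually_ge_atTop ⌈|H z.2 z.1|⌉₊] with K hK
    rw [truncate_of_abs_le (Nat.ceil_le.1 hK), sub_self]
  obtain ⟨K, hK⟩ := (l1.eventually_lt_const hε2).exists
  -- then discretize in time
  have l2 : Tendsto (fun n : ℕ => eLpNorm (fun z : Ω × ℝ≥0 =>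
      (gridProcess hH T K n).eval z.2 z.1 - truncate K (H z.2 z.1)) 2 (pathMeasure P T))
      atTop (𝓝 0) := by
    have hbd : ∀ (n : ℕ) (s : ℝ≥0) (ω : Ω), |(gridProcess hH T K n).eval s ω| ≤ K := by
      intro n s ω
      rw [SimpleProcess.eval]
      by_cases hs : ∃ i ∈ Finset.range (gridProcess hH T K n).size,
          s ∈ Set.Ioc ((gridProcess hH T K n).time i) ((gridProcess hH T K n).time (i + 1))
      · obtain ⟨i, hi, hmem⟩ := hs
        rw [Finset.sum_eq_single i, Set.indicator_of_mem hmem]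
        · exact abs_truncate_le (NNReal.coe_nonneg _) _
        · intro j _ hji
          refine Set.indicator_of_notMem (fun hj => ?_) _
          exact Set.disjoint_left.1
            ((gridProcess hH T K n).time_mono.pairwise_disjoint_on_Ioc_succ hji) hj hmem
        · exact fun h => absurd hi h
      · push Not at hs
        rw [Finset.sum_eq_zero fun i hi => Set.indicator_of_notMem (hs i hi) _, abs_zero]
        exact K.cast_nonneg
    refine tendsto_eLpNorm_two_of_dominated (g := fun _ => 2 * (K : ℝ))
      (fun n => (gridProcess hH T K n).measurable_eval.sub (htm K)) (memLp_const _)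
      (fun n z => ?_) ?_
    · rw [abs_of_nonneg (by positivity : (0 : ℝ) ≤ 2 * K)]
      refine (abs_sub _ _).trans ?_
      have h1 := hbd n z.2 z.1
      have h2 := abs_truncate_le (K := (K : ℝ)) K.cast_nonneg (H z.2 z.1)
      linarith
    · have hpos : ∀ᵐ z ∂(pathMeasure P T), z.2 ∈ Set.Ioc 0 T := by
        refine (Measure.ae_prod_mem_iff_ae_ae_mem
          (measurable_snd measurableSet_Ioc : MeasurableSet {z : Ω × ℝ≥0 | z.2 ∈ Set.Ioc 0 T})).2
          (Eventually.of_forall fun _ => ?_)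
        rw [Measure.restrict_congr_set (Iic_ae_eq_Ioc T)]
        exact ae_restrict_mem measurableSet_Ioc
      filter_upwards [hpos] with z hz
      have := tendsto_gridProcess_eval hH K (hc z.1) hz.1 hz.2
      have h2 := this.sub_const (truncate K (H z.2 z.1))
      simpa using h2
  obtain ⟨n, hn⟩ := (l2.eventually_lt_const hε2).exists
  refine ⟨gridProcess hH T K n, ?_⟩
  refine (eLpNorm_two_sub_le ((gridProcess hH T K n).measurable_eval.aestronglyMeasurable)
    (htm K).aestronglyMeasurable hHm.aestronglyMeasurable).trans ?_
  calc _ ≤ ε / 2 + ε / 2 := add_le_add hn.le hK.le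
    _ = ε := ENNReal.add_halves ε

/-! ### Locally uniform limits -/

/-- Geometrically small increments, eventually and locally uniformly, give a continuous limit. -/
lemma exists_continuous_limit {u : ℕ → ℝ≥0 → ℝ} (hu : ∀ k, Continuous (u k)) {C : ℝ}
    (h : ∀ n : ℕ, ∀ᶠ k in atTop, ∀ t ≤ (n : ℝ≥0), |u (k + 1) t - u k t| ≤ C * (1 / 2) ^ k) :
    ∃ v : ℝ≥0 → ℝ, Continuous v ∧ ∀ t, Tendsto (fun k => u k t) atTop (𝓝 (v t)) := by
  have hlim : ∀ t, ∃ y, Tendsto (fun k => u k t) atTop (𝓝 y) := by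
    intro t
    obtain ⟨n, hn⟩ := exists_nat_ge t
    obtain ⟨k₀, hk₀⟩ := eventually_atTop.1 (h n)
    refine cauchySeq_tendsto_of_complete ?_
    rw [← cauchySeq_shift k₀]
    refine cauchySeq_of_le_geometric (1 / 2) (C * (1 / 2) ^ k₀) (by norm_num) fun k => ?_
    rw [dist_comm, Real.dist_eq]
    have := hk₀ (k + k₀) (Nat.le_add_left _ _) t hn
    rw [add_right_comm] at this
    refine this.trans (le_of_eq ?_)
    rw [pow_add]; ring
  choose v hv using hlim
  refine ⟨v, ?_, hv⟩
  have hunif : ∀ n : ℕ, TendstoUniformlyOn u v atTop (Set.Iic (n : ℝ≥0)) := by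
    intro n
    obtain ⟨k₀, hk₀⟩ := eventually_atTop.1 (h n)
    rw [Metric.tendstoUniformlyOn_iff]
    intro ε hε
    have hg : Tendsto (fun k : ℕ => C * (1 / 2 : ℝ) ^ k / (1 - 1 / 2)) atTop
        (𝓝 (C * 0 / (1 - 1 / 2))) :=
      ((tendsto_pow_atTop_nhds_zero_of_lt_one (by norm_num) (by norm_num)).const_mul C).div_const _
    rw [mul_zero, zero_div] at hg
    filter_upwards [hg.eventually_lt_const hε, eventually_ge_atTop k₀] with k hk hkk t ht
    rw [dist_comm]
    refine lt_of_le_of_lt ?_ hk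
    have hd : ∀ j, dist (u (j + k) t) (u (j + 1 + k) t) ≤
        C * (1 / 2) ^ k * (1 / 2) ^ j := fun j => by
      rw [dist_comm, Real.dist_eq]
      have := hk₀ (j + k) (hkk.trans (Nat.le_add_left _ _)) t ht
      rw [add_right_comm] at this
      refine this.trans (le_of_eq ?_)
      rw [pow_add]; ring
    have := dist_le_of_le_geometric_of_tendsto₀ (1 / 2) (C * (1 / 2) ^ k) (by norm_num) hd
      ((tendsto_add_atTop_iff_nat k).2 (hv t))
    simpa using this
  rw [continuous_iff_continuousAt]
  intro t
  obtain ⟨n, hn⟩ := exists_nat_gt t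
  have := (hunif n).continuousOn (Frequently.of_forall fun k => (hu k).continuousOn)
  exact this.continuousAt (Iic_mem_nhds hn)

/-! ### Stochastic differential equations with Lipschitz coefficients -/

lemma eLpNorm_pathMeasure_mono (P : Measure Ω) [SFinite P] (f : Ω × ℝ≥0 → ℝ) {s t : ℝ≥0}
    (hst : s ≤ t) : eLpNorm f 2 (pathMeasure P s) ≤ eLpNorm f 2 (pathMeasure P t) := by
  refine eLpNorm_mono_measure f ?_
  exact Measure.prod_mono le_rfl (Measure.restrict_mono (Set.Iic_subset_Iic.2 hst) le_rfl)

lemma eLpNorm_lipschitz_sub_sq_le {α : Type*} [MeasurableSpace α] {μ : Measure α} {σ : ℝ → ℝ}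
    {L : ℝ≥0} (hσ : LipschitzWith L σ) (f g : α → ℝ) :
    eLpNorm (fun x => σ (f x) - σ (g x)) 2 μ ^ 2 ≤
      L ^ 2 * eLpNorm (fun x => f x - g x) 2 μ ^ 2 := by
  rw [← mul_pow]
  refine pow_le_pow_left₀ zero_le ?_ 2
  have := eLpNorm_le_nnreal_smul_eLpNorm_of_ae_le_mul (μ := μ)
    (f := fun x => σ (f x) - σ (g x)) (g := fun x => f x - g x) (c := L)
    (Eventually.of_forall fun x => ?_) 2
  · simpa [ENNReal.smul_def] using this
  · have := hσ.dist_le_mul (f x) (g x)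
    rw [Real.dist_eq, Real.dist_eq] at this
    exact_mod_cast this

lemma energy_lipschitz_lt_top [IsProbabilityMeasure P] {σ : ℝ → ℝ} {L : ℝ≥0}
    (hσ : LipschitzWith L σ) {X : ℝ≥0 → Ω → ℝ} (hX : Measurable fun z : Ω × ℝ≥0 => X z.2 z.1)
    {T : ℝ≥0} (h : energy P X T < ∞) : energy P (fun t ω => σ (X t ω)) T < ∞ := by
  have hm : Measurable fun z : Ω × ℝ≥0 => σ (X z.2 z.1) := hσ.continuous.measurable.comp hX
  have h2 := memLp_of_energy_lt_top hX h
  have h3 : MemLp (fun z : Ω × ℝ≥0 => σ (X z.2 z.1)) 2 (pathMeasure P T) := by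
    refine MemLp.of_le (((h2.norm.const_mul (L : ℝ)).add (memLp_const |σ 0|)))
      hm.aestronglyMeasurable (Eventually.of_forall fun z => ?_)
    have := hσ.dist_le_mul (X z.2 z.1) 0
    rw [Real.dist_eq, Real.dist_eq, sub_zero] at this
    have h4 := abs_sub_abs_le_abs_sub (σ (X z.2 z.1)) (σ 0)
    simp only [Pi.add_apply, Real.norm_eq_abs]
    refine le_trans ?_ (le_abs_self _)
    linarith
  rw [energy_eq hm]
  exact ENNReal.pow_lt_top h3.eLpNorm_lt_top

lemma eLpNorm_const_mul_primitive_sq_le [SFinite P] {f : ℝ≥0 → Ω → ℝ}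
    (hf : Measurable fun z : Ω × ℝ≥0 => f z.2 z.1) (a : ℝ) (t : ℝ≥0) :
    eLpNorm (fun ω => ∫ s in Set.Iic t, a * f s ω ∂timeMeasure) 2 P ^ 2 ≤
      t * ‖a‖₊ ^ 2 * energy P f t := by
  refine (eLpNorm_primitive_sq_le (f := fun s ω => a * f s ω) (hf.const_mul a) t).trans ?_
  rw [energy_eq (f := fun s ω => a * f s ω) (hf.const_mul a), energy_eq hf, mul_assoc, ← mul_pow]
  gcongr
  exact (eLpNorm_const_smul a (fun z : Ω × ℝ≥0 => f z.2 z.1) 2 (pathMeasure P t)).le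

/-- **Pathwise uniqueness** for `dX = (a X + b) dt + σ(X) dW` with Lipschitz `σ`. -/
theorem IsItoProcess.unique [IsProbabilityMeasure P] (hW : IsBrownianBasis P 𝓕 W) {x a b : ℝ}
    {σ : ℝ → ℝ} {L : ℝ≥0} (hσ : LipschitzWith L σ) {X Y : ℝ≥0 → Ω → ℝ}
    (hX : IsItoProcess P 𝓕 W x (fun t ω => a * X t ω + b) (fun t ω => σ (X t ω)) X)
    (hY : IsItoProcess P 𝓕 W x (fun t ω => a * Y t ω + b) (fun t ω => σ (Y t ω)) Y) :
    ∀ᵐ ω ∂P, ∀ t, Y t ω = X t ω := by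
  have hXm := hX.progressive.measurable_uncurry
  have hYm := hY.progressive.measurable_uncurry
  have hDm : Measurable fun z : Ω × ℝ≥0 => X z.2 z.1 - Y z.2 z.1 := hXm.sub hYm
  set f : ℝ≥0 → ℝ≥0∞ := fun t => eLpNorm (fun ω => X t ω - Y t ω) 2 P ^ 2 with hf
  have hfm : Measurable f := by
    have : f = fun t => ∫⁻ ω, ENNReal.ofReal ((X t ω - Y t ω) ^ 2) ∂P := by
      ext t; rw [hf]; exact eLpNorm_two_sq _ _
    rw [this]
    exact Measurable.lintegral_prod_left' (f := fun z : Ω × ℝ≥0 =>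
      ENNReal.ofReal ((X z.2 z.1 - Y z.2 z.1) ^ 2)) (hDm.pow_const 2).ennreal_ofReal
  have hen : ∀ T, energy P (fun t ω => X t ω - Y t ω) T = ∫⁻ s in Set.Iic T, f s ∂timeMeasure :=
    fun T => energy_eq_lintegral_time hDm T
  have hfin : ∀ T, energy P (fun t ω => X t ω - Y t ω) T < ∞ := fun T => by
    rw [energy_eq hDm]
    exact ENNReal.pow_lt_top ((hX.memLp_path hW T).sub (hY.memLp_path hW T)).eLpNorm_lt_top
  obtain ⟨M, hM, hXe⟩ := hX.equation
  obtain ⟨M', hM', hYe⟩ := hY.equation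
  have hzero : ∀ T, f T = 0 := by
    intro T
    set K : ℝ≥0 := 2 * (T * ‖a‖₊ ^ 2 + L ^ 2) with hK
    refine gronwall_zero hfm (T := T) (K := K) (by rw [← hen]; exact (hfin T).ne) fun t ht => ?_
    have e1 : ∀ᵐ ω ∂P, X t ω - Y t ω =
        (∫ s in Set.Iic t, (a * (X s ω - Y s ω)) ∂timeMeasure) + (M t ω - M' t ω) := by
      have i1 := (hX.memLp_drift t).integrable one_le_two
      have i2 := (hY.memLp_drift t).integrable one_le_two
      unfold pathMeasure at i1 i2
      filter_upwards [hXe t, hYe t, i1.prod_right_ae, i2.prod_right_ae] with ω h1 h2 h3 h4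
      rw [h1, h2]
      have : ∫ s in Set.Iic t, (a * (X s ω - Y s ω)) ∂timeMeasure =
          (∫ s in Set.Iic t, (a * X s ω + b) ∂timeMeasure) -
          ∫ s in Set.Iic t, (a * Y s ω + b) ∂timeMeasure := by
        rw [← integral_sub h3 h4]
        exact integral_congr_ae (Eventually.of_forall fun s => by beta_reduce; ring)
      rw [this]; ring
    have e2 : eLpNorm (fun ω => ∫ s in Set.Iic t, (a * (X s ω - Y s ω)) ∂timeMeasure) 2 P ^ 2 ≤
        T * ‖a‖₊ ^ 2 * ∫⁻ s in Set.Iic t, f s ∂timeMeasure := by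
      refine (eLpNorm_const_mul_primitive_sq_le (f := fun s ω => X s ω - Y s ω) hDm a t).trans ?_
      rw [hen]
      gcongr
    have e3 : eLpNorm (fun ω => M t ω - M' t ω) 2 P ^ 2 ≤
        L ^ 2 * ∫⁻ s in Set.Iic t, f s ∂timeMeasure := by
      rw [hM.eLpNorm_sub hW hM']
      refine (eLpNorm_lipschitz_sub_sq_le hσ _ _).trans (le_of_eq ?_)
      rw [← energy_eq (f := fun t ω => X t ω - Y t ω) hDm, hen]
    have m1 : AEStronglyMeasurable
        (fun ω => ∫ s in Set.Iic t, (a * (X s ω - Y s ω)) ∂timeMeasure) P :=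
      ((measurable_primitive (f := fun s ω => a * (X s ω - Y s ω))
        (hDm.const_mul a)).comp measurable_prodMk_right).aestronglyMeasurable
    have m2 := (hM.aestronglyMeasurable t).sub (hM'.aestronglyMeasurable t)
    calc f t = eLpNorm (fun ω => (∫ s in Set.Iic t, (a * (X s ω - Y s ω)) ∂timeMeasure) +
          (M t ω - M' t ω)) 2 P ^ 2 := by rw [hf]; beta_reduce; rw [eLpNorm_congr_ae e1]
      _ ≤ (eLpNorm (fun ω => ∫ s in Set.Iic t, (a * (X s ω - Y s ω)) ∂timeMeasure) 2 P +
          eLpNorm (fun ω => M t ω - M' t ω) 2 P) ^ 2 := by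
          gcongr
          exact eLpNorm_add_le m1 m2 one_le_two
      _ ≤ 2 * (T * ‖a‖₊ ^ 2 * (∫⁻ s in Set.Iic t, f s ∂timeMeasure) +
          L ^ 2 * ∫⁻ s in Set.Iic t, f s ∂timeMeasure) :=
          (add_sq_le_two_mul _ _).trans (by gcongr)
      _ = K * ∫⁻ s in Set.Iic t, f s ∂timeMeasure := by
          rw [hK]; push_cast; ring
  have hae : ∀ t, ∀ᵐ ω ∂P, Y t ω = X t ω := by
    intro t
    have h0 : eLpNorm (fun ω => X t ω - Y t ω) 2 P = 0 := by
      have := hzero t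
      rw [hf] at this
      exact pow_eq_zero_iff two_ne_zero |>.1 this
    have h1 := (eLpNorm_eq_zero_iff (f := fun ω => X t ω - Y t ω)
      ((hX.memLp hW t).sub (hY.memLp hW t)).aestronglyMeasurable two_ne_zero).1 h0
    filter_upwards [h1] with ω hω
    simp only [Pi.zero_apply] at hω
    linarith
  -- two continuous paths that agree at a dense set of times agree
  have hd : ∀ᵐ ω ∂P, ∀ t ∈ TopologicalSpace.denseSeq ℝ≥0 '' Set.univ, Y t ω = X t ω :=
    (ae_ball_iff (Set.countable_univ.image _)).2 fun t _ => hae t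
  filter_upwards [hd, hX.continuous, hY.continuous] with ω h1 h2 h3
  have := Continuous.ext_on (s := TopologicalSpace.denseSeq ℝ≥0 '' Set.univ)
    (by rw [Set.image_univ]; exact TopologicalSpace.denseRange_denseSeq _) h3 h2 h1
  exact fun t => congrFun this t

/-- The class of continuous adapted processes with finite energy, in which the Picard iteration
takes place. Continuity is required of all paths, so that adaptedness implies progressive
measurability. -/
structure IsIterate (P : Measure Ω) (𝓕 : Filtration ℝ≥0 mΩ) (X : ℝ≥0 → Ω → ℝ) : Prop where
  continuous : ∀ ω, Continuous fun t => X t ω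
  adapted : StronglyAdapted 𝓕 X
  energy_lt_top : ∀ T, energy P X T < ∞

namespace IsIterate

variable {X : ℝ≥0 → Ω → ℝ}

lemma progressive (hX : IsIterate P 𝓕 X) : IsStronglyProgressive 𝓕 X :=
  hX.adapted.isStronglyProgressive_of_continuous hX.continuous

lemma measurable (hX : IsIterate P 𝓕 X) : Measurable fun z : Ω × ℝ≥0 => X z.2 z.1 :=
  hX.progressive.measurable_uncurry

lemma affine_continuous (hX : IsIterate P 𝓕 X) (a b : ℝ) (ω : Ω) :
    Continuous fun t => a * X t ω + b :=
  (continuous_const.mul (hX.continuous ω)).add continuous_const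

lemma affine_progressive (hX : IsIterate P 𝓕 X) (a b : ℝ) :
    IsStronglyProgressive 𝓕 fun t ω => a * X t ω + b :=
  fun i => ((hX.progressive i).const_mul a).add_const b

lemma memLp_path [SFinite P] (hX : IsIterate P 𝓕 X) (T : ℝ≥0) :
    MemLp (fun z : Ω × ℝ≥0 => X z.2 z.1) 2 (pathMeasure P T) :=
  memLp_of_energy_lt_top hX.measurable (hX.energy_lt_top T)

lemma affine_energy [IsProbabilityMeasure P] (hX : IsIterate P 𝓕 X) (a b : ℝ) (T : ℝ≥0) :
    energy P (fun t ω => a * X t ω + b) T < ∞ := by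
  rw [energy_eq (f := fun t ω => a * X t ω + b) ((hX.measurable.const_mul a).add_const b)]
  exact ENNReal.pow_lt_top (((hX.memLp_path T).const_mul a).add (memLp_const b)).eLpNorm_lt_top

lemma drift_continuous (hX : IsIterate P 𝓕 X) (a b : ℝ) (ω : Ω) :
    Continuous fun t => ∫ s in Set.Iic t, (a * X s ω + b) ∂timeMeasure :=
  continuous_primitive fun T =>
    ((hX.affine_continuous a b ω).integrableOn_Icc (a := 0) (b := T)).mono_set
      fun _ hs => ⟨zero_le, hs⟩

lemma integrableOn (hX : IsIterate P 𝓕 X) (a b : ℝ) (ω : Ω) (T : ℝ≥0) :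
    IntegrableOn (fun s => a * X s ω + b) (Set.Iic T) timeMeasure :=
  ((hX.affine_continuous a b ω).integrableOn_Icc (a := 0) (b := T)).mono_set
    fun _ hs => ⟨zero_le, hs⟩

end IsIterate

lemma eLpNorm_integral_sq_le [IsProbabilityMeasure P] (hW : IsBrownianBasis P 𝓕 W)
    (G : SimpleProcess 𝓕) {t T : ℝ≥0} (ht : t ≤ T) :
    eLpNorm (G.integral W t) 2 P ^ 2 ≤
      eLpNorm (fun z : Ω × ℝ≥0 => G.eval z.2 z.1) 2 (pathMeasure P T) ^ 2 := by
  have h := G.eLpNorm_integral_sub hW (SimpleProcess.zero 𝓕) t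
  simp only [SimpleProcess.integral_zero, SimpleProcess.eval_zero, sub_zero] at h
  refine pow_le_pow_left₀ zero_le ?_ 2
  exact h.le.trans (eLpNorm_pathMeasure_mono P _ ht)

/-- One step of the perturbed Picard iteration: the diffusion coefficient `σ(X)` is replaced by a
simple process `G`, so that only elementary stochastic integrals occur. -/
lemma exists_picard_step [IsProbabilityMeasure P] (hW : IsBrownianBasis P 𝓕 W) (x a b : ℝ)
    {σ : ℝ → ℝ} {L : ℝ≥0} (hσ : LipschitzWith L σ) {X : ℝ≥0 → Ω → ℝ} (hX : IsIterate P 𝓕 X)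
    (k : ℕ) :
    ∃ (G : SimpleProcess 𝓕) (Y : ℝ≥0 → Ω → ℝ), IsIterate P 𝓕 Y ∧
      eLpNorm (fun z : Ω × ℝ≥0 => G.eval z.2 z.1 - σ (X z.2 z.1)) 2 (pathMeasure P k) ≤
        (4⁻¹) ^ k ∧
      ∀ᵐ ω ∂P, ∀ t, Y t ω =
        x + ∫ s in Set.Iic t, (a * X s ω + b) ∂timeMeasure + G.integral W t ω := by
  obtain ⟨G, hG⟩ := exists_simpleProcess_approx (P := P) (𝓕 := 𝓕) (T := k)
    (H := fun t ω => σ (X t ω))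
    (fun ω => hσ.continuous.comp (hX.continuous ω))
    (fun t => hσ.continuous.comp_stronglyMeasurable (hX.adapted t))
    (energy_lipschitz_lt_top hσ hX.measurable (hX.energy_lt_top k))
    (ε := (4⁻¹) ^ k) (by
      refine ENNReal.pow_pos (ENNReal.inv_pos.2 (by norm_num)) k)
  -- the null set on which Brownian paths may be discontinuous is removed
  set A : Set Ω := {ω | Continuous fun t => W t ω} with hA
  have hA0 : P Aᶜ = 0 := hW.brownian.cont
  have hAm : ∀ t, MeasurableSet[𝓕 t] A := fun t => by
    have := hW.null_measurable Aᶜ hA0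
    rw [← compl_compl A]
    exact (𝓕.mono (zero_le : 0 ≤ t) _ this).compl
  have hβ := (hX.affine_progressive a b)
  set Y : ℝ≥0 → Ω → ℝ := fun t ω =>
    x + ∫ s in Set.Iic t, (a * X s ω + b) ∂timeMeasure + A.indicator (G.integral W t) ω with hY
  have hYc : ∀ ω, Continuous fun t => Y t ω := fun ω => by
    refine (continuous_const.add (hX.drift_continuous a b ω)).add ?_
    by_cases hω : ω ∈ A
    · simp only [Set.indicator_of_mem hω]
      exact G.continuous_integral hω
    · simp only [Set.indicator_of_notMem hω]
      exact continuous_const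
  have hYa : StronglyAdapted 𝓕 Y := fun t =>
    (stronglyMeasurable_const.add (stronglyAdapted_primitive hβ t)).add
      ((G.stronglyMeasurable_integral hW t).indicator (hAm t))
  have hYe : ∀ᵐ ω ∂P, ∀ t, Y t ω =
        x + ∫ s in Set.Iic t, (a * X s ω + b) ∂timeMeasure + G.integral W t ω := by
    have : ∀ᵐ ω ∂P, ω ∈ A := hW.brownian.cont
    filter_upwards [this] with ω hω t
    rw [hY]
    simp only [Set.indicator_of_mem hω]
  refine ⟨G, Y, ⟨hYc, hYa, fun T => ?_⟩, hG, hYe⟩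
  have hYm := (hYa.isStronglyProgressive_of_continuous hYc).measurable_uncurry
  have m1 := fun t => memLp_primitive (P := P) hβ.measurable_uncurry (hX.affine_energy a b t)
  refine energy_lt_top_of_bound hYm (K := 2 * (2 * (‖x‖ₑ ^ 2 +
      T * energy P (fun t ω => a * X t ω + b) T) +
      eLpNorm (fun z : Ω × ℝ≥0 => G.eval z.2 z.1) 2 (pathMeasure P T) ^ 2)) ?_ fun t ht => ?_
  · have h1 := (hX.affine_energy (P := P) a b T).ne
    have h2 := (G.memLp_eval (P := P) T).eLpNorm_ne_top
    finiteness
  · have hYt : Y t =ᵐ[P] fun ω => (x + ∫ s in Set.Iic t, (a * X s ω + b) ∂timeMeasure) +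
        G.integral W t ω := by
      filter_upwards [hYe] with ω hω using hω t
    rw [eLpNorm_congr_ae hYt]
    have e1 := eLpNorm_add_le ((memLp_const (μ := P) (p := 2) x).add (m1 t)).aestronglyMeasurable
      (G.memLp_integral hW t).aestronglyMeasurable one_le_two
    have e2 := eLpNorm_add_le (memLp_const (μ := P) (p := 2) x).aestronglyMeasurable
      (m1 t).aestronglyMeasurable one_le_two
    refine (pow_le_pow_left₀ zero_le e1 2).trans ((add_sq_le_two_mul _ _).trans ?_)
    refine mul_le_mul_right (add_le_add ?_ (eLpNorm_integral_sq_le hW G ht)) _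
    refine (pow_le_pow_left₀ zero_le e2 2).trans ((add_sq_le_two_mul _ _).trans ?_)
    refine mul_le_mul_right (add_le_add (le_of_eq ?_) ?_) _
    · rw [eLpNorm_const' _ two_ne_zero (by norm_num)]; simp
    · refine (eLpNorm_primitive_sq_le hβ.measurable_uncurry t).trans ?_
      gcongr
      exact energy_mono ht

/-! ### Picard iteration -/

/-- A perturbed Picard iteration for `dX = (a X + b) dt + σ(X) dW`, `X_0 = x`: the next iterate is
driven by a simple process `G k` close to `σ (X k)`. The approximation improves with `k` on a time
interval that grows with `k`, so that the errors are summable on every bounded interval. -/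
structure IsPicardSequence (P : Measure Ω) (𝓕 : Filtration ℝ≥0 mΩ) (W : ℝ≥0 → Ω → ℝ)
    (x a b : ℝ) (σ : ℝ → ℝ) (X : ℕ → ℝ≥0 → Ω → ℝ) (G : ℕ → SimpleProcess 𝓕) : Prop where
  iterate : ∀ k, IsIterate P 𝓕 (X k)
  approx : ∀ k : ℕ, eLpNorm (fun z : Ω × ℝ≥0 => (G k).eval z.2 z.1 - σ (X k z.2 z.1)) 2
    (pathMeasure P k) ≤ (4⁻¹) ^ k
  step : ∀ k, ∀ᵐ ω ∂P, ∀ t, X (k + 1) t ω =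
    x + ∫ s in Set.Iic t, (a * X k s ω + b) ∂timeMeasure + (G k).integral W t ω

lemma exists_isPicardSequence [IsProbabilityMeasure P] (hW : IsBrownianBasis P 𝓕 W) (x a b : ℝ)
    {σ : ℝ → ℝ} {L : ℝ≥0} (hσ : LipschitzWith L σ) :
    ∃ X G, IsPicardSequence P 𝓕 W x a b σ X G := by
  have h0 : IsIterate P 𝓕 (fun _ _ => x) := by
    refine ⟨fun _ => continuous_const, fun _ => stronglyMeasurable_const, fun T => ?_⟩
    rw [energy_eq (f := fun _ _ => x) measurable_const]
    exact ENNReal.pow_lt_top (memLp_const (μ := pathMeasure P T) x).eLpNorm_lt_top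
  choose g Y hY hg hs using
    fun (X : {X : ℝ≥0 → Ω → ℝ // IsIterate P 𝓕 X}) (k : ℕ) =>
      exists_picard_step hW x a b hσ X.2 k
  let Z : ℕ → {X : ℝ≥0 → Ω → ℝ // IsIterate P 𝓕 X} := fun k =>
    Nat.rec ⟨fun _ _ => x, h0⟩ (fun k X => ⟨Y X k, hY X k⟩) k
  exact ⟨fun k => (Z k).1, fun k => g (Z k) k, fun k => (Z k).2, fun k => hg (Z k) k,
    fun k => hs (Z k) k⟩

namespace IsPicardSequence

variable {x a b : ℝ} {σ : ℝ → ℝ} {L : ℝ≥0} {X : ℕ → ℝ≥0 → Ω → ℝ} {G : ℕ → SimpleProcess 𝓕}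

lemma drift_sub (h : IsPicardSequence P 𝓕 W x a b σ X G) (k l : ℕ) (ω : Ω) (t : ℝ≥0) :
    (∫ s in Set.Iic t, (a * X k s ω + b) ∂timeMeasure) -
      ∫ s in Set.Iic t, (a * X l s ω + b) ∂timeMeasure =
    ∫ s in Set.Iic t, (a * (X k s ω - X l s ω)) ∂timeMeasure := by
  rw [← integral_sub ((h.iterate k).integrableOn a b ω t) ((h.iterate l).integrableOn a b ω t)]
  exact integral_congr_ae (Eventually.of_forall fun s => by beta_reduce; ring)

lemma measurable_sub (h : IsPicardSequence P 𝓕 W x a b σ X G) (k l : ℕ) :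
    Measurable fun z : Ω × ℝ≥0 => X k z.2 z.1 - X l z.2 z.1 :=
  (h.iterate k).measurable.sub (h.iterate l).measurable

/-- The distance of consecutive driving simple processes in terms of that of the iterates. -/
lemma eLpNorm_eval_sub_le [IsProbabilityMeasure P] (hσ : LipschitzWith L σ)
    (h : IsPicardSequence P 𝓕 W x a b σ X G) {k : ℕ} {t : ℝ≥0} (ht : t ≤ k) :
    eLpNorm (fun z : Ω × ℝ≥0 => (G (k + 1)).eval z.2 z.1 - (G k).eval z.2 z.1) 2
        (pathMeasure P t) ^ 2 ≤
      2 * ((2 * (4⁻¹) ^ k) ^ 2 + L ^ 2 * energy P (fun s ω => X (k + 1) s ω - X k s ω) t) := by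
  have mG := fun k => ((G k).measurable_eval).aestronglyMeasurable (μ := pathMeasure P t)
  have mX := fun k => (hσ.continuous.measurable.comp
    (h.iterate k).measurable).aestronglyMeasurable (μ := pathMeasure P t)
  have t1 := eLpNorm_two_sub_le (mG (k + 1)) (mX (k + 1)) (mG k)
  have t2 := eLpNorm_two_sub_le (mX (k + 1)) (mX k) (mG k)
  have ht' : t ≤ ((k + 1 : ℕ) : ℝ≥0) := ht.trans (by simp)
  have a1 := (eLpNorm_pathMeasure_mono P _ ht').trans (h.approx (k + 1))
  have a2 := (eLpNorm_pathMeasure_mono P _ ht).trans (h.approx k)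
  have a3 : ((4⁻¹ : ℝ≥0∞)) ^ (k + 1) ≤ (4⁻¹) ^ k := by
    refine pow_le_pow_of_le_one zero_le ?_ (Nat.le_succ k)
    exact ENNReal.inv_le_one.2 (by norm_num)
  rw [eLpNorm_two_sub_comm] at a2
  rw [energy_eq (f := fun s ω => X (k + 1) s ω - X k s ω) (h.measurable_sub (k + 1) k)]
  refine le_trans (pow_le_pow_left₀ zero_le ?_ 2) ((add_sq_le_two_mul _ _).trans
    (mul_le_mul_right (add_le_add le_rfl (eLpNorm_lipschitz_sub_sq_le hσ
      (fun z : Ω × ℝ≥0 => X (k + 1) z.2 z.1) (fun z => X k z.2 z.1))) _))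
  refine (t1.trans (add_le_add (a1.trans a3) (t2.trans (add_le_add le_rfl a2)))).trans
    (le_of_eq ?_)
  simp only [Function.comp_def]
  ring

lemma four_inv_pow_sq (k : ℕ) : (((4⁻¹ : ℝ≥0∞)) ^ k) ^ 2 = (16⁻¹) ^ k := by
  rw [← pow_mul, mul_comm, pow_mul, ← ENNReal.inv_pow]; norm_num

/-- Increments of the iterates and of the driving simple processes decay geometrically. -/
lemma exists_bound [IsProbabilityMeasure P] (hW : IsBrownianBasis P 𝓕 W) (hσ : LipschitzWith L σ)
    (h : IsPicardSequence P 𝓕 W x a b σ X G) (T : ℕ) :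
    ∃ A : ℝ≥0, ∀ k ≥ T, energy P (fun s ω => X (k + 1) s ω - X k s ω) T ≤ A * (16⁻¹) ^ k ∧
      eLpNorm (fun z : Ω × ℝ≥0 => (G (k + 1)).eval z.2 z.1 - (G k).eval z.2 z.1) 2
        (pathMeasure P T) ^ 2 ≤ A * (16⁻¹) ^ k ∧
      ∀ t ≤ (T : ℝ≥0), eLpNorm (fun ω => X (k + 2) t ω - X (k + 1) t ω) 2 P ^ 2 ≤
        A * (16⁻¹) ^ k := by
  set f : ℕ → ℝ≥0 → ℝ≥0∞ := fun k t => eLpNorm (fun ω => X (k + 1) t ω - X k t ω) 2 P ^ 2 with hf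
  have hfm : ∀ k, Measurable (f k) := fun k => by
    have : f k = fun t => ∫⁻ ω, ENNReal.ofReal ((X (k + 1) t ω - X k t ω) ^ 2) ∂P := by
      ext t; rw [hf]; exact eLpNorm_two_sq _ _
    rw [this]
    exact Measurable.lintegral_prod_left' (f := fun z : Ω × ℝ≥0 =>
      ENNReal.ofReal ((X (k + 1) z.2 z.1 - X k z.2 z.1) ^ 2))
      ((h.measurable_sub (k + 1) k).pow_const 2).ennreal_ofReal
  have hen : ∀ k t, energy P (fun s ω => X (k + 1) s ω - X k s ω) t =
      ∫⁻ s in Set.Iic t, f k s ∂timeMeasure :=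
    fun k t => energy_eq_lintegral_time (h.measurable_sub (k + 1) k) t
  have hfin : ∀ k t, energy P (fun s ω => X (k + 1) s ω - X k s ω) t < ∞ := fun k t => by
    rw [energy_eq (f := fun s ω => X (k + 1) s ω - X k s ω) (h.measurable_sub (k + 1) k)]
    exact ENNReal.pow_lt_top
      (((h.iterate (k + 1)).memLp_path t).sub ((h.iterate k).memLp_path t)).eLpNorm_lt_top
  set K : ℝ≥0 := 2 * (T * ‖a‖₊ ^ 2 + 2 * L ^ 2) with hK
  have hrec : ∀ k ≥ T, ∀ t ≤ (T : ℝ≥0),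
      f (k + 1) t ≤ K * (∫⁻ s in Set.Iic t, f k s ∂timeMeasure) + (16 : ℝ≥0) * (16⁻¹) ^ k := by
    intro k hk t ht
    have htk : t ≤ k := ht.trans (by exact_mod_cast hk)
    have e1 : ∀ᵐ ω ∂P, X (k + 2) t ω - X (k + 1) t ω =
        (∫ s in Set.Iic t, (a * (X (k + 1) s ω - X k s ω)) ∂timeMeasure) +
        ((G (k + 1)).integral W t ω - (G k).integral W t ω) := by
      filter_upwards [h.step (k + 1), h.step k] with ω h1 h2
      rw [h1 t, h2 t, ← h.drift_sub (k + 1) k ω t]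
      ring
    have e2 := eLpNorm_const_mul_primitive_sq_le (P := P)
      (f := fun s ω => X (k + 1) s ω - X k s ω) (h.measurable_sub (k + 1) k) a t
    have e3 := h.eLpNorm_eval_sub_le hσ htk
    rw [← SimpleProcess.eLpNorm_integral_sub hW] at e3
    rw [hen] at e2 e3
    have m1 : AEStronglyMeasurable
        (fun ω => ∫ s in Set.Iic t, (a * (X (k + 1) s ω - X k s ω)) ∂timeMeasure) P :=
      ((measurable_primitive (f := fun s ω => a * (X (k + 1) s ω - X k s ω))
        ((h.measurable_sub (k + 1) k).const_mul a)).comp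
          measurable_prodMk_right).aestronglyMeasurable
    have m2 := (((G (k + 1)).memLp_integral hW t).sub
      ((G k).memLp_integral hW t)).aestronglyMeasurable
    calc f (k + 1) t = eLpNorm (fun ω =>
          (∫ s in Set.Iic t, (a * (X (k + 1) s ω - X k s ω)) ∂timeMeasure) +
          ((G (k + 1)).integral W t ω - (G k).integral W t ω)) 2 P ^ 2 := by
            rw [hf]; beta_reduce; rw [eLpNorm_congr_ae e1]
      _ ≤ (eLpNorm (fun ω =>
            ∫ s in Set.Iic t, (a * (X (k + 1) s ω - X k s ω)) ∂timeMeasure) 2 P +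
          eLpNorm (fun ω => (G (k + 1)).integral W t ω - (G k).integral W t ω) 2 P) ^ 2 := by
          gcongr
          exact eLpNorm_add_le m1 m2 one_le_two
      _ ≤ 2 * (T * ‖a‖₊ ^ 2 * (∫⁻ s in Set.Iic t, f k s ∂timeMeasure) +
          2 * ((2 * (4⁻¹) ^ k) ^ 2 + L ^ 2 * ∫⁻ s in Set.Iic t, f k s ∂timeMeasure)) := by
          refine (add_sq_le_two_mul _ _).trans ?_
          gcongr
          refine e2.trans ?_
          gcongr
          exact_mod_cast ht
      _ = _ := by
          rw [mul_pow, four_inv_pow_sq, hK]; push_cast; ring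
  obtain ⟨A, hA⟩ := picard_bound hfm (T := T) (K := K) (C := 16) (k₀ := T)
    (by rw [← hen]; exact (hfin T T).ne) hrec
  refine ⟨A + (2 * (4 + L ^ 2 * A)) + (K * A + 16), fun k hk => ⟨?_, ?_, fun t ht => ?_⟩⟩
  · rw [hen]
    refine (hA k hk).trans ?_
    gcongr
    rw [add_assoc]
    exact le_self_add
  · refine (h.eLpNorm_eval_sub_le hσ (k := k) (t := T) (by exact_mod_cast hk)).trans ?_
    rw [hen, mul_pow, four_inv_pow_sq]
    refine (mul_le_mul_right (add_le_add le_rfl (mul_le_mul_right (hA k hk) _)) _).trans ?_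
    calc (2 : ℝ≥0∞) * (2 ^ 2 * 16⁻¹ ^ k + L ^ 2 * (A * 16⁻¹ ^ k)) =
          ((2 * (4 + L ^ 2 * A) : ℝ≥0) : ℝ≥0∞) * 16⁻¹ ^ k := by push_cast; ring
      _ ≤ _ := by
        gcongr
        rw [add_comm A, add_assoc]
        exact le_self_add
  · refine (hrec k hk t ht).trans ?_
    calc _ ≤ (K : ℝ≥0∞) * (A * 16⁻¹ ^ k) + (16 : ℝ≥0) * 16⁻¹ ^ k := by
          gcongr
          exact (lintegral_mono_set (Set.Iic_subset_Iic.2 ht)).trans (hA k hk)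
      _ = ((K * A + 16 : ℝ≥0) : ℝ≥0∞) * 16⁻¹ ^ k := by push_cast; ring
      _ ≤ _ := mul_le_mul_left (ENNReal.coe_le_coe.2 le_add_self) _

end IsPicardSequence

namespace IsPicardSequence

variable {x a b : ℝ} {σ : ℝ → ℝ} {L : ℝ≥0} {X : ℕ → ℝ≥0 → Ω → ℝ} {G : ℕ → SimpleProcess 𝓕}

lemma two_pow_mul_four_inv_pow (k : ℕ) : (2 : ℝ≥0∞) ^ k * (4⁻¹) ^ k = (2⁻¹) ^ k := by
  rw [← mul_pow]
  congr 1
  rw [show (4 : ℝ≥0∞) = 2 * 2 by norm_num, ENNReal.mul_inv (by simp) (by simp), ← mul_assoc,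
    ENNReal.mul_inv_cancel (by simp) (by simp), one_mul]

lemma two_pow_mul_two_inv_pow (k : ℕ) : (2 : ℝ≥0∞) ^ k * (2⁻¹) ^ k = 1 := by
  rw [← mul_pow, ENNReal.mul_inv_cancel (by simp) (by simp), one_pow]

lemma le_of_sq_le_mul_sixteen_inv_pow {p : ℝ≥0∞} {A : ℝ≥0} {k : ℕ}
    (h : p ^ 2 ≤ A * (16⁻¹) ^ k) : p ≤ ((A + 1 : ℝ≥0) : ℝ≥0∞) * (4⁻¹) ^ k := by
  refine le_of_not_gt fun hlt => ?_
  refine (ENNReal.pow_lt_pow_left two_ne_zero hlt).not_ge (h.trans ?_)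
  rw [mul_pow, four_inv_pow_sq]
  gcongr
  rw [← ENNReal.coe_pow]
  exact ENNReal.coe_le_coe.2 (by nlinarith [zero_le (a := A)])

lemma meas_le_of_two_inv_pow_mul_le {p A : ℝ≥0∞} {k : ℕ} (h : (2⁻¹) ^ k * p ≤ A * (4⁻¹) ^ k) :
    p ≤ A * (2⁻¹) ^ k := by
  calc p = 2 ^ k * ((2⁻¹) ^ k * p) := by rw [← mul_assoc, two_pow_mul_two_inv_pow, one_mul]
    _ ≤ 2 ^ k * (A * (4⁻¹) ^ k) := by gcongr
    _ = A * (2⁻¹) ^ k := by rw [mul_left_comm, two_pow_mul_four_inv_pow]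

/-- The martingale part of the iterate `X (k + 1)`, in a version with continuous paths. -/
def martingalePart (x a b : ℝ) (X : ℕ → ℝ≥0 → Ω → ℝ) (k : ℕ) (t : ℝ≥0) (ω : Ω) : ℝ :=
  X (k + 1) t ω - x - ∫ s in Set.Iic t, (a * X k s ω + b) ∂timeMeasure

lemma martingalePart_continuous (h : IsPicardSequence P 𝓕 W x a b σ X G) (k : ℕ) (ω : Ω) :
    Continuous fun t => martingalePart x a b X k t ω :=
  (((h.iterate (k + 1)).continuous ω).sub continuous_const).sub
    ((h.iterate k).drift_continuous a b ω)

lemma martingalePart_adapted (h : IsPicardSequence P 𝓕 W x a b σ X G) (k : ℕ) :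
    StronglyAdapted 𝓕 (martingalePart x a b X k) := fun t =>
  (((h.iterate (k + 1)).adapted t).sub stronglyMeasurable_const).sub
    (stronglyAdapted_primitive ((h.iterate k).affine_progressive a b) t)

lemma martingalePart_ae_eq (h : IsPicardSequence P 𝓕 W x a b σ X G) (k : ℕ) :
    ∀ᵐ ω ∂P, ∀ t, martingalePart x a b X k t ω = (G k).integral W t ω := by
  filter_upwards [h.step k] with ω hω t
  rw [martingalePart, hω t]
  ring

/-- The maximal inequality, applied to the increments of the martingale parts. -/
lemma meas_martingalePart_le [IsProbabilityMeasure P] (hW : IsBrownianBasis P 𝓕 W)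
    (h : IsPicardSequence P 𝓕 W x a b σ X G) (k : ℕ) (T ε : ℝ≥0) :
    ε * P {ω | ∃ t ≤ T, (ε : ℝ) <
        |martingalePart x a b X (k + 1) t ω - martingalePart x a b X k t ω|} ≤
      eLpNorm (fun z : Ω × ℝ≥0 => (G (k + 1)).eval z.2 z.1 - (G k).eval z.2 z.1) 2
        (pathMeasure P T) := by
  have hae : ∀ t, (fun ω => martingalePart x a b X (k + 1) t ω - martingalePart x a b X k t ω)
      =ᵐ[P] fun ω => (G (k + 1)).integral W t ω - (G k).integral W t ω := fun t => by
    filter_upwards [h.martingalePart_ae_eq (k + 1), h.martingalePart_ae_eq k] with ω h1 h2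
    rw [h1, h2]
  have hL : ∀ t, MemLp (fun ω => (G (k + 1)).integral W t ω - (G k).integral W t ω) 2 P :=
    fun t => ((G (k + 1)).memLp_integral hW t).sub ((G k).memLp_integral hW t)
  refine (maximal_inequality
    (N := fun t ω => martingalePart x a b X (k + 1) t ω - martingalePart x a b X k t ω)
    (fun ω => (h.martingalePart_continuous (k + 1) ω).sub (h.martingalePart_continuous k ω))
    (fun t => (h.martingalePart_adapted (k + 1) t).sub (h.martingalePart_adapted k t))
    (fun t => (memLp_congr_ae (hae t)).2 (hL t)) (fun s t hst Z hZ hZ2 => ?_) T ε).trans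
    (le_of_eq ?_)
  · have i := fun j => hZ2.integrable_mul
      (((G j).memLp_integral hW t).sub ((G j).memLp_integral hW s))
    have z := fun j => (G j).integral_mul_integral_sub hW hst hZ hZ2
    calc _ = ∫ ω, (Z ω * ((G (k + 1)).integral W t ω - (G (k + 1)).integral W s ω) -
          Z ω * ((G k).integral W t ω - (G k).integral W s ω)) ∂P := by
          refine integral_congr_ae ?_
          filter_upwards [hae t, hae s] with ω h1 h2
          rw [h1, h2]; ring
      _ = 0 := by
          have := integral_sub (i (k + 1)) (i k)
          simp only [Pi.mul_apply, Pi.sub_apply, z, sub_zero] at this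
          exact this
  · rw [eLpNorm_congr_ae (hae T), SimpleProcess.eLpNorm_integral_sub hW]

/-- The iterates almost surely converge uniformly on compact time intervals: by the maximal
inequality for the martingale parts and Chebyshev's inequality for the drift parts, the exceptional
probabilities are summable, and the Borel–Cantelli lemma applies. -/
lemma ae_eventually_sub_le [IsProbabilityMeasure P] (hW : IsBrownianBasis P 𝓕 W)
    (hσ : LipschitzWith L σ) (h : IsPicardSequence P 𝓕 W x a b σ X G) :
    ∀ᵐ ω ∂P, ∀ n : ℕ, ∀ᶠ k in atTop, ∀ t ≤ (n : ℝ≥0),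
      |X (k + 2) t ω - X (k + 1) t ω| ≤ 2 * (1 / 2) ^ k := by
  rw [ae_all_iff]
  intro n
  obtain ⟨A, hA⟩ := h.exists_bound hW hσ n
  set D : ℕ → Ω → ℝ := fun k ω =>
    ∫ s in Set.Iic (n : ℝ≥0), |a * (X (k + 1) s ω - X k s ω)| ∂timeMeasure with hD
  set S₁ : ℕ → Set Ω := fun k => {ω | ∃ t ≤ (n : ℝ≥0), (((2⁻¹ : ℝ≥0) ^ k : ℝ≥0) : ℝ) <
    |martingalePart x a b X (k + 1) t ω - martingalePart x a b X k t ω|} with hS₁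
  set S₂ : ℕ → Set Ω := fun k => {ω | ((2⁻¹ : ℝ≥0∞)) ^ k ≤ ‖D k ω‖ₑ} with hS₂
  have hP₁ : ∀ k ≥ n, P (S₁ k) ≤ ((A + 1 : ℝ≥0) : ℝ≥0∞) * (2⁻¹) ^ k := fun k hk => by
    refine meas_le_of_two_inv_pow_mul_le ?_
    refine le_trans ?_ (le_of_sq_le_mul_sixteen_inv_pow (hA k hk).2.1)
    refine le_trans (le_of_eq ?_) (h.meas_martingalePart_le hW k n ((2⁻¹) ^ k))
    congr 1
    rw [ENNReal.coe_pow, ENNReal.coe_inv two_ne_zero]; rfl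
  have hP₂ : ∀ k ≥ n, P (S₂ k) ≤ ((n * ‖a‖₊ ^ 2 * A + 1 : ℝ≥0) : ℝ≥0∞) * (2⁻¹) ^ k := by
    intro k hk
    have hm := ((h.measurable_sub (k + 1) k).const_mul a).abs
    have e1 := eLpNorm_primitive_sq_le (P := P)
      (f := fun s ω => |a * (X (k + 1) s ω - X k s ω)|) hm n
    have e2 : energy P (fun s ω => |a * (X (k + 1) s ω - X k s ω)|) n ≤
        ‖a‖₊ ^ 2 * energy P (fun s ω => X (k + 1) s ω - X k s ω) n := by
      rw [energy_eq (f := fun s ω => |a * (X (k + 1) s ω - X k s ω)|) hm,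
        energy_eq (f := fun s ω => X (k + 1) s ω - X k s ω) (h.measurable_sub (k + 1) k),
        ← mul_pow]
      gcongr
      refine (eLpNorm_norm (fun z : Ω × ℝ≥0 => a * (X (k + 1) z.2 z.1 - X k z.2 z.1))).le.trans ?_
      exact (eLpNorm_const_smul a _ 2 (pathMeasure P n)).le
    have e3 : eLpNorm (D k) 2 P ^ 2 ≤ ((n * ‖a‖₊ ^ 2 * A : ℝ≥0) : ℝ≥0∞) * (16⁻¹) ^ k := by
      refine e1.trans ((mul_le_mul_right (e2.trans (mul_le_mul_right (hA k hk).1 _)) _).trans ?_)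
      push_cast
      exact le_of_eq (by ring)
    have hDm : AEStronglyMeasurable (D k) P :=
      ((measurable_primitive (f := fun s ω => |a * (X (k + 1) s ω - X k s ω)|) hm).comp
        measurable_prodMk_right).aestronglyMeasurable
    have e4 := mul_meas_ge_le_pow_eLpNorm' P one_ne_zero (by simp) hDm ((2⁻¹) ^ k)
    simp only [ENNReal.toReal_one, ENNReal.rpow_one] at e4
    exact meas_le_of_two_inv_pow_mul_le (e4.trans
      ((eLpNorm_le_eLpNorm_of_exponent_le one_le_two hDm).trans
        (le_of_sq_le_mul_sixteen_inv_pow e3)))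
  have hsum : ∑' k, P (S₁ (k + n) ∪ S₂ (k + n)) ≠ ∞ := by
    refine ne_top_of_le_ne_top ?_ (ENNReal.tsum_le_tsum fun k =>
      (measure_union_le _ _).trans (add_le_add (hP₁ (k + n) (Nat.le_add_left _ _))
        (hP₂ (k + n) (Nat.le_add_left _ _))))
    simp_rw [← add_mul, pow_add]
    rw [ENNReal.tsum_mul_left, ENNReal.tsum_mul_right, ENNReal.tsum_geometric]
    have : (1 - 2⁻¹ : ℝ≥0∞)⁻¹ ≠ ∞ := by simp
    finiteness
  filter_upwards [ae_eventually_notMem hsum] with ω hω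
  rw [← eventually_map (m := fun k => k + n) (P := fun k => ω ∉ S₁ k ∪ S₂ k),
    map_add_atTop_eq_nat] at hω
  filter_upwards [hω] with k hk t ht
  have k1 : ω ∉ S₁ k := fun h' => hk (Or.inl h')
  have k2 : ω ∉ S₂ k := fun h' => hk (Or.inr h')
  simp only [hS₁, Set.mem_ofPred_eq, not_exists, not_and, not_lt] at k1
  simp only [hS₂, Set.mem_ofPred_eq, not_le] at k2
  have k1 := k1 t ht
  have k3 : |D k ω| ≤ (1 / 2) ^ k := by
    have : ‖D k ω‖ₑ < (((2⁻¹ : ℝ≥0) ^ k : ℝ≥0) : ℝ≥0∞) := by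
      rw [ENNReal.coe_pow, ENNReal.coe_inv two_ne_zero]; exact k2
    rw [enorm_eq_nnnorm, ENNReal.coe_lt_coe, ← NNReal.coe_lt_coe] at this
    simpa using this.le
  have k4 : |∫ s in Set.Iic t, (a * (X (k + 1) s ω - X k s ω)) ∂timeMeasure| ≤ |D k ω| := by
    rw [← Real.norm_eq_abs]
    refine (norm_integral_le_integral_norm _).trans (le_trans ?_ (le_abs_self _))
    refine setIntegral_mono_set ?_ (Eventually.of_forall fun s => abs_nonneg _)
      (Set.Iic_subset_Iic.2 ht).eventuallyLE
    have := ((h.iterate (k + 1)).integrableOn a b ω n).sub ((h.iterate k).integrableOn a b ω n)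
    refine (this.congr (Eventually.of_forall fun s => ?_)).abs
    simp only [Pi.sub_apply]
    ring
  have k5 : X (k + 2) t ω - X (k + 1) t ω =
      (martingalePart x a b X (k + 1) t ω - martingalePart x a b X k t ω) +
      ∫ s in Set.Iic t, (a * (X (k + 1) s ω - X k s ω)) ∂timeMeasure := by
    rw [← h.drift_sub (k + 1) k ω t, martingalePart, martingalePart]
    ring
  have k6 : (((2⁻¹ : ℝ≥0) ^ k : ℝ≥0) : ℝ) = (1 / 2) ^ k := by simp
  rw [k6] at k1
  rw [k5]
  refine (abs_add_le _ _).trans ?_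
  linarith

/-- Distance of an iterate to all later ones. -/
lemma exists_bound_sub [IsProbabilityMeasure P] (hW : IsBrownianBasis P 𝓕 W)
    (hσ : LipschitzWith L σ) (h : IsPicardSequence P 𝓕 W x a b σ X G) (T : ℕ) :
    ∃ A : ℝ≥0, ∀ k ≥ T, ∀ j, ∀ t ≤ (T : ℝ≥0),
      eLpNorm (fun ω => X (k + 1) t ω - X (k + 1 + j) t ω) 2 P ≤ A * (2⁻¹) ^ k := by
  obtain ⟨A, hA⟩ := h.exists_bound hW hσ T
  have hm : ∀ k t, AEStronglyMeasurable (X k t) P := fun k t =>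
    (((h.iterate k).adapted t).mono (𝓕.le t)).aestronglyMeasurable
  have h1 : ∀ k ≥ T, ∀ t ≤ (T : ℝ≥0), eLpNorm (fun ω => X (k + 1) t ω - X (k + 2) t ω) 2 P ≤
      ((A + 1 : ℝ≥0) : ℝ≥0∞) * (2⁻¹) ^ k := fun k hk t ht => by
    rw [eLpNorm_two_sub_comm]
    refine (le_of_sq_le_mul_sixteen_inv_pow ((hA k hk).2.2 t ht)).trans ?_
    gcongr
    norm_num
  refine ⟨2 * (A + 1), fun k hk j t ht => ?_⟩
  induction j generalizing k with
  | zero => simp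
  | succ j ih =>
    have e := eLpNorm_two_sub_le (hm (k + 1) t) (hm (k + 2) t) (hm (k + 1 + (j + 1)) t)
    have i := ih (k + 1) (hk.trans (Nat.le_succ k))
    rw [show k + 1 + 1 + j = k + 1 + (j + 1) by ring] at i
    refine (e.trans (add_le_add (h1 k hk t ht) i)).trans (le_of_eq ?_)
    push_cast
    have h2 : (2 : ℝ≥0∞) * 2⁻¹ = 1 := ENNReal.mul_inv_cancel (by simp) (by simp)
    calc _ = ((A : ℝ≥0∞) + 1) * 2⁻¹ ^ k + (2 * 2⁻¹) * ((A + 1) * 2⁻¹ ^ k) := by ring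
      _ = _ := by rw [h2]; ring

/-- The limit of the iterates, as a continuous adapted process. -/
lemma exists_limit [IsProbabilityMeasure P] (hW : IsBrownianBasis P 𝓕 W)
    (hσ : LipschitzWith L σ) (h : IsPicardSequence P 𝓕 W x a b σ X G) :
    ∃ Y : ℝ≥0 → Ω → ℝ, (∀ ω, Continuous fun t => Y t ω) ∧ StronglyAdapted 𝓕 Y ∧
      ∀ T : ℕ, ∃ A : ℝ≥0, ∀ k ≥ T, ∀ t ≤ (T : ℝ≥0),
        eLpNorm (fun ω => X (k + 1) t ω - Y t ω) 2 P ≤ A * (2⁻¹) ^ k := by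
  -- On the null set where the iterates need not converge they are replaced by zero; this keeps the
  -- limit adapted, because the filtration contains all null sets.
  set Γ : Set Ω := {ω | ∀ n : ℕ, ∀ᶠ k in atTop, ∀ t ≤ (n : ℝ≥0),
      |X (k + 2) t ω - X (k + 1) t ω| ≤ 2 * (1 / 2) ^ k} with hΓ
  have hΓ1 : ∀ᵐ ω ∂P, ω ∈ Γ := h.ae_eventually_sub_le hW hσ
  have hΓm : ∀ t, MeasurableSet[𝓕 t] Γ := fun t => by
    have := hW.null_measurable Γᶜ hΓ1
    rw [← compl_compl Γ]
    exact (𝓕.mono (zero_le : 0 ≤ t) _ this).compl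
  have hlim : ∀ ω, ∃ v : ℝ≥0 → ℝ, Continuous v ∧
      ∀ t, Tendsto (fun k => Γ.indicator (X (k + 1) t) ω) atTop (𝓝 (v t)) := fun ω => by
    by_cases hω : ω ∈ Γ
    · simp only [Set.indicator_of_mem hω]
      exact exists_continuous_limit (u := fun k t => X (k + 1) t ω)
        (fun k => (h.iterate (k + 1)).continuous ω) hω
    · simp only [Set.indicator_of_notMem hω]
      exact ⟨fun _ => 0, continuous_const, fun _ => tendsto_const_nhds⟩
  choose v hvc hvl using hlim
  refine ⟨fun t ω => v ω t, hvc, fun t => ?_, fun T => ?_⟩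
  · exact stronglyMeasurable_of_tendsto (m := 𝓕 t) atTop
      (fun k => ((h.iterate (k + 1)).adapted t).indicator (hΓm t))
      (tendsto_pi_nhds.2 fun ω => hvl ω t)
  · obtain ⟨A, hA⟩ := h.exists_bound_sub hW hσ T
    refine ⟨A, fun k hk t ht => ?_⟩
    have hm : ∀ k t, AEStronglyMeasurable (X k t) P := fun k t =>
      (((h.iterate k).adapted t).mono (𝓕.le t)).aestronglyMeasurable
    refine (Lp.eLpNorm_lim_le_liminf_eLpNorm (p := 2) (μ := P)
      (f := fun j ω => X (k + 1) t ω - X (k + 1 + j) t ω)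
      (fun j => (hm (k + 1) t).sub (hm (k + 1 + j) t)) _ ?_).trans ?_
    · filter_upwards [hΓ1] with ω hω
      have := hvl ω t
      simp only [Set.indicator_of_mem hω] at this
      refine tendsto_const_nhds.sub ?_
      have := this.comp (tendsto_add_atTop_nat k)
      refine this.congr fun j => ?_
      simp only [Function.comp]
      rw [show j + k + 1 = k + 1 + j by ring]
    · exact liminf_le_of_le ⟨0, by simp⟩ fun c hc =>
        (hc.exists.choose_spec).trans (hA k hk _ t ht)

end IsPicardSequence

/-- **Existence** of a strong solution of `dX = (a X + b) dt + σ(X) dW` with Lipschitz `σ`. -/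
theorem exists_isItoProcess [IsProbabilityMeasure P] (hW : IsBrownianBasis P 𝓕 W) (x a b : ℝ)
    {σ : ℝ → ℝ} {L : ℝ≥0} (hσ : LipschitzWith L σ) :
    ∃ X : ℝ≥0 → Ω → ℝ,
      IsItoProcess P 𝓕 W x (fun t ω => a * X t ω + b) (fun t ω => σ (X t ω)) X := by
  obtain ⟨X, G, h⟩ := exists_isPicardSequence hW x a b hσ
  obtain ⟨Y, hYc, hYa, hXY⟩ := h.exists_limit hW hσ
  have hYp : IsStronglyProgressive 𝓕 Y := hYa.isStronglyProgressive_of_continuous hYc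
  have hYm := hYp.measurable_uncurry
  have hdm : ∀ n, Measurable fun z : Ω × ℝ≥0 => X n z.2 z.1 - Y z.2 z.1 := fun n =>
    (h.iterate n).measurable.sub hYm
  have hpow : Tendsto (fun k : ℕ => ((2⁻¹ : ℝ≥0∞)) ^ k) atTop (𝓝 0) :=
    ENNReal.tendsto_pow_atTop_nhds_zero_of_lt_one (by simp)
  have hten : ∀ A : ℝ≥0∞, A ≠ ∞ → Tendsto (fun k : ℕ => A * (2⁻¹) ^ k) atTop (𝓝 0) :=
    fun A hA => by simpa using ENNReal.Tendsto.const_mul hpow (Or.inr hA)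
  have hten2 : ∀ A : ℝ≥0∞, A ≠ ∞ → Tendsto (fun k : ℕ => (A * (2⁻¹) ^ k) ^ 2) atTop (𝓝 0) :=
    fun A hA => by simpa using ENNReal.Tendsto.pow (n := 2) (hten A hA)
  have hpt : ∀ T : ℝ≥0, Tendsto (fun k => eLpNorm (fun ω => X (k + 1) T ω - Y T ω) 2 P) atTop
      (𝓝 0) := fun T => by
    obtain ⟨A, hA⟩ := hXY ⌈T⌉₊
    refine tendsto_of_tendsto_of_tendsto_of_le_of_le' tendsto_const_nhds
      (hten A ENNReal.coe_ne_top) (Eventually.of_forall fun _ => zero_le) ?_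
    filter_upwards [eventually_ge_atTop ⌈T⌉₊] with k hk
    exact hA k hk T (Nat.le_ceil T)
  have henb : ∀ T : ℝ≥0, ∃ A : ℝ≥0, ∀ k ≥ ⌈T⌉₊,
      energy P (fun t ω => X (k + 1) t ω - Y t ω) T ≤ (A * (2⁻¹) ^ k) ^ 2 * T := fun T => by
    obtain ⟨A, hA⟩ := hXY ⌈T⌉₊
    refine ⟨A, fun k hk => ?_⟩
    rw [energy_eq_lintegral_time (f := fun t ω => X (k + 1) t ω - Y t ω) (hdm (k + 1))]
    refine (setLIntegral_mono measurable_const fun t ht =>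
      pow_le_pow_left₀ zero_le (hA k hk t ((Set.mem_Iic.1 ht).trans (Nat.le_ceil T))) 2).trans ?_
    rw [setLIntegral_const, timeMeasure_apply_Iic]
  have hen : ∀ T : ℝ≥0, Tendsto (fun k => energy P (fun t ω => X (k + 1) t ω - Y t ω) T) atTop
      (𝓝 0) := fun T => by
    obtain ⟨A, hA⟩ := henb T
    refine tendsto_of_tendsto_of_tendsto_of_le_of_le' tendsto_const_nhds
      (h := fun k : ℕ => ((A : ℝ≥0∞) * (2⁻¹) ^ k) ^ 2 * T) ?_
      (Eventually.of_forall fun _ => zero_le) ?_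
    · simpa using ENNReal.Tendsto.mul_const (hten2 A ENNReal.coe_ne_top)
        (Or.inr (ENNReal.coe_ne_top (r := T)))
    filter_upwards [eventually_ge_atTop ⌈T⌉₊] with k hk
    exact hA k hk
  have hY : IsIterate P 𝓕 Y := ⟨hYc, hYa, fun T => by
    obtain ⟨A, hA⟩ := henb T
    have h1 : energy P (fun t ω => X (⌈T⌉₊ + 1) t ω - Y t ω) T < ∞ := by
      refine (hA ⌈T⌉₊ le_rfl).trans_lt ?_
      have : ((2⁻¹ : ℝ≥0∞)) ^ ⌈T⌉₊ ≠ ∞ := ENNReal.pow_ne_top (by simp)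
      finiteness
    have h2 := ((h.iterate (⌈T⌉₊ + 1)).memLp_path T).sub
      (memLp_of_energy_lt_top (f := fun t ω => X (⌈T⌉₊ + 1) t ω - Y t ω) (hdm _) h1)
    rw [energy_eq hYm]
    refine ENNReal.pow_lt_top ?_
    simpa [Pi.sub_def] using h2.eLpNorm_lt_top⟩
  -- The martingale part of the limit is identified as the Itô integral of `σ(Y)`, with the simple
  -- processes of the iteration as approximating sequence.
  set M : ℝ≥0 → Ω → ℝ := fun t ω =>
    Y t ω - x - ∫ s in Set.Iic t, (a * Y s ω + b) ∂timeMeasure with hM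
  have hMc : ∀ ω, Continuous fun t => M t ω := fun ω =>
    ((hYc ω).sub continuous_const).sub (hY.drift_continuous a b ω)
  have hMa : StronglyAdapted 𝓕 M := fun t =>
    ((hYa t).sub stronglyMeasurable_const).sub
      (stronglyAdapted_primitive (hY.affine_progressive a b) t)
  have hσp : IsStronglyProgressive 𝓕 fun t ω => σ (Y t ω) :=
    fun t => hσ.continuous.comp_stronglyMeasurable (hYp t)
  refine ⟨Y, hYp, Eventually.of_forall hYc, hY.affine_progressive a b, hY.affine_energy a b,
    M, ⟨hσp, fun T => energy_lipschitz_lt_top hσ hYm (hY.energy_lt_top T),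
      hMa.isStronglyProgressive_of_continuous hMc, Eventually.of_forall hMc,
      fun k => G (k + 1), fun T => ⟨?_, ?_⟩⟩, fun t => Eventually.of_forall fun ω => ?_⟩
  · have hfour : Tendsto (fun k : ℕ => ((4⁻¹ : ℝ≥0∞)) ^ (k + 1)) atTop (𝓝 0) :=
      (ENNReal.tendsto_pow_atTop_nhds_zero_of_lt_one (by simp)).comp (tendsto_add_atTop_nat 1)
    have lim : Tendsto (fun k : ℕ => 2 * ((((4⁻¹ : ℝ≥0∞)) ^ (k + 1)) ^ 2 +
        L ^ 2 * energy P (fun t ω => X (k + 1) t ω - Y t ω) T)) atTop (𝓝 0) := by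
      have l1 := ENNReal.Tendsto.pow (n := 2) hfour
      have l2 := ENNReal.Tendsto.const_mul (a := (L : ℝ≥0∞) ^ 2) (hen T) (Or.inr (by finiteness))
      simpa using ENNReal.Tendsto.const_mul (a := 2) (l1.add l2) (Or.inr (by simp))
    refine tendsto_of_tendsto_of_tendsto_of_le_of_le' tendsto_const_nhds lim
      (Eventually.of_forall fun _ => zero_le) ?_
    filter_upwards [eventually_ge_atTop ⌈T⌉₊] with k hk
    have hT : T ≤ ((k + 1 : ℕ) : ℝ≥0) :=
      (Nat.le_ceil T).trans (by exact_mod_cast hk.trans (Nat.le_succ k))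
    have hm : Measurable fun z : Ω × ℝ≥0 => σ (Y z.2 z.1) := hσ.continuous.measurable.comp hYm
    have hm' : Measurable fun z : Ω × ℝ≥0 => σ (X (k + 1) z.2 z.1) :=
      hσ.continuous.measurable.comp (h.iterate (k + 1)).measurable
    have hG := (G (k + 1)).measurable_eval
    rw [energy_eq (f := fun s ω => (G (k + 1)).eval s ω - σ (Y s ω)) (hG.sub hm),
      energy_eq (f := fun s ω => X (k + 1) s ω - Y s ω) (hdm (k + 1))]
    have t1 := eLpNorm_two_sub_le (μ := pathMeasure P T) hG.aestronglyMeasurable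
      hm'.aestronglyMeasurable hm.aestronglyMeasurable
    refine (pow_le_pow_left₀ zero_le (t1.trans (add_le_add
      ((eLpNorm_pathMeasure_mono P _ hT).trans (h.approx (k + 1))) le_rfl)) 2).trans ?_
    refine (add_sq_le_two_mul _ _).trans (mul_le_mul_right (add_le_add le_rfl ?_) _)
    exact eLpNorm_lipschitz_sub_sq_le hσ _ _
  · have lim : Tendsto (fun k : ℕ => 2 * (eLpNorm (fun ω => X (k + 1 + 1) T ω - Y T ω) 2 P ^ 2 +
        T * ‖a‖₊ ^ 2 * energy P (fun t ω => X (k + 1) t ω - Y t ω) T)) atTop (𝓝 0) := by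
      have l1 := ENNReal.Tendsto.pow (n := 2) ((hpt T).comp (tendsto_add_atTop_nat 1))
      have l2 := ENNReal.Tendsto.const_mul (a := (T : ℝ≥0∞) * ‖a‖₊ ^ 2) (hen T)
        (Or.inr (by finiteness))
      simpa [Function.comp_def] using
        ENNReal.Tendsto.const_mul (a := 2) (l1.add l2) (Or.inr (by simp))
    refine tendsto_of_tendsto_of_tendsto_of_le_of_le tendsto_const_nhds lim
      (fun _ => zero_le) fun k => ?_
    have e1 : (fun ω => (G (k + 1)).integral W T ω - M T ω) =ᵐ[P] fun ω =>
        (X (k + 1 + 1) T ω - Y T ω) -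
          ∫ s in Set.Iic T, (a * (X (k + 1) s ω - Y s ω)) ∂timeMeasure := by
      filter_upwards [h.step (k + 1)] with ω hω
      have : ∫ s in Set.Iic T, (a * (X (k + 1) s ω - Y s ω)) ∂timeMeasure =
          (∫ s in Set.Iic T, (a * X (k + 1) s ω + b) ∂timeMeasure) -
            ∫ s in Set.Iic T, (a * Y s ω + b) ∂timeMeasure := by
        rw [← integral_sub ((h.iterate (k + 1)).integrableOn a b ω T) (hY.integrableOn a b ω T)]
        exact integral_congr_ae (Eventually.of_forall fun s => by beta_reduce; ring)
      rw [this, hω T, hM]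
      ring
    beta_reduce
    rw [← eLpNorm_two_sq, eLpNorm_congr_ae e1]
    have m1 : AEStronglyMeasurable (fun ω => X (k + 1 + 1) T ω - Y T ω) P :=
      ((hdm (k + 1 + 1)).comp measurable_prodMk_right).aestronglyMeasurable
    have m2 : AEStronglyMeasurable
        (fun ω => ∫ s in Set.Iic T, (a * (X (k + 1) s ω - Y s ω)) ∂timeMeasure) P :=
      ((measurable_primitive (f := fun s ω => a * (X (k + 1) s ω - Y s ω))
        ((hdm (k + 1)).const_mul a)).comp measurable_prodMk_right).aestronglyMeasurable
    refine (pow_le_pow_left₀ zero_le (eLpNorm_sub_le m1 m2 one_le_two) 2).trans ?_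
    refine (add_sq_le_two_mul _ _).trans (mul_le_mul_right (add_le_add le_rfl ?_) _)
    exact eLpNorm_const_mul_primitive_sq_le (f := fun s ω => X (k + 1) s ω - Y s ω)
      (hdm (k + 1)) a T
  · rw [hM]; ring

/-! ### The infinite horizon -/

lemma pathMeasure_eq_restrict (P : Measure Ω) [SFinite P] (T : ℝ≥0) :
    pathMeasure P T = (P.prod timeMeasure).restrict (Prod.snd ⁻¹' Set.Iic T) := by
  have := Measure.prod_restrict (μ := P) (ν := timeMeasure) Set.univ (Set.Iic T)
  rw [Measure.restrict_univ, Set.univ_prod] at this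
  exact this

lemma ae_prod_of_forall_pathMeasure [SFinite P] {p : Ω × ℝ≥0 → Prop}
    (h : ∀ T, ∀ᵐ z ∂(pathMeasure P T), p z) : ∀ᵐ z ∂(P.prod timeMeasure), p z := by
  have h' : ∀ n : ℕ, ∀ᵐ z ∂((P.prod timeMeasure).restrict (Prod.snd ⁻¹' Set.Iic (n : ℝ≥0))),
      p z := fun n => by
    rw [← pathMeasure_eq_restrict]; exact h n
  have hu : (⋃ n : ℕ, (Prod.snd ⁻¹' Set.Iic (n : ℝ≥0) : Set (Ω × ℝ≥0))) = Set.univ := by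
    refine Set.eq_univ_of_forall fun z => ?_
    exact Set.mem_iUnion.2 ⟨⌈z.2⌉₊, Nat.le_ceil z.2⟩
  rw [← Measure.restrict_univ (μ := P.prod timeMeasure), ← hu, ae_restrict_iUnion_iff]
  exact h'

lemma tendsto_integral_pathMeasure [SFinite P] {f : Ω × ℝ≥0 → ℝ}
    (hf : Integrable f (P.prod timeMeasure)) {T : ℕ → ℝ≥0} (hT : Tendsto T atTop atTop) :
    Tendsto (fun k => ∫ z, f z ∂(pathMeasure P (T k))) atTop
      (𝓝 (∫ z, f z ∂(P.prod timeMeasure))) := by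
  have hm : ∀ T : ℝ≥0, MeasurableSet (Prod.snd ⁻¹' Set.Iic T : Set (Ω × ℝ≥0)) := fun T =>
    measurable_snd measurableSet_Iic
  simp_rw [pathMeasure_eq_restrict, ← integral_indicator (hm _)]
  refine tendsto_integral_of_dominated_convergence (fun z => ‖f z‖)
    (fun k => hf.aestronglyMeasurable.indicator (hm _)) hf.norm
    (fun k => Eventually.of_forall fun z => norm_indicator_le_norm_self _ _)
    (Eventually.of_forall fun z => ?_)
  refine tendsto_const_nhds.congr' ?_
  filter_upwards [hT.eventually_ge_atTop z.2] with k hk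
  rw [Set.indicator_of_mem]
  exact hk

lemma integral_exp_pathMeasure [IsProbabilityMeasure P] (δ : ℝ) (T : ℝ≥0) :
    ∫ z : Ω × ℝ≥0, δ * Real.exp (-δ * z.2) ∂(pathMeasure P T) = 1 - Real.exp (-δ * T) := by
  have hexp : IntegrableOn (fun s : ℝ≥0 => δ * Real.exp (-δ * s)) (Set.Iic T) timeMeasure :=
    (Continuous.integrableOn_Icc (a := 0) (b := T) (by fun_prop)).mono_set
      (fun s hs => ⟨zero_le, hs⟩)
  rw [pathMeasure, integral_prod (fun z : Ω × ℝ≥0 => δ * Real.exp (-δ * z.2))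
    (hexp.integrable.comp_snd P)]
  simp only [integral_exp_Iic, integral_const, probReal_univ, one_smul]

lemma integrable_exp_timeMeasure {θ : ℝ} (hθ : 0 < θ) :
    Integrable (fun t : ℝ≥0 => Real.exp (-θ * t)) timeMeasure := by
  have h := (integrableOn_Ici_iff_integrableOn_Ioi).2 (exp_neg_integrableOn_Ioi 0 hθ)
  rw [IntegrableOn, ← map_coe_timeMeasure] at h
  exact (integrable_map_measure h.aestronglyMeasurable
    (measurable_coe_nnreal_real.aemeasurable)).1 h

/-- Along a suitable sequence of horizons, the transversality condition annihilates the discounted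
expectation of every quadratic polynomial of the state. -/
lemma DiscountedLiminfZero.exists_seq [IsProbabilityMeasure P] {ρ : ℝ} (hρ : 0 < ρ)
    {X : ℝ≥0 → Ω → ℝ} (hX : ∀ t, MemLp (X t) 2 P) (h : DiscountedLiminfZero P ρ X) :
    ∃ T : ℕ → ℝ≥0, Tendsto T atTop atTop ∧ ∀ δ ≥ ρ, ∀ p₂ p₁ p₀ : ℝ,
      Tendsto (fun k => Real.exp (-δ * T k) *
        ∫ ω, (1 / 2 * p₂ * X (T k) ω ^ 2 + p₁ * X (T k) ω + p₀) ∂P) atTop (𝓝 0) := by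
  have hval : ∀ T : ℝ≥0, ENNReal.ofReal (Real.exp (-ρ * T)) *
      ∫⁻ ω, ENNReal.ofReal ((X T ω) ^ 2) ∂P =
      ENNReal.ofReal (Real.exp (-ρ * T) * ∫ ω, X T ω ^ 2 ∂P) := fun T => by
    rw [ENNReal.ofReal_mul (Real.exp_pos _).le, ofReal_integral_eq_lintegral_ofReal
      (hX T).integrable_sq (Eventually.of_forall fun ω => sq_nonneg _)]
  have hex : ∀ k : ℕ, ∃ T : ℝ≥0, (k : ℝ≥0) ≤ T ∧
      Real.exp (-ρ * T) * ∫ ω, X T ω ^ 2 ∂P < 1 / (k + 1) := fun k => by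
    have hk : (0 : ℝ) < 1 / (k + 1) := by positivity
    have hlt : liminf (fun T : ℝ≥0 => ENNReal.ofReal (Real.exp (-ρ * T)) *
        ∫⁻ ω, ENNReal.ofReal ((X T ω) ^ 2) ∂P) atTop < ENNReal.ofReal (1 / (k + 1)) := by
      rw [h]; exact ENNReal.ofReal_pos.2 hk
    obtain ⟨T, hT, hkT⟩ := ((frequently_lt_of_liminf_lt (by isBoundedDefault) hlt).and_eventually
      (eventually_ge_atTop (k : ℝ≥0))).exists
    refine ⟨T, hkT, ?_⟩
    rw [hval] at hT
    exact (ENNReal.ofReal_lt_ofReal_iff hk).1 hT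
  choose T hT1 hT2 using hex
  have hTt : Tendsto T atTop atTop :=
    tendsto_atTop_mono hT1 tendsto_natCast_atTop_atTop
  refine ⟨T, hTt, fun δ hδ p₂ p₁ p₀ => ?_⟩
  have l1 : Tendsto (fun k => Real.exp (-ρ * T k) * ∫ ω, X (T k) ω ^ 2 ∂P) atTop (𝓝 0) :=
    squeeze_zero (fun k => mul_nonneg (Real.exp_pos _).le
      (integral_nonneg fun ω => sq_nonneg _)) (fun k => (hT2 k).le)
      tendsto_one_div_add_atTop_nhds_zero_nat
  have l2 : Tendsto (fun k => Real.exp (-ρ * T k)) atTop (𝓝 0) := by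
    refine Real.tendsto_exp_atBot.comp ?_
    exact (NNReal.tendsto_coe_atTop.2 hTt).const_mul_atTop_of_neg (by linarith)
  have l3 : Tendsto (fun k => (|p₂| + |p₁|) * (Real.exp (-ρ * T k) * ∫ ω, X (T k) ω ^ 2 ∂P) +
      (|p₁| + |p₀|) * Real.exp (-ρ * T k)) atTop (𝓝 0) := by
    simpa using (l1.const_mul (|p₂| + |p₁|)).add (l2.const_mul (|p₁| + |p₀|))
  refine squeeze_zero_norm (fun k => ?_) l3
  have i2 := (hX (T k)).integrable_sq
  have hb : ‖∫ ω, (1 / 2 * p₂ * X (T k) ω ^ 2 + p₁ * X (T k) ω + p₀) ∂P‖ ≤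
      (|p₂| + |p₁|) * (∫ ω, X (T k) ω ^ 2 ∂P) + (|p₁| + |p₀|) := by
    have e : (|p₂| + |p₁|) * (∫ ω, X (T k) ω ^ 2 ∂P) + (|p₁| + |p₀|) =
        ∫ ω, ((|p₂| + |p₁|) * X (T k) ω ^ 2 + (|p₁| + |p₀|)) ∂P := by
      rw [integral_add (i2.const_mul _) (integrable_const _), integral_const_mul]
      simp
    rw [e]
    refine norm_integral_le_of_norm_le ((i2.const_mul _).add (integrable_const _))
      (Eventually.of_forall fun ω => ?_)
    have h1 : |X (T k) ω| ≤ X (T k) ω ^ 2 + 1 := by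
      rw [← sq_abs]; nlinarith [sq_nonneg (|X (T k) ω| - 1), abs_nonneg (X (T k) ω)]
    rw [Real.norm_eq_abs]
    refine (abs_add_three _ _ _).trans ?_
    rw [abs_mul, abs_mul, abs_mul, abs_of_nonneg (sq_nonneg (X (T k) ω))]
    have h2 : |(1 / 2 : ℝ)| = 1 / 2 := by norm_num
    rw [h2]
    nlinarith [mul_le_mul_of_nonneg_left h1 (abs_nonneg p₁),
      mul_nonneg (abs_nonneg p₂) (sq_nonneg (X (T k) ω))]
  have hexp : Real.exp (-δ * T k) ≤ Real.exp (-ρ * T k) := by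
    rw [Real.exp_le_exp]
    nlinarith [(T k).2]
  rw [norm_mul, Real.norm_eq_abs, abs_of_pos (Real.exp_pos _)]
  refine (mul_le_mul hexp hb (norm_nonneg _) (Real.exp_pos _).le).trans (le_of_eq ?_)
  ring

/-- **Verification**: the payoff is at most `v(x) + c` if the running reward `ℓ` and the
quadratic `v` satisfy the Hamilton–Jacobi–Bellman inequality with constant `ρ c`. -/
lemma IsItoProcess.payoff_le [IsProbabilityMeasure P] (hW : IsBrownianBasis P 𝓕 W) {x ρ : ℝ}
    (hρ : 0 < ρ) {β γ X : ℝ≥0 → Ω → ℝ} (hX : IsItoProcess P 𝓕 W x β γ X)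
    (ht : DiscountedLiminfZero P ρ X) {ℓ : Ω × ℝ≥0 → ℝ}
    (hℓ : Integrable (fun z => Real.exp (-ρ * z.2) * ℓ z) (P.prod timeMeasure)) (p₂ p₁ p₀ c : ℝ)
    (h : ∀ᵐ z ∂(P.prod timeMeasure), ℓ z + quadraticDrift β γ X ρ p₂ p₁ p₀ z ≤ ρ * c) :
    ∫ z, Real.exp (-ρ * z.2) * ℓ z ∂(P.prod timeMeasure) ≤
      (1 / 2 * p₂ * x ^ 2 + p₁ * x + p₀) + c := by
  obtain ⟨T, hT, hlim⟩ := ht.exists_seq hρ fun t => hX.memLp hW t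
  have hbound : ∀ T : ℝ≥0, ∫ z, Real.exp (-ρ * z.2) * ℓ z ∂(pathMeasure P T) ≤
      (1 / 2 * p₂ * x ^ 2 + p₁ * x + p₀) + c -
        Real.exp (-ρ * T) * ∫ ω, (1 / 2 * p₂ * X T ω ^ 2 + p₁ * X T ω + (p₀ + c)) ∂P := by
    intro T
    have hi := (hX.integrable_quadraticDrift hW ρ p₂ p₁ (p₀ + c) T)
    have hdisc : Integrable (fun z : Ω × ℝ≥0 => Real.exp (-ρ * z.2) *
        quadraticDrift β γ X ρ p₂ p₁ (p₀ + c) z) (pathMeasure P T) := by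
      refine hi.bdd_mul (c := 1) (Measurable.aestronglyMeasurable (by fun_prop))
        (Eventually.of_forall fun z => ?_)
      rw [Real.norm_eq_abs, abs_of_pos (Real.exp_pos _), Real.exp_le_one_iff]
      nlinarith [z.2.2, mul_nonneg hρ.le z.2.2]
    have hℓT : Integrable (fun z => Real.exp (-ρ * z.2) * ℓ z) (pathMeasure P T) := by
      rw [pathMeasure_eq_restrict]; exact hℓ.restrict
    have hT : ∀ᵐ z ∂(pathMeasure P T), ℓ z + quadraticDrift β γ X ρ p₂ p₁ p₀ z ≤ ρ * c := by
      rw [pathMeasure_eq_restrict]; exact ae_restrict_of_ae h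
    rw [hX.discounted_quadratic hW ρ p₂ p₁ (p₀ + c) T]
    have : ∫ z, Real.exp (-ρ * z.2) * ℓ z ∂(pathMeasure P T) ≤
        ∫ z, -(Real.exp (-ρ * z.2) * quadraticDrift β γ X ρ p₂ p₁ (p₀ + c) z)
          ∂(pathMeasure P T) := by
      refine integral_mono_ae hℓT hdisc.neg ?_
      filter_upwards [hT] with z hz
      have e : quadraticDrift β γ X ρ p₂ p₁ (p₀ + c) z =
          quadraticDrift β γ X ρ p₂ p₁ p₀ z - ρ * c := by
        simp only [quadraticDrift]; ring
      rw [e]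
      nlinarith [Real.exp_pos (-ρ * z.2)]
    rw [integral_neg] at this
    linarith
  refine le_of_tendsto_of_tendsto' (tendsto_integral_pathMeasure hℓ hT) ?_ fun k => hbound (T k)
  simpa using tendsto_const_nhds (x := (1 / 2 * p₂ * x ^ 2 + p₁ * x + p₀) + c) |>.sub
    (hlim ρ le_rfl p₂ p₁ (p₀ + c))

/-- The case of equality, by applying the inequality to `ℓ` and to `-ℓ`. -/
lemma IsItoProcess.payoff_eq [IsProbabilityMeasure P] (hW : IsBrownianBasis P 𝓕 W) {x ρ : ℝ}
    (hρ : 0 < ρ) {β γ X : ℝ≥0 → Ω → ℝ} (hX : IsItoProcess P 𝓕 W x β γ X)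
    (ht : DiscountedLiminfZero P ρ X) {ℓ : Ω × ℝ≥0 → ℝ}
    (hℓ : Integrable (fun z => Real.exp (-ρ * z.2) * ℓ z) (P.prod timeMeasure)) (p₂ p₁ p₀ c : ℝ)
    (h : ∀ᵐ z ∂(P.prod timeMeasure), ℓ z + quadraticDrift β γ X ρ p₂ p₁ p₀ z = ρ * c) :
    ∫ z, Real.exp (-ρ * z.2) * ℓ z ∂(P.prod timeMeasure) =
      (1 / 2 * p₂ * x ^ 2 + p₁ * x + p₀) + c := by
  refine le_antisymm (hX.payoff_le hW hρ ht hℓ p₂ p₁ p₀ c (h.mono fun z hz => hz.le)) ?_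
  have hℓ' : Integrable (fun z => Real.exp (-ρ * z.2) * -ℓ z) (P.prod timeMeasure) := by
    simpa only [mul_neg] using hℓ.fun_neg
  have := hX.payoff_le hW hρ ht hℓ' (-p₂) (-p₁) (-p₀) (-c) (h.mono fun z hz => by
    refine le_of_eq ?_
    rw [mul_neg, ← hz]
    simp only [quadraticDrift]
    ring)
  simp only [mul_neg, integral_neg] at this
  linarith

/-! ### Linear closed-loop dynamics -/

/-- `X` solves `dX = (a X + b) dt + γ dW`, `X_0 = x`, with `γ² = (c X + d)² + e`. -/
structure IsClosedLoop (P : Measure Ω) (𝓕 : Filtration ℝ≥0 mΩ) (W : ℝ≥0 → Ω → ℝ)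
    (x a b c d e : ℝ) (γ X : ℝ≥0 → Ω → ℝ) : Prop where
  ito : IsItoProcess P 𝓕 W x (fun t ω => a * X t ω + b) γ X
  vol_sq : ∀ t ω, γ t ω ^ 2 = (c * X t ω + d) ^ 2 + e

lemma lipschitzWith_affine (c d : ℝ) : LipschitzWith ‖c‖₊ fun y : ℝ => c * y + d := by
  refine LipschitzWith.of_dist_le_mul fun y z => ?_
  rw [Real.dist_eq, Real.dist_eq, coe_nnnorm, Real.norm_eq_abs, ← abs_mul]
  exact le_of_eq (by congr 1; ring)

lemma lipschitzWith_sqrt_sq_add {e : ℝ} (he : 0 ≤ e) (c d : ℝ) :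
    LipschitzWith ‖c‖₊ fun y : ℝ => √((c * y + d) ^ 2 + e) := by
  have h1 : LipschitzWith 1 fun y : ℝ => √(y ^ 2 + e) := by
    refine LipschitzWith.of_dist_le_mul fun y z => ?_
    rw [Real.dist_eq, Real.dist_eq, NNReal.coe_one, one_mul]
    have hy : 0 ≤ y ^ 2 + e := by positivity
    have hz : 0 ≤ z ^ 2 + e := by positivity
    have ay := Real.abs_le_sqrt (show y ^ 2 ≤ y ^ 2 + e by linarith)
    have az := Real.abs_le_sqrt (show z ^ 2 ≤ z ^ 2 + e by linarith)
    have sy := Real.sq_sqrt hy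
    have sz := Real.sq_sqrt hz
    set p := √(y ^ 2 + e)
    set q := √(z ^ 2 + e)
    have e1 : |p - q| * (p + q) = |y - z| * |y + z| := by
      have h0 : 0 ≤ p + q := add_nonneg (Real.sqrt_nonneg _) (Real.sqrt_nonneg _)
      rw [← abs_of_nonneg h0, ← abs_mul, ← abs_mul]
      congr 1
      linear_combination sy - sz
    have e2 : |y + z| ≤ p + q := (abs_add_le _ _).trans (add_le_add ay az)
    rcases (abs_nonneg (y + z)).trans e2 |>.eq_or_lt with h0 | h0
    · have hp : p = 0 := le_antisymm (by
        have := (abs_nonneg z).trans az; linarith) ((abs_nonneg y).trans ay)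
      have hq : q = 0 := by linarith
      rw [hp, hq]; simp
    · exact le_of_mul_le_mul_right
        (e1.le.trans (mul_le_mul_of_nonneg_left e2 (abs_nonneg _))) h0
  simpa [Function.comp_def] using h1.comp (lipschitzWith_affine c d)

namespace IsClosedLoop

variable {x a b c d e : ℝ} {γ X : ℝ≥0 → Ω → ℝ}

lemma quadraticDrift_eq (h : IsClosedLoop P 𝓕 W x a b c d e γ X) (δ p₂ p₁ p₀ : ℝ)
    (z : Ω × ℝ≥0) :
    IsItoProcess.quadraticDrift (fun t ω => a * X t ω + b) γ X δ p₂ p₁ p₀ z =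
      1 / 2 * (p₂ * (2 * a + c ^ 2 - δ)) * X z.2 z.1 ^ 2 +
      (p₁ * (a - δ) + p₂ * (b + c * d)) * X z.2 z.1 +
      (p₁ * b + 1 / 2 * p₂ * (d ^ 2 + e) - δ * p₀) := by
  simp only [IsItoProcess.quadraticDrift, h.vol_sq]
  ring

/-- If the transversality condition holds for every initial state, the mean-square growth rate
`2a + c²` is less than the discount rate. For a growth rate `κ ≥ ρ` there is a polynomial
`p(y) = y² + p₁ y + p₀` for which `e^{-κt} p(X_t)` has constant expectation; by transversality this
constant is zero, so that `p` would vanish identically. -/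
lemma rate_lt [IsProbabilityMeasure P] (hW : IsBrownianBasis P 𝓕 W) {ρ : ℝ} (hρ : 0 < ρ)
    (h : ∀ x, ∃ γ X, IsClosedLoop P 𝓕 W x a b c d e γ X ∧ DiscountedLiminfZero P ρ X) :
    2 * a + c ^ 2 < ρ := by
  by_contra hlt
  push Not at hlt
  set κ := 2 * a + c ^ 2 with hκ
  have hκ0 : 0 < κ := hρ.trans_le hlt
  have ha : a - κ ≠ 0 := by
    intro h0
    nlinarith [sq_nonneg c]
  set p₁ : ℝ := -(2 * (b + c * d)) / (a - κ) with hp₁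
  set p₀ : ℝ := (p₁ * b + (d ^ 2 + e)) / κ with hp₀
  have e1 : p₁ * (a - κ) + 2 * (b + c * d) = 0 := by
    rw [hp₁, div_mul_cancel₀ _ ha]; ring
  have e0 : p₁ * b + 1 / 2 * 2 * (d ^ 2 + e) - κ * p₀ = 0 := by
    rw [hp₀, mul_div_cancel₀ _ hκ0.ne']; ring
  have hp : ∀ x, 1 / 2 * 2 * x ^ 2 + p₁ * x + p₀ = 0 := fun x => by
    obtain ⟨γ, X, hX, ht⟩ := h x
    obtain ⟨T, -, hlim⟩ := ht.exists_seq hρ fun t => hX.ito.memLp hW t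
    refine tendsto_nhds_unique ?_ (hlim κ hlt 2 p₁ p₀)
    have : ∀ k, Real.exp (-κ * T k) *
        ∫ ω, (1 / 2 * 2 * X (T k) ω ^ 2 + p₁ * X (T k) ω + p₀) ∂P =
        1 / 2 * 2 * x ^ 2 + p₁ * x + p₀ := fun k => by
      rw [hX.ito.discounted_quadratic hW κ 2 p₁ p₀]
      simp only [hX.quadraticDrift_eq, e1, e0, ← hκ]
      simp
    simp only [this]
    exact tendsto_const_nhds
  have h0 := hp 0
  have h1 := hp 1
  have h2 := hp (-1)
  linarith

/-- Growth of the second moment, for an exponent above the mean-square growth rate. -/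
lemma exists_integral_sq_le [IsProbabilityMeasure P] (hW : IsBrownianBasis P 𝓕 W)
    (h : IsClosedLoop P 𝓕 W x a b c d e γ X) {δ : ℝ} (hδ : 0 < δ) (hκ : 2 * a + c ^ 2 < δ) :
    ∃ K : ℝ, ∀ t : ℝ≥0, ∫ ω, X t ω ^ 2 ∂P ≤ K * Real.exp (δ * t) := by
  set q : ℝ := δ - (2 * a + c ^ 2) with hq
  have hq0 : 0 < q := by linarith
  set K₀ : ℝ := (b + c * d) ^ 2 / q + d ^ 2 + |e| with hK₀
  have hK₀0 : 0 ≤ K₀ := by positivity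
  refine ⟨x ^ 2 + K₀ / δ, fun t => ?_⟩
  have hito := h.ito.discounted_quadratic hW δ 2 0 0 t
  have hle : ∫ z, Real.exp (-δ * z.2) *
      IsItoProcess.quadraticDrift (fun t ω => a * X t ω + b) γ X δ 2 0 0 z ∂(pathMeasure P t) ≤
      ∫ z : Ω × ℝ≥0, (K₀ / δ) * (δ * Real.exp (-δ * z.2)) ∂(pathMeasure P t) := by
    have hm : Measurable fun z : Ω × ℝ≥0 => Real.exp (-δ * z.2) := by fun_prop
    have hb : ∀ z : Ω × ℝ≥0, ‖Real.exp (-δ * z.2)‖ ≤ 1 := fun z => by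
      rw [Real.norm_eq_abs, abs_of_pos (Real.exp_pos _), Real.exp_le_one_iff]
      nlinarith [mul_nonneg hδ.le z.2.2]
    refine integral_mono ((h.ito.integrable_quadraticDrift hW δ 2 0 0 t).bdd_mul
      hm.aestronglyMeasurable (Eventually.of_forall hb)) ?_ fun z => ?_
    · have : Integrable (fun z : Ω × ℝ≥0 => Real.exp (-δ * z.2)) (pathMeasure P t) := by
        refine (integrable_const (1 : ℝ)).mono' hm.aestronglyMeasurable (Eventually.of_forall hb)
      exact (this.const_mul δ).const_mul _
    · beta_reduce
      have h4 : K₀ / δ * (δ * Real.exp (-δ * z.2)) = Real.exp (-δ * z.2) * K₀ := by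
        field_simp
      -- The linear term of the drift is absorbed by the negative quadratic one.
      rw [h.quadraticDrift_eq, h4]
      refine mul_le_mul_of_nonneg_left ?_ (Real.exp_pos _).le
      have h1 : -(q * X z.2 z.1 ^ 2) + 2 * (b + c * d) * X z.2 z.1 ≤ (b + c * d) ^ 2 / q := by
        rw [le_div_iff₀ hq0]
        nlinarith [sq_nonneg (q * X z.2 z.1 - (b + c * d))]
      have h2 := le_abs_self e
      have h3 : 2 * (2 * a + c ^ 2 - δ) = -2 * q := by rw [hq]; ring
      rw [h3, hK₀]
      linarith
  rw [integral_const_mul, integral_exp_pathMeasure] at hle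
  have h0 : 0 ≤ K₀ / δ := by positivity
  have hexp := Real.exp_pos (-δ * t)
  have hle2 : Real.exp (-δ * t) * ∫ ω, X t ω ^ 2 ∂P ≤ x ^ 2 + K₀ / δ := by
    have e1 : (fun ω => 1 / 2 * 2 * X t ω ^ 2 + 0 * X t ω + 0) = fun ω => X t ω ^ 2 := by
      ext ω; ring
    rw [e1] at hito
    rw [hito]
    nlinarith
  calc ∫ ω, X t ω ^ 2 ∂P = Real.exp (δ * t) * (Real.exp (-δ * t) * ∫ ω, X t ω ^ 2 ∂P) := by
        rw [← mul_assoc, ← Real.exp_add]; simp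
    _ ≤ Real.exp (δ * t) * (x ^ 2 + K₀ / δ) := by gcongr
    _ = _ := mul_comm _ _

/-- The closed loop satisfies the transversality condition if its growth rate is less than `ρ`. -/
lemma discountedLiminfZero [IsProbabilityMeasure P] (hW : IsBrownianBasis P 𝓕 W)
    (h : IsClosedLoop P 𝓕 W x a b c d e γ X) {ρ : ℝ} (hρ : 0 < ρ) (hκ : 2 * a + c ^ 2 < ρ) :
    DiscountedLiminfZero P ρ X := by
  obtain ⟨δ, hδ, hδρ⟩ := exists_between (max_lt hρ hκ)
  obtain ⟨K, hK⟩ := h.exists_integral_sq_le hW ((le_max_left _ _).trans_lt hδ)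
    ((le_max_right _ _).trans_lt hδ)
  refine Tendsto.liminf_eq ?_
  have hle : ∀ T : ℝ≥0, ENNReal.ofReal (Real.exp (-ρ * T)) *
      ∫⁻ ω, ENNReal.ofReal ((X T ω) ^ 2) ∂P ≤ ENNReal.ofReal (K * Real.exp ((δ - ρ) * T)) := by
    intro T
    rw [← ofReal_integral_eq_lintegral_ofReal (h.ito.memLp hW T).integrable_sq
      (Eventually.of_forall fun ω => sq_nonneg _), ← ENNReal.ofReal_mul (Real.exp_pos _).le]
    refine ENNReal.ofReal_le_ofReal ?_
    refine (mul_le_mul_of_nonneg_left (hK T) (Real.exp_pos _).le).trans (le_of_eq ?_)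
    rw [mul_left_comm, ← Real.exp_add]
    congr 2
    ring
  refine tendsto_of_tendsto_of_tendsto_of_le_of_le tendsto_const_nhds ?_ (fun _ => zero_le) hle
  have : Tendsto (fun T : ℝ≥0 => K * Real.exp ((δ - ρ) * T)) atTop (𝓝 (K * 0)) := by
    refine Tendsto.const_mul K (Real.tendsto_exp_atBot.comp ?_)
    exact NNReal.tendsto_coe_atTop.2 tendsto_id |>.const_mul_atTop_of_neg (by linarith)
  simpa using ENNReal.tendsto_ofReal this

/-- Discounted quadratic polynomials of the state are integrable over the whole half-line. -/
lemma integrable_quadratic [IsProbabilityMeasure P] (hW : IsBrownianBasis P 𝓕 W)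
    (h : IsClosedLoop P 𝓕 W x a b c d e γ X) {ρ : ℝ} (hρ : 0 < ρ) (hκ : 2 * a + c ^ 2 < ρ)
    (q₂ q₁ q₀ : ℝ) :
    Integrable (fun z : Ω × ℝ≥0 => Real.exp (-ρ * z.2) *
      (q₂ * X z.2 z.1 ^ 2 + q₁ * X z.2 z.1 + q₀)) (P.prod timeMeasure) := by
  obtain ⟨δ, hδ, hδρ⟩ := exists_between (max_lt hρ hκ)
  obtain ⟨K, hK⟩ := h.exists_integral_sq_le hW ((le_max_left _ _).trans_lt hδ)
    ((le_max_right _ _).trans_lt hδ)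
  have hXm := h.ito.progressive.measurable_uncurry
  have hm : Measurable fun z : Ω × ℝ≥0 => Real.exp (-ρ * z.2) := by fun_prop
  have h2 : Integrable (fun z : Ω × ℝ≥0 => Real.exp (-ρ * z.2) * X z.2 z.1 ^ 2)
      (P.prod timeMeasure) := by
    have hmm : Measurable (fun z : Ω × ℝ≥0 => Real.exp (-ρ * z.2) * X z.2 z.1 ^ 2) :=
      hm.mul (hXm.pow_const 2)
    refine (integrable_prod_iff' hmm.aestronglyMeasurable).2
      ⟨Eventually.of_forall fun t =>
        ((h.ito.memLp hW t).integrable_sq).const_mul (Real.exp (-ρ * t)), ?_⟩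
    refine ((integrable_exp_timeMeasure (θ := ρ - δ) (by linarith)).const_mul K).mono'
      hmm.aestronglyMeasurable.norm.prod_swap.integral_prod_right'
      (Eventually.of_forall fun t => ?_)
    rw [Real.norm_eq_abs, abs_of_nonneg (integral_nonneg fun ω => norm_nonneg _)]
    have : ∀ ω, ‖Real.exp (-ρ * t) * X t ω ^ 2‖ = Real.exp (-ρ * t) * X t ω ^ 2 := fun ω =>
      Real.norm_of_nonneg (mul_nonneg (Real.exp_pos _).le (sq_nonneg _))
    simp only [this]
    rw [integral_const_mul]
    refine (mul_le_mul_of_nonneg_left (hK t) (Real.exp_pos _).le).trans (le_of_eq ?_)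
    rw [mul_left_comm, ← Real.exp_add]
    congr 2
    ring
  have h0 : Integrable (fun z : Ω × ℝ≥0 => Real.exp (-ρ * z.2)) (P.prod timeMeasure) :=
    (integrable_exp_timeMeasure hρ).comp_snd P
  have h1 : Integrable (fun z : Ω × ℝ≥0 => Real.exp (-ρ * z.2) * X z.2 z.1)
      (P.prod timeMeasure) := by
    refine (h2.add h0).mono' (hm.mul hXm).aestronglyMeasurable (Eventually.of_forall fun z => ?_)
    rw [norm_mul, Real.norm_of_nonneg (Real.exp_pos _).le, Pi.add_apply, ← mul_add_one,
      Real.norm_eq_abs]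
    refine mul_le_mul_of_nonneg_left ?_ (Real.exp_pos _).le
    rw [← sq_abs]
    nlinarith [sq_nonneg (|X z.2 z.1| - 1), abs_nonneg (X z.2 z.1)]
  refine (((h2.const_mul q₂).add (h1.const_mul q₁)).add (h0.const_mul q₀)).congr
    (Eventually.of_forall fun z => ?_)
  simp only [Pi.add_apply]
  ring

/-- If the payoff of the closed loop is `v(x) + q` for every initial state `x`, where the running
reward plus the drift of `v` exceeds `ρ q` by a quadratic polynomial `g` of the state, then
`g = 0`. Solving for a quadratic `w` whose drift is `-g`, verification with `v + w` shows that the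
payoff is `v(x) + w(x) + q` as well, whence `w = 0`. -/
lemma residual_eq_zero [IsProbabilityMeasure P] (hW : IsBrownianBasis P 𝓕 W) {ρ : ℝ} (hρ : 0 < ρ)
    (hκ : 2 * a + c ^ 2 < ρ) {p₂ p₁ p₀ g₂ g₁ g₀ q : ℝ}
    (h : ∀ x, ∃ (γ X : ℝ≥0 → Ω → ℝ) (ℓ : Ω × ℝ≥0 → ℝ), IsClosedLoop P 𝓕 W x a b c d e γ X ∧
      DiscountedLiminfZero P ρ X ∧
      Integrable (fun z => Real.exp (-ρ * z.2) * ℓ z) (P.prod timeMeasure) ∧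
      (∀ z, ℓ z + IsItoProcess.quadraticDrift (fun t ω => a * X t ω + b) γ X ρ p₂ p₁ p₀ z =
        g₂ * X z.2 z.1 ^ 2 + g₁ * X z.2 z.1 + g₀ + ρ * q) ∧
      ∫ z, Real.exp (-ρ * z.2) * ℓ z ∂(P.prod timeMeasure) =
        (1 / 2 * p₂ * x ^ 2 + p₁ * x + p₀) + q) :
    g₂ = 0 ∧ g₁ = 0 ∧ g₀ = 0 := by
  have hκ' : 2 * a + c ^ 2 - ρ ≠ 0 := by linarith
  have ha' : a - ρ ≠ 0 := fun h0 => by nlinarith [sq_nonneg c]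
  obtain ⟨w₂, hw₂⟩ : ∃ w₂, 1 / 2 * (w₂ * (2 * a + c ^ 2 - ρ)) = -g₂ :=
    ⟨-2 * g₂ / (2 * a + c ^ 2 - ρ), by rw [div_mul_cancel₀ _ hκ']; ring⟩
  obtain ⟨w₁, hw₁⟩ : ∃ w₁, w₁ * (a - ρ) + w₂ * (b + c * d) = -g₁ :=
    ⟨(-g₁ - w₂ * (b + c * d)) / (a - ρ), by rw [div_mul_cancel₀ _ ha']; ring⟩
  obtain ⟨w₀, hw₀⟩ : ∃ w₀, w₁ * b + 1 / 2 * w₂ * (d ^ 2 + e) - ρ * w₀ = -g₀ :=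
    ⟨(w₁ * b + 1 / 2 * w₂ * (d ^ 2 + e) + g₀) / ρ, by rw [mul_div_cancel₀ _ hρ.ne']; ring⟩
  have hw : ∀ x, 1 / 2 * w₂ * x ^ 2 + w₁ * x + w₀ = 0 := fun x => by
    obtain ⟨γ, X, ℓ, hX, ht, hi, hℓ, hJ⟩ := h x
    have := hX.ito.payoff_eq hW hρ ht hi (p₂ + w₂) (p₁ + w₁) (p₀ + w₀) q
      (Eventually.of_forall fun z => by
        have h1 := hℓ z
        rw [hX.quadraticDrift_eq] at h1 ⊢
        linear_combination h1 + hw₂ * X z.2 z.1 ^ 2 + hw₁ * X z.2 z.1 + hw₀)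
    rw [hJ] at this
    linarith
  have h0 := hw 0
  have h1 := hw 1
  have h2 := hw (-1)
  have z2 : w₂ = 0 := by linarith
  have z1 : w₁ = 0 := by linarith
  have z0 : w₀ = 0 := by linarith
  subst z2 z1 z0
  refine ⟨by linarith, by linarith, by linarith⟩

end IsClosedLoop

/-! ### The Hamilton–Jacobi–Bellman equation -/

/-- `N - α₂ D²`, minus the second derivative of the Hamiltonian in the control. -/
def LQData.curvature (S : LQData) (α₂ : ℝ) : ℝ := S.N - α₂ * S.D ^ 2

/-- The slope of the affine feedback `u*`. -/
def LQData.slope (S : LQData) (α₂ : ℝ) : ℝ := (α₂ * (S.B + S.C * S.D) - S.R) / S.curvature α₂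

/-- The intercept of the affine feedback `u*`. -/
def LQData.intercept (S : LQData) (α₁ α₂ : ℝ) : ℝ := (α₁ * S.B - S.Q) / S.curvature α₂

lemma affineFeedback_eq (S : LQData) (α₁ α₂ y : ℝ) :
    affineFeedback S α₁ α₂ y = S.slope α₂ * y + S.intercept α₁ α₂ := by
  rw [affineFeedback, LQData.slope, LQData.intercept, LQData.curvature, div_mul_eq_mul_div,
    ← add_div]
  ring

lemma LQData.curvature_pos {S : LQData} {α₂ : ℝ} (hN : 0 < S.N) (hα₂ : α₂ < 0) :
    0 < S.curvature α₂ := by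
  have := mul_nonneg (neg_nonneg.2 hα₂.le) (sq_nonneg S.D)
  rw [LQData.curvature]
  linarith

/-- The expression `r + b v' + σ² v'' / 2 - ρ v` that is maximized over the control in the
Hamilton–Jacobi–Bellman equation, for `v(y) = α₂ y² / 2 + α₁ y + α₀`. -/
def LQData.hamiltonian (S : LQData) (α₀ α₁ α₂ y u : ℝ) : ℝ :=
  S.reward y u + (α₂ * y + α₁) * S.drift y u + 1 / 2 * α₂ * S.vol y u ^ 2 -
    S.ρ * (1 / 2 * α₂ * y ^ 2 + α₁ * y + α₀)

/-- Completion of the square: `u*` maximizes the Hamiltonian. -/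
lemma LQData.hamiltonian_eq {S : LQData} {α₂ : ℝ} (hn : 0 < S.curvature α₂) (α₀ α₁ y u : ℝ) :
    S.hamiltonian α₀ α₁ α₂ y u = S.hamiltonian α₀ α₁ α₂ y (affineFeedback S α₁ α₂ y) -
      S.curvature α₂ / 2 * (u - affineFeedback S α₁ α₂ y) ^ 2 := by
  have h : S.curvature α₂ * affineFeedback S α₁ α₂ y =
      (α₂ * (S.B + S.C * S.D) - S.R) * y + α₁ * S.B - S.Q := by
    rw [affineFeedback]
    exact mul_div_cancel₀ _ hn.ne'
  set w := affineFeedback S α₁ α₂ y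
  simp only [hamiltonian, reward, drift, vol, curvature] at h ⊢
  linear_combination (w - u) * h

/-- The Hamilton–Jacobi–Bellman equation, together with the condition that the mean-square growth
rate of the state under the feedback `u*` is less than the discount rate. Both solvability
statements are equivalent to it, whatever the exploration weight. -/
structure LQData.SolvesHJB (S : LQData) (α₀ α₁ α₂ : ℝ) : Prop where
  equation : ∀ y, S.hamiltonian α₀ α₁ α₂ y (affineFeedback S α₁ α₂ y) = 0
  rate_lt : 2 * (S.A + S.B * S.slope α₂) + (S.C + S.D * S.slope α₂) ^ 2 < S.ρ

lemma LQData.exists_hamiltonian_quadratic (S : LQData) (α₀ α₁ α₂ : ℝ) :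
    ∃ g₂ g₁ g₀ : ℝ, ∀ y, S.hamiltonian α₀ α₁ α₂ y (affineFeedback S α₁ α₂ y) =
      g₂ * y ^ 2 + g₁ * y + g₀ := by
  set k := S.slope α₂
  set l := S.intercept α₁ α₂
  refine ⟨-(S.M / 2 + S.R * k + S.N / 2 * k ^ 2) + α₂ * (S.A + S.B * k) +
      1 / 2 * α₂ * (S.C + S.D * k) ^ 2 - S.ρ * (1 / 2 * α₂),
    -(S.R * l + S.N * k * l + S.P + S.Q * k) + α₂ * (S.B * l) + α₁ * (S.A + S.B * k) +
      α₂ * (S.C + S.D * k) * (S.D * l) - S.ρ * α₁,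
    -(S.N / 2 * l ^ 2 + S.Q * l) + α₁ * (S.B * l) + 1 / 2 * α₂ * (S.D * l) ^ 2 - S.ρ * α₀,
    fun y => ?_⟩
  rw [affineFeedback_eq]
  simp only [hamiltonian, reward, drift, vol]
  ring

lemma LQData.exists_reward_quadratic (S : LQData) (α₁ α₂ : ℝ) :
    ∃ q₂ q₁ q₀ : ℝ, ∀ y, S.reward y (affineFeedback S α₁ α₂ y) = q₂ * y ^ 2 + q₁ * y + q₀ := by
  set k := S.slope α₂
  set l := S.intercept α₁ α₂
  refine ⟨-(S.M / 2 + S.R * k + S.N / 2 * k ^ 2), -(S.R * l + S.N * k * l + S.P + S.Q * k),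
    -(S.N / 2 * l ^ 2 + S.Q * l), fun y => ?_⟩
  rw [affineFeedback_eq]
  simp only [reward]
  ring

/-! ### The classical problem -/

lemma drift_affineFeedback (S : LQData) (α₁ α₂ y : ℝ) :
    S.drift y (affineFeedback S α₁ α₂ y) =
      (S.A + S.B * S.slope α₂) * y + S.B * S.intercept α₁ α₂ := by
  rw [affineFeedback_eq, LQData.drift]; ring

lemma vol_affineFeedback (S : LQData) (α₁ α₂ y : ℝ) :
    S.vol y (affineFeedback S α₁ α₂ y) =
      (S.C + S.D * S.slope α₂) * y + S.D * S.intercept α₁ α₂ := by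
  rw [affineFeedback_eq, LQData.vol]; ring

lemma isClassicalState_affineFeedback_iff {S : LQData} {α₁ α₂ x : ℝ} {X : ℝ≥0 → Ω → ℝ} :
    IsClassicalState P 𝓕 W S x (fun t ω => affineFeedback S α₁ α₂ (X t ω)) X ↔
      IsItoProcess P 𝓕 W x
        (fun t ω => (S.A + S.B * S.slope α₂) * X t ω + S.B * S.intercept α₁ α₂)
        (fun t ω => (S.C + S.D * S.slope α₂) * X t ω + S.D * S.intercept α₁ α₂) X := by
  simp only [IsClassicalState, drift_affineFeedback, vol_affineFeedback]

lemma IsClassicalState.isClosedLoop {S : LQData} {α₁ α₂ x : ℝ} {X : ℝ≥0 → Ω → ℝ}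
    (h : IsClassicalState P 𝓕 W S x (fun t ω => affineFeedback S α₁ α₂ (X t ω)) X) :
    IsClosedLoop P 𝓕 W x (S.A + S.B * S.slope α₂) (S.B * S.intercept α₁ α₂)
      (S.C + S.D * S.slope α₂) (S.D * S.intercept α₁ α₂) 0
      (fun t ω => (S.C + S.D * S.slope α₂) * X t ω + S.D * S.intercept α₁ α₂) X :=
  ⟨isClassicalState_affineFeedback_iff.1 h, fun _ _ => (add_zero _).symm⟩

lemma reward_add_quadraticDrift {Ω : Type*} (S : LQData) (α₀ α₁ α₂ : ℝ) (u X : ℝ≥0 → Ω → ℝ)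
    (z : Ω × ℝ≥0) :
    S.reward (X z.2 z.1) (u z.2 z.1) + IsItoProcess.quadraticDrift
      (fun t ω => S.drift (X t ω) (u t ω)) (fun t ω => S.vol (X t ω) (u t ω)) X S.ρ α₂ α₁ α₀ z =
      S.hamiltonian α₀ α₁ α₂ (X z.2 z.1) (u z.2 z.1) := by
  simp only [IsItoProcess.quadraticDrift, LQData.hamiltonian]
  ring

lemma IsClassicalAdmissible.payoff_eq_integral [SFinite P] {S : LQData} {x : ℝ}
    {u X : ℝ≥0 → Ω → ℝ} (h : IsClassicalAdmissible P 𝓕 W S x u X) :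
    classicalPayoff P S u X = ∫ z, Real.exp (-S.ρ * z.2) * S.reward (X z.2 z.1) (u z.2 z.1)
      ∂(P.prod timeMeasure) :=
  (integral_prod _ h.reward_integrable).symm

/-- No admissible control does better than the candidate value. -/
lemma IsClassicalAdmissible.payoff_le [IsProbabilityMeasure P] (hW : IsBrownianBasis P 𝓕 W)
    {S : LQData} (hρ : 0 < S.ρ) {α₀ α₁ α₂ : ℝ} (hn : 0 < S.curvature α₂)
    (hS : S.SolvesHJB α₀ α₁ α₂) {x : ℝ} {u X : ℝ≥0 → Ω → ℝ}
    (h : IsClassicalAdmissible P 𝓕 W S x u X) :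
    classicalPayoff P S u X ≤ 1 / 2 * α₂ * x ^ 2 + α₁ * x + α₀ := by
  rw [h.payoff_eq_integral]
  have := IsItoProcess.payoff_le hW hρ h.state h.transversality h.reward_integrable α₂ α₁ α₀ 0
    (Eventually.of_forall fun z => by
      rw [reward_add_quadraticDrift, LQData.hamiltonian_eq hn, hS.equation]
      have := mul_nonneg hn.le
        (sq_nonneg (u z.2 z.1 - affineFeedback S α₁ α₂ (X z.2 z.1)))
      linarith)
  simpa using this

/-- Under the feedback `u*`, the control is admissible and its payoff is the candidate value. -/
lemma IsClassicalState.admissible [IsProbabilityMeasure P] (hW : IsBrownianBasis P 𝓕 W)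
    {S : LQData} (hρ : 0 < S.ρ) {α₀ α₁ α₂ : ℝ}
    (hS : S.SolvesHJB α₀ α₁ α₂) {x : ℝ} {X : ℝ≥0 → Ω → ℝ}
    (h : IsClassicalState P 𝓕 W S x (fun t ω => affineFeedback S α₁ α₂ (X t ω)) X) :
    IsClassicalAdmissible P 𝓕 W S x (fun t ω => affineFeedback S α₁ α₂ (X t ω)) X ∧
      classicalPayoff P S (fun t ω => affineFeedback S α₁ α₂ (X t ω)) X =
        1 / 2 * α₂ * x ^ 2 + α₁ * x + α₀ := by
  have hc := h.isClosedLoop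
  have hp : IsStronglyProgressive 𝓕 fun t ω => affineFeedback S α₁ α₂ (X t ω) := fun t => by
    simp only [affineFeedback_eq]
    exact ((hc.ito.progressive t).const_mul _).add_const _
  have hadm : IsClassicalAdmissible P 𝓕 W S x (fun t ω => affineFeedback S α₁ α₂ (X t ω)) X := by
    refine ⟨hp, fun t => ?_, h, hc.discountedLiminfZero hW hρ hS.rate_lt, ?_⟩
    · rw [energy_eq (f := fun t ω => affineFeedback S α₁ α₂ (X t ω)) hp.measurable_uncurry]
      simp only [affineFeedback_eq]
      exact ENNReal.pow_lt_top
        (((hc.ito.memLp_path hW t).const_mul _).add (memLp_const _)).eLpNorm_lt_top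
    · obtain ⟨q₂, q₁, q₀, hq⟩ := S.exists_reward_quadratic α₁ α₂
      simp only [hq]
      exact hc.integrable_quadratic hW hρ hS.rate_lt q₂ q₁ q₀
  refine ⟨hadm, ?_⟩
  rw [hadm.payoff_eq_integral]
  have := IsItoProcess.payoff_eq hW hρ h hadm.transversality hadm.reward_integrable α₂ α₁ α₀ 0
    (Eventually.of_forall fun z => by
      rw [reward_add_quadraticDrift S α₀ α₁ α₂ (fun t ω => affineFeedback S α₁ α₂ (X t ω)) X z,
        hS.equation, mul_zero])
  simpa using this

/-- Sufficiency of the Hamilton–Jacobi–Bellman equation for the classical problem. -/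
theorem LQData.SolvesHJB.classicalSolution [IsProbabilityMeasure P] (hW : IsBrownianBasis P 𝓕 W)
    {S : LQData} (hρ : 0 < S.ρ) {α₀ α₁ α₂ : ℝ} (hn : 0 < S.curvature α₂)
    (hS : S.SolvesHJB α₀ α₁ α₂) : ClassicalSolution P 𝓕 W S α₀ α₁ α₂ := by
  have key : ∀ x : ℝ, ∃ X, IsClassicalState P 𝓕 W S x
      (fun t ω => affineFeedback S α₁ α₂ (X t ω)) X := fun x => by
    obtain ⟨X, hX⟩ := exists_isItoProcess hW x (S.A + S.B * S.slope α₂) (S.B * S.intercept α₁ α₂)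
      (lipschitzWith_affine (S.C + S.D * S.slope α₂) (S.D * S.intercept α₁ α₂))
    exact ⟨X, isClassicalState_affineFeedback_iff.2 hX⟩
  have hval : ∀ x : ℝ, classicalValue P 𝓕 W S x =
      ((1 / 2 * α₂ * x ^ 2 + α₁ * x + α₀ : ℝ) : EReal) := fun x => by
    refine le_antisymm (sSup_le ?_) ?_
    · rintro J ⟨u, X, hadm, rfl⟩
      exact EReal.coe_le_coe_iff.2 (hadm.payoff_le hW hρ hn hS)
    · obtain ⟨X, hX⟩ := key x
      obtain ⟨hadm, hpay⟩ := hX.admissible hW hρ hS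
      exact le_sSup ⟨_, X, hadm, by rw [hpay]⟩
  refine ⟨hval, fun x => ?_⟩
  obtain ⟨X, hX⟩ := key x
  obtain ⟨hadm, hpay⟩ := hX.admissible hW hρ hS
  refine ⟨X, hX, fun Y hY => ?_, hadm, by rw [hpay, hval]⟩
  exact (isClassicalState_affineFeedback_iff.1 hX).unique hW (lipschitzWith_affine _ _)
    (isClassicalState_affineFeedback_iff.1 hY)

/-- Necessity of the Hamilton–Jacobi–Bellman equation for the classical problem. -/
theorem ClassicalSolution.solvesHJB [IsProbabilityMeasure P] (hW : IsBrownianBasis P 𝓕 W)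
    {S : LQData} (hρ : 0 < S.ρ) {α₀ α₁ α₂ : ℝ} (h : ClassicalSolution P 𝓕 W S α₀ α₁ α₂) :
    S.SolvesHJB α₀ α₁ α₂ := by
  have hκ := IsClosedLoop.rate_lt hW hρ fun x => by
    obtain ⟨X, hX, -, hadm, -⟩ := h.2 x
    exact ⟨_, X, hX.isClosedLoop, hadm.transversality⟩
  refine ⟨?_, hκ⟩
  obtain ⟨g₂, g₁, g₀, hg⟩ := S.exists_hamiltonian_quadratic α₀ α₁ α₂
  obtain ⟨rfl, rfl, rfl⟩ := IsClosedLoop.residual_eq_zero (p₂ := α₂) (p₁ := α₁) (p₀ := α₀)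
    (g₂ := g₂) (g₁ := g₁) (g₀ := g₀) (q := 0) hW hρ hκ fun x => by
      obtain ⟨X, hX, -, hadm, hval⟩ := h.2 x
      refine ⟨_, X, fun z => S.reward (X z.2 z.1) (affineFeedback S α₁ α₂ (X z.2 z.1)),
        hX.isClosedLoop, hadm.transversality, hadm.reward_integrable, fun z => ?_, ?_⟩
      · have := reward_add_quadraticDrift S α₀ α₁ α₂
          (fun t ω => affineFeedback S α₁ α₂ (X t ω)) X z
        simp only [drift_affineFeedback, vol_affineFeedback] at this
        rw [this, hg]
        ring
      · rw [← hadm.payoff_eq_integral, add_zero]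
        rw [h.1 x] at hval
        exact EReal.coe_eq_coe_iff.1 hval
  intro y
  rw [hg]
  ring

/-! ### Entropy and the Gibbs variational principle -/

lemma log_gaussianPDFReal (w : ℝ) {s : ℝ≥0} (hs : s ≠ 0) (u : ℝ) :
    Real.log (gaussianPDFReal w s u) =
      -(1 / 2 * Real.log (2 * Real.pi * s)) - (u - w) ^ 2 / (2 * s) := by
  have hs' : (0 : ℝ) < s := by exact_mod_cast pos_iff_ne_zero.2 hs
  have hp : 0 < 2 * Real.pi * (s : ℝ) := by positivity
  rw [gaussianPDFReal, Real.log_mul (by positivity) (Real.exp_ne_zero _), Real.log_exp,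
    Real.log_inv, Real.log_sqrt hp.le]
  ring

lemma integrable_sub_sq {m : Measure ℝ} [IsFiniteMeasure m] (hm : MemLp id 2 m) (w : ℝ) :
    Integrable (fun u : ℝ => (u - w) ^ 2) m :=
  (hm.sub (memLp_const w)).integrable_sq

lemma integrable_log_gaussianPDFReal {m : Measure ℝ} [IsFiniteMeasure m] (hm : MemLp id 2 m)
    (w : ℝ) {s : ℝ≥0} (hs : s ≠ 0) :
    Integrable (fun u => Real.log (gaussianPDFReal w s u)) m := by
  simp only [log_gaussianPDFReal w hs]
  exact (integrable_const _).sub ((integrable_sub_sq hm w).div_const _)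

lemma integral_log_gaussianPDFReal {m : Measure ℝ} [IsProbabilityMeasure m] (hm : MemLp id 2 m)
    (w : ℝ) {s : ℝ≥0} (hs : s ≠ 0) :
    ∫ u, Real.log (gaussianPDFReal w s u) ∂m =
      -(1 / 2 * Real.log (2 * Real.pi * s)) - (∫ u, (u - w) ^ 2 ∂m) / (2 * s) := by
  simp only [log_gaussianPDFReal w hs]
  rw [integral_sub (integrable_const _) ((integrable_sub_sq hm w).div_const _), integral_div]
  simp

/-- Gibbs' inequality: the relative entropy of `m` with respect to a Gaussian is nonnegative. -/
lemma integral_log_gaussianPDFReal_le {m : Measure ℝ} [IsProbabilityMeasure m]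
    (hac : m ≪ volume) (hm : MemLp id 2 m) (he : Integrable (entropyIntegrand m)) (w : ℝ)
    {s : ℝ≥0} (hs : s ≠ 0) :
    ∫ u, Real.log (gaussianPDFReal w s u) ∂m ≤ ∫ u, entropyIntegrand m u := by
  set φ := gaussianPDFReal w s with hφ
  have i1 : Integrable (fun u => (m.rnDeriv volume u).toReal • Real.log (φ u)) :=
    (integrable_rnDeriv_smul_iff hac).2 (integrable_log_gaussianPDFReal hm w hs)
  have i2 : Integrable (fun u => (m.rnDeriv volume u).toReal) := Measure.integrable_toReal_rnDeriv
  have i3 : Integrable φ := integrable_gaussianPDFReal w s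
  have h : ∫ u, ((m.rnDeriv volume u).toReal • Real.log (φ u) + (m.rnDeriv volume u).toReal - φ u)
      ≤ ∫ u, entropyIntegrand m u := by
    refine integral_mono ((i1.add i2).sub i3) he fun u => ?_
    have h0 : 0 ≤ (m.rnDeriv volume u).toReal := ENNReal.toReal_nonneg
    have hφ0 : 0 < φ u := gaussianPDFReal_pos w s u hs
    simp only [entropyIntegrand, smul_eq_mul]
    set p := (m.rnDeriv volume u).toReal
    rcases h0.eq_or_lt with h0 | h0
    · rw [← h0]; simp [hφ0.le]
    · have h1 := Real.log_le_sub_one_of_pos (div_pos hφ0 h0)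
      rw [Real.log_div hφ0.ne' h0.ne'] at h1
      have h2 := mul_le_mul_of_nonneg_left h1 h0.le
      rw [mul_sub, mul_sub, mul_div_cancel₀ _ h0.ne'] at h2
      linarith
  rw [integral_sub (i1.fun_add i2) i3, integral_add i1 i2, integral_rnDeriv_smul hac,
    Measure.integral_toReal_rnDeriv hac, integral_gaussianPDFReal_eq_one w hs, probReal_univ] at h
  linarith

lemma entropyIntegrand_gaussianReal (w : ℝ) (s : ℝ≥0) :
    entropyIntegrand (gaussianReal w s) =ᵐ[volume] fun u =>
      ((gaussianReal w s).rnDeriv volume u).toReal • Real.log (gaussianPDFReal w s u) := by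
  filter_upwards [rnDeriv_gaussianReal w s] with u hu
  rw [entropyIntegrand, hu, toReal_gaussianPDF, smul_eq_mul]

lemma memLp_two_id_gaussianReal (w : ℝ) (s : ℝ≥0) : MemLp id 2 (gaussianReal w s) :=
  memLp_id_gaussianReal 2

lemma integrable_entropyIntegrand_gaussianReal (w : ℝ) {s : ℝ≥0} (hs : s ≠ 0) :
    Integrable (entropyIntegrand (gaussianReal w s)) :=
  ((integrable_rnDeriv_smul_iff (gaussianReal_absolutelyContinuous w hs)).2
    (integrable_log_gaussianPDFReal (memLp_two_id_gaussianReal w s) w hs)).congr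
    (entropyIntegrand_gaussianReal w s).symm

lemma integral_entropyIntegrand_gaussianReal (w : ℝ) {s : ℝ≥0} (hs : s ≠ 0) :
    ∫ u, entropyIntegrand (gaussianReal w s) u =
      ∫ u, Real.log (gaussianPDFReal w s u) ∂(gaussianReal w s) := by
  rw [integral_congr_ae (entropyIntegrand_gaussianReal w s),
    integral_rnDeriv_smul (gaussianReal_absolutelyContinuous w hs)]

lemma integral_sub_sq_gaussianReal (w : ℝ) (s : ℝ≥0) :
    ∫ u, (u - w) ^ 2 ∂(gaussianReal w s) = s := by
  have h := variance_id_gaussianReal (μ := w) (v := s)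
  rw [variance_eq_integral measurable_id.aemeasurable] at h
  simpa using h

/-- The constant by which the exploratory value exceeds the classical one. -/
def LQData.bonus (S : LQData) (α₂ lam : ℝ) : ℝ :=
  lam / (2 * S.ρ) *
    (Real.log (2 * Real.pi * Real.exp 1 * lam / S.curvature α₂) - 1)

lemma LQData.rho_mul_bonus {S : LQData} (hρ : 0 < S.ρ) {α₂ lam : ℝ} (hn : 0 < S.curvature α₂)
    (hlam : 0 < lam) :
    S.ρ * S.bonus α₂ lam = lam / 2 * Real.log (2 * Real.pi * (lam / S.curvature α₂)) := by
  have e : 2 * Real.pi * Real.exp 1 * lam / S.curvature α₂ =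
      Real.exp 1 * (2 * Real.pi * (lam / S.curvature α₂)) := by ring
  rw [LQData.bonus, e, Real.log_mul (Real.exp_ne_zero 1) (by positivity), Real.log_exp]
  field_simp
  ring

/-- The variance of the Gaussian feedback. -/
def LQData.gibbsVariance (S : LQData) (α₂ lam : ℝ) : ℝ≥0 := (lam / S.curvature α₂).toNNReal

lemma LQData.coe_gibbsVariance {S : LQData} {α₂ lam : ℝ} (hn : 0 < S.curvature α₂)
    (hlam : 0 < lam) : (S.gibbsVariance α₂ lam : ℝ) = lam / S.curvature α₂ :=
  Real.coe_toNNReal _ (div_pos hlam hn).le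

lemma LQData.gibbsVariance_ne_zero {S : LQData} {α₂ lam : ℝ} (hn : 0 < S.curvature α₂)
    (hlam : 0 < lam) : S.gibbsVariance α₂ lam ≠ 0 :=
  (Real.toNNReal_pos.2 (div_pos hlam hn)).ne'

lemma LQData.penalized_log_eq {S : LQData} (hρ : 0 < S.ρ) {α₂ lam : ℝ} (hn : 0 < S.curvature α₂)
    (hlam : 0 < lam) {m : Measure ℝ} [IsProbabilityMeasure m] (hm : MemLp id 2 m) (w : ℝ) :
    -(lam * ∫ u, Real.log (gaussianPDFReal w (S.gibbsVariance α₂ lam) u) ∂m) -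
      S.curvature α₂ / 2 * ∫ u, (u - w) ^ 2 ∂m = S.ρ * S.bonus α₂ lam := by
  rw [integral_log_gaussianPDFReal hm w (gibbsVariance_ne_zero hn hlam), coe_gibbsVariance hn hlam,
    rho_mul_bonus hρ hn hlam]
  field_simp
  ring

/-- Among all control distributions, the entropy bonus minus the quadratic penalty for the
deviation from `w` is at most `ρ` times the constant `bonus`. -/
lemma LQData.entropy_sub_penalty_le {S : LQData} (hρ : 0 < S.ρ) {α₂ lam : ℝ}
    (hn : 0 < S.curvature α₂) (hlam : 0 < lam) {m : Measure ℝ} [IsProbabilityMeasure m]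
    (hac : m ≪ volume) (hm : MemLp id 2 m) (he : Integrable (entropyIntegrand m)) (w : ℝ) :
    -(lam * ∫ u, entropyIntegrand m u) - S.curvature α₂ / 2 * ∫ u, (u - w) ^ 2 ∂m ≤
      S.ρ * S.bonus α₂ lam := by
  rw [← penalized_log_eq hρ hn hlam hm w]
  have := mul_le_mul_of_nonneg_left
    (integral_log_gaussianPDFReal_le hac hm he w (gibbsVariance_ne_zero hn hlam)) hlam.le
  linarith

lemma LQData.entropy_sub_penalty_gaussianReal {S : LQData} (hρ : 0 < S.ρ) {α₂ lam : ℝ}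
    (hn : 0 < S.curvature α₂) (hlam : 0 < lam) (w : ℝ) :
    -(lam * ∫ u, entropyIntegrand (gaussianReal w (S.gibbsVariance α₂ lam)) u) -
      S.curvature α₂ / 2 * ∫ u, (u - w) ^ 2 ∂(gaussianReal w (S.gibbsVariance α₂ lam)) =
      S.ρ * S.bonus α₂ lam := by
  rw [integral_entropyIntegrand_gaussianReal w (gibbsVariance_ne_zero hn hlam)]
  exact penalized_log_eq hρ hn hlam (memLp_two_id_gaussianReal w _) w

/-! ### The exploratory Hamiltonian -/

lemma integrable_quadratic_of_memLp {m : Measure ℝ} [IsFiniteMeasure m] (hm : MemLp id 2 m)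
    (q₂ q₁ q₀ : ℝ) : Integrable (fun u : ℝ => q₂ * u ^ 2 + q₁ * u + q₀) m :=
  (((hm.integrable_sq).const_mul q₂).add ((hm.integrable one_le_two).const_mul q₁)).add
    (integrable_const q₀)

lemma LQData.exploratoryVol_sq (S : LQData) (y : ℝ) (m : Measure ℝ) :
    S.exploratoryVol y m ^ 2 = ∫ u, S.vol y u ^ 2 ∂m :=
  Real.sq_sqrt (integral_nonneg fun _ => sq_nonneg _)

/-- The Hamiltonian averaged over a control distribution. -/
lemma LQData.exploratory_hamiltonian {S : LQData} {α₂ : ℝ} (hn : 0 < S.curvature α₂) (α₀ α₁ y : ℝ)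
    {m : Measure ℝ} [IsProbabilityMeasure m] (hm : MemLp id 2 m) :
    (∫ u, S.reward y u ∂m) + ((α₂ * y + α₁) * S.exploratoryDrift y m +
      1 / 2 * α₂ * S.exploratoryVol y m ^ 2 -
      S.ρ * (1 / 2 * α₂ * y ^ 2 + α₁ * y + α₀)) =
      S.hamiltonian α₀ α₁ α₂ y (affineFeedback S α₁ α₂ y) -
        S.curvature α₂ / 2 * ∫ u, (u - affineFeedback S α₁ α₂ y) ^ 2 ∂m := by
  have ir : Integrable (fun u => S.reward y u) m :=
    (integrable_quadratic_of_memLp hm (-(S.N / 2)) (-(S.R * y + S.Q))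
      (-(S.M / 2 * y ^ 2 + S.P * y))).congr (Eventually.of_forall fun u => by
        simp only [reward]; ring)
  have ib : Integrable (fun u => S.drift y u) m :=
    (integrable_quadratic_of_memLp hm 0 S.B (S.A * y)).congr (Eventually.of_forall fun u => by
        simp only [drift]; ring)
  have iv : Integrable (fun u => S.vol y u ^ 2) m :=
    (integrable_quadratic_of_memLp hm (S.D ^ 2) (2 * (S.C * y) * S.D) ((S.C * y) ^ 2)).congr
      (Eventually.of_forall fun u => by simp only [vol]; ring)
  have ip := integrable_sub_sq hm (affineFeedback S α₁ α₂ y)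
  have h1 : ∫ u, S.hamiltonian α₀ α₁ α₂ y u ∂m = (∫ u, S.reward y u ∂m) +
      ((α₂ * y + α₁) * S.exploratoryDrift y m + 1 / 2 * α₂ * S.exploratoryVol y m ^ 2 -
      S.ρ * (1 / 2 * α₂ * y ^ 2 + α₁ * y + α₀)) := by
    simp only [hamiltonian]
    rw [integral_sub ((ir.fun_add (ib.const_mul _)).fun_add (iv.const_mul _)) (integrable_const _),
      integral_add (ir.fun_add (ib.const_mul _)) (iv.const_mul _),
      integral_add ir (ib.const_mul _), integral_const_mul, integral_const_mul,
      exploratoryVol_sq, exploratoryDrift]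
    simp only [integral_const, probReal_univ, one_smul]
    ring
  rw [← h1]
  rw [integral_congr_ae (Eventually.of_forall fun u => hamiltonian_eq hn α₀ α₁ y u),
    integral_sub (integrable_const _) (ip.const_mul _), integral_const_mul]
  simp

/-! ### The exploratory problem -/

lemma runningReward_add_quadraticDrift {Ω : Type*} {S : LQData} {α₂ : ℝ} (hn : 0 < S.curvature α₂)
    (α₀ α₁ lam : ℝ) (π : ℝ≥0 → Ω → Measure ℝ) (X : ℝ≥0 → Ω → ℝ) (z : Ω × ℝ≥0)
    [IsProbabilityMeasure (π z.2 z.1)] (hm : MemLp id 2 (π z.2 z.1)) :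
    S.runningReward lam (X z.2 z.1) (π z.2 z.1) + IsItoProcess.quadraticDrift
      (fun t ω => S.exploratoryDrift (X t ω) (π t ω)) (fun t ω => S.exploratoryVol (X t ω) (π t ω))
      X S.ρ α₂ α₁ α₀ z =
    S.hamiltonian α₀ α₁ α₂ (X z.2 z.1) (affineFeedback S α₁ α₂ (X z.2 z.1)) +
      (-(lam * ∫ u, entropyIntegrand (π z.2 z.1) u) - S.curvature α₂ / 2 *
        ∫ u, (u - affineFeedback S α₁ α₂ (X z.2 z.1)) ^ 2 ∂(π z.2 z.1)) := by
  have := LQData.exploratory_hamiltonian hn α₀ α₁ (X z.2 z.1) hm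
  simp only [IsItoProcess.quadraticDrift, LQData.runningReward]
  linarith

namespace IsExploratoryAdmissible

variable {S : LQData} {lam x : ℝ} {π : ℝ≥0 → Ω → Measure ℝ} {X : ℝ≥0 → Ω → ℝ}

lemma measurable (h : IsExploratoryAdmissible P 𝓕 W S lam x π X) :
    Measurable fun z : Ω × ℝ≥0 => π z.2 z.1 :=
  Measure.measurable_of_measurable_coe _ fun E hE =>
    (h.progressive E hE).measurable_uncurry

lemma payoff_eq_integral [SFinite P] (h : IsExploratoryAdmissible P 𝓕 W S lam x π X) :
    exploratoryPayoff P S lam π X = ∫ z, Real.exp (-S.ρ * z.2) *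
      S.runningReward lam (X z.2 z.1) (π z.2 z.1) ∂(P.prod timeMeasure) :=
  (integral_prod _ h.reward_integrable).symm

/-- The density condition, stated for each time and almost all outcomes, holds almost everywhere on
the product space. Absolute continuity is a measurable condition on a finite kernel when it is
tested against an equivalent finite measure, here a Gaussian one. -/
lemma ae_density [IsProbabilityMeasure P] (h : IsExploratoryAdmissible P 𝓕 W S lam x π X) :
    ∀ᵐ z ∂(P.prod timeMeasure), IsProbabilityMeasure (π z.2 z.1) ∧ π z.2 z.1 ≪ volume := by
  classical
  have hπ := h.measurable
  have hmass : MeasurableSet {z : Ω × ℝ≥0 | π z.2 z.1 Set.univ = 1} :=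
    (Measure.measurable_coe MeasurableSet.univ).comp hπ (measurableSet_singleton 1)
  let κ : Kernel (Ω × ℝ≥0) ℝ :=
    ⟨fun z => if π z.2 z.1 Set.univ = 1 then π z.2 z.1 else Measure.dirac 0,
      Measurable.ite hmass hπ measurable_const⟩
  have hκ : ∀ z, π z.2 z.1 Set.univ = 1 → κ z = π z.2 z.1 := fun z hz => if_pos hz
  have : IsMarkovKernel κ := ⟨fun z => by
    by_cases hz : π z.2 z.1 Set.univ = 1
    · rw [hκ z hz]; exact ⟨hz⟩
    · have : κ z = Measure.dirac 0 := if_neg hz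
      rw [this]; infer_instance⟩
  set p : Ω × ℝ≥0 → Prop := fun z => π z.2 z.1 Set.univ = 1 ∧
    κ z ≪ Kernel.const (Ω × ℝ≥0) (gaussianReal 0 1) z with hp
  have hpm : MeasurableSet {z | p z} :=
    hmass.inter (Kernel.measurableSet_absolutelyContinuous κ (Kernel.const _ (gaussianReal 0 1)))
  have hpt : ∀ t, ∀ᵐ ω ∂P, p (ω, t) := fun t => by
    filter_upwards [h.density t] with ω hω
    have h1 : π t ω Set.univ = 1 := hω.1.measure_univ
    refine ⟨h1, ?_⟩
    rw [hκ (ω, t) h1, Kernel.const_apply]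
    exact hω.2.trans (gaussianReal_absolutelyContinuous' 0 one_ne_zero)
  refine ae_prod_of_forall_pathMeasure fun T => ?_
  filter_upwards [ae_pathMeasure_of_forall hpm hpt T] with z hz
  refine ⟨⟨hz.1⟩, ?_⟩
  have h2 := hz.2
  rw [hκ z hz.1, Kernel.const_apply] at h2
  exact h2.trans (gaussianReal_absolutelyContinuous 0 one_ne_zero)

lemma ae_memLp [IsProbabilityMeasure P] (h : IsExploratoryAdmissible P 𝓕 W S lam x π X) :
    ∀ᵐ z ∂(P.prod timeMeasure), MemLp id 2 (π z.2 z.1) := by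
  have hm : Measurable fun z : Ω × ℝ≥0 => ∫⁻ u, ENNReal.ofReal (u ^ 2) ∂(π z.2 z.1) :=
    (Measure.measurable_lintegral (by fun_prop)).comp h.measurable
  refine ae_prod_of_forall_pathMeasure fun T => ?_
  have hT : ∫⁻ z, ∫⁻ u, ENNReal.ofReal (u ^ 2) ∂(π z.2 z.1) ∂(pathMeasure P T) ≠ ∞ := by
    rw [pathMeasure, lintegral_prod _ hm.aemeasurable]
    exact (h.moment T).ne
  filter_upwards [ae_lt_top hm hT] with z hz
  refine ⟨aestronglyMeasurable_id, ?_⟩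
  have h2 := eLpNorm_two_sq (π z.2 z.1) id
  simp only [id] at h2
  rw [← h2] at hz
  exact (ENNReal.pow_lt_top_iff.1 hz).resolve_right two_ne_zero

/-- No admissible control distribution does better than the candidate value. -/
lemma payoff_le [IsProbabilityMeasure P] (hW : IsBrownianBasis P 𝓕 W) (hρ : 0 < S.ρ)
    {α₀ α₁ α₂ : ℝ} (hn : 0 < S.curvature α₂) (hlam : 0 < lam) (hS : S.SolvesHJB α₀ α₁ α₂)
    (h : IsExploratoryAdmissible P 𝓕 W S lam x π X) :
    exploratoryPayoff P S lam π X ≤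
      (1 / 2 * α₂ * x ^ 2 + α₁ * x + α₀) + S.bonus α₂ lam := by
  rw [h.payoff_eq_integral]
  refine IsItoProcess.payoff_le hW hρ h.state h.transversality h.reward_integrable α₂ α₁ α₀ _ ?_
  filter_upwards [h.ae_density, h.ae_memLp, h.entropy_finite] with z h1 h2 h3
  have := h1.1
  rw [runningReward_add_quadraticDrift hn α₀ α₁ lam π X z h2, hS.equation, zero_add]
  exact LQData.entropy_sub_penalty_le hρ hn hlam h1.2 h2 h3 _

end IsExploratoryAdmissible

variable {S : LQData} {lam x α₀ α₁ α₂ : ℝ} {X : ℝ≥0 → Ω → ℝ}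

/-- The volatility under the Gaussian feedback, which adds the variance of the control to the
square of the classical volatility. -/
def LQData.gaussianVol (S : LQData) (α₁ α₂ lam y : ℝ) : ℝ :=
  √(((S.C + S.D * S.slope α₂) * y + S.D * S.intercept α₁ α₂) ^ 2 +
    S.D ^ 2 * S.gibbsVariance α₂ lam)

lemma coe_gaussianFeedback (S : LQData) (α₁ α₂ lam y : ℝ) :
    (gaussianFeedback S α₁ α₂ lam y : Measure ℝ) =
      gaussianReal (affineFeedback S α₁ α₂ y) (S.gibbsVariance α₂ lam) := rfl

lemma exploratoryDrift_gaussianFeedback (S : LQData) (α₁ α₂ lam y : ℝ) :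
    S.exploratoryDrift y (gaussianFeedback S α₁ α₂ lam y : Measure ℝ) =
      (S.A + S.B * S.slope α₂) * y + S.B * S.intercept α₁ α₂ := by
  rw [← drift_affineFeedback, coe_gaussianFeedback, LQData.exploratoryDrift]
  have hm := memLp_two_id_gaussianReal (affineFeedback S α₁ α₂ y) (S.gibbsVariance α₂ lam)
  have i : Integrable (fun u : ℝ => u)
    (gaussianReal (affineFeedback S α₁ α₂ y) (S.gibbsVariance α₂ lam)) := hm.integrable one_le_two
  simp only [LQData.drift]
  rw [integral_add (integrable_const _) (i.const_mul _), integral_const_mul S.B,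
    integral_id_gaussianReal]
  simp

lemma exploratoryVol_gaussianFeedback (S : LQData) (α₁ α₂ lam y : ℝ) :
    S.exploratoryVol y (gaussianFeedback S α₁ α₂ lam y : Measure ℝ) =
      S.gaussianVol α₁ α₂ lam y := by
  rw [LQData.gaussianVol, ← vol_affineFeedback, coe_gaussianFeedback, LQData.exploratoryVol]
  congr 1
  set w := affineFeedback S α₁ α₂ y
  set s := S.gibbsVariance α₂ lam
  have hm := memLp_two_id_gaussianReal w s
  have i : Integrable (fun u : ℝ => u) (gaussianReal w s) := hm.integrable one_le_two
  have e : ∀ u, S.vol y u ^ 2 =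
      S.vol y w ^ 2 + 2 * S.vol y w * S.D * (u - w) + S.D ^ 2 * (u - w) ^ 2 := fun u => by
    simp only [LQData.vol]; ring
  rw [integral_congr_ae (Eventually.of_forall e)]
  have i1 : Integrable (fun u : ℝ => 2 * S.vol y w * S.D * (u - w)) (gaussianReal w s) :=
    (i.sub (integrable_const w)).const_mul _
  rw [integral_add ((integrable_const _).fun_add i1) ((integrable_sub_sq hm w).const_mul _),
    integral_add (integrable_const _) i1, integral_const_mul, integral_const_mul,
    integral_sub i (integrable_const w), integral_id_gaussianReal, integral_sub_sq_gaussianReal]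
  simp

lemma isExploratoryState_gaussianFeedback_iff :
    IsExploratoryState P 𝓕 W S x (fun t ω => (gaussianFeedback S α₁ α₂ lam (X t ω) : Measure ℝ)) X ↔
      IsItoProcess P 𝓕 W x
        (fun t ω => (S.A + S.B * S.slope α₂) * X t ω + S.B * S.intercept α₁ α₂)
        (fun t ω => S.gaussianVol α₁ α₂ lam (X t ω)) X := by
  simp only [IsExploratoryState, exploratoryDrift_gaussianFeedback,
    exploratoryVol_gaussianFeedback]

lemma lipschitzWith_gaussianVol (S : LQData) (α₁ α₂ lam : ℝ) :
    LipschitzWith ‖S.C + S.D * S.slope α₂‖₊ (S.gaussianVol α₁ α₂ lam) :=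
  lipschitzWith_sqrt_sq_add (by positivity) _ _

lemma IsExploratoryState.isClosedLoop
    (h : IsExploratoryState P 𝓕 W S x
      (fun t ω => (gaussianFeedback S α₁ α₂ lam (X t ω) : Measure ℝ)) X) :
    IsClosedLoop P 𝓕 W x (S.A + S.B * S.slope α₂) (S.B * S.intercept α₁ α₂)
      (S.C + S.D * S.slope α₂) (S.D * S.intercept α₁ α₂) (S.D ^ 2 * S.gibbsVariance α₂ lam)
      (fun t ω => S.gaussianVol α₁ α₂ lam (X t ω)) X :=
  ⟨isExploratoryState_gaussianFeedback_iff.1 h, fun _ _ => Real.sq_sqrt (by positivity)⟩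

lemma runningReward_gaussianFeedback_add {Ω : Type*} (hρ : 0 < S.ρ) (hn : 0 < S.curvature α₂)
    (hlam : 0 < lam) (α₀ α₁ : ℝ) (X : ℝ≥0 → Ω → ℝ) (z : Ω × ℝ≥0) :
    S.runningReward lam (X z.2 z.1) (gaussianFeedback S α₁ α₂ lam (X z.2 z.1) : Measure ℝ) +
      IsItoProcess.quadraticDrift
        (fun t ω => (S.A + S.B * S.slope α₂) * X t ω + S.B * S.intercept α₁ α₂)
        (fun t ω => S.gaussianVol α₁ α₂ lam (X t ω)) X S.ρ α₂ α₁ α₀ z =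
    S.hamiltonian α₀ α₁ α₂ (X z.2 z.1) (affineFeedback S α₁ α₂ (X z.2 z.1)) +
      S.ρ * S.bonus α₂ lam := by
  have h := runningReward_add_quadraticDrift hn α₀ α₁ lam
    (fun t ω => (gaussianFeedback S α₁ α₂ lam (X t ω) : Measure ℝ)) X z
    (memLp_two_id_gaussianReal _ _)
  simp only [exploratoryDrift_gaussianFeedback, exploratoryVol_gaussianFeedback] at h
  rw [h, coe_gaussianFeedback, LQData.entropy_sub_penalty_gaussianReal hρ hn hlam]

lemma exists_runningReward_quadratic (hρ : 0 < S.ρ) (hn : 0 < S.curvature α₂)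
    (hlam : 0 < lam) (α₁ : ℝ) : ∃ q₂ q₁ q₀ : ℝ, ∀ y,
      S.runningReward lam y (gaussianFeedback S α₁ α₂ lam y : Measure ℝ) =
        q₂ * y ^ 2 + q₁ * y + q₀ := by
  obtain ⟨g₂, g₁, g₀, hg⟩ := S.exists_hamiltonian_quadratic 0 α₁ α₂
  set a := S.A + S.B * S.slope α₂
  set b := S.B * S.intercept α₁ α₂
  set c := S.C + S.D * S.slope α₂
  set d := S.D * S.intercept α₁ α₂
  set e := S.D ^ 2 * S.gibbsVariance α₂ lam
  refine ⟨g₂ - (α₂ * a + 1 / 2 * α₂ * c ^ 2 - S.ρ * (1 / 2 * α₂)),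
    g₁ - (α₂ * b + α₁ * a + α₂ * c * d - S.ρ * α₁),
    g₀ + S.ρ * S.bonus α₂ lam - (α₁ * b + 1 / 2 * α₂ * (d ^ 2 + e)), fun y => ?_⟩
  have h := runningReward_gaussianFeedback_add (Ω := Unit) hρ hn hlam 0 α₁ (fun _ _ => y) ((), 0)
  have hv : S.gaussianVol α₁ α₂ lam y ^ 2 = (c * y + d) ^ 2 + e := Real.sq_sqrt (by positivity)
  simp only [IsItoProcess.quadraticDrift, hg, hv] at h
  linear_combination h

/-- Under the Gaussian feedback, the control is admissible and its payoff is the candidate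
value. -/
lemma IsExploratoryState.admissible [IsProbabilityMeasure P] (hW : IsBrownianBasis P 𝓕 W)
    (hρ : 0 < S.ρ) (hn : 0 < S.curvature α₂) (hlam : 0 < lam) (hS : S.SolvesHJB α₀ α₁ α₂)
    (h : IsExploratoryState P 𝓕 W S x
      (fun t ω => (gaussianFeedback S α₁ α₂ lam (X t ω) : Measure ℝ)) X) :
    IsExploratoryAdmissible P 𝓕 W S lam x
        (fun t ω => (gaussianFeedback S α₁ α₂ lam (X t ω) : Measure ℝ)) X ∧
      exploratoryPayoff P S lam
        (fun t ω => (gaussianFeedback S α₁ α₂ lam (X t ω) : Measure ℝ)) X =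
        (1 / 2 * α₂ * x ^ 2 + α₁ * x + α₀) + S.bonus α₂ lam := by
  have hc := h.isClosedLoop
  have hs := LQData.gibbsVariance_ne_zero hn hlam
  have hadm : IsExploratoryAdmissible P 𝓕 W S lam x
      (fun t ω => (gaussianFeedback S α₁ α₂ lam (X t ω) : Measure ℝ)) X := by
    refine ⟨fun t => Eventually.of_forall fun ω => ⟨inferInstance,
      gaussianReal_absolutelyContinuous _ hs⟩, fun E hE t => ?_, fun t => ?_, h,
      hc.discountedLiminfZero hW hρ hS.rate_lt, Eventually.of_forall fun z =>
        integrable_entropyIntegrand_gaussianReal _ hs, ?_⟩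
    · simp only [coe_gaussianFeedback, affineFeedback_eq]
      have hmean := (((hc.ito.progressive t).measurable).const_mul (S.slope α₂)).add_const
        (S.intercept α₁ α₂)
      exact (Measure.measurable_coe hE).comp
        (measurable_gaussianReal.comp (hmean.prodMk measurable_const))
    · have hmom : ∀ w : ℝ, ∫⁻ u, ENNReal.ofReal (u ^ 2)
          ∂(gaussianReal w (S.gibbsVariance α₂ lam)) =
          ENNReal.ofReal (w ^ 2) + S.gibbsVariance α₂ lam := fun w => by
        have hm := memLp_two_id_gaussianReal w (S.gibbsVariance α₂ lam)
        have e1 : ∫ u, u ^ 2 ∂(gaussianReal w (S.gibbsVariance α₂ lam)) =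
            w ^ 2 + S.gibbsVariance α₂ lam := by
          have hv := variance_eq_sub hm
          rw [variance_id_gaussianReal] at hv
          simp only [Pi.pow_apply, id, integral_id_gaussianReal] at hv
          linarith
        have i2 : Integrable (fun u : ℝ => u ^ 2) (gaussianReal w (S.gibbsVariance α₂ lam)) :=
          hm.integrable_sq
        rw [← ofReal_integral_eq_lintegral_ofReal i2 (Eventually.of_forall fun u => sq_nonneg _),
          e1, ENNReal.ofReal_add (sq_nonneg _) (NNReal.coe_nonneg _), ENNReal.ofReal_coe_nnreal]
      simp only [coe_gaussianFeedback, hmom]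
      have hXm := hc.ito.progressive.measurable_uncurry
      have hum : Measurable fun z : Ω × ℝ≥0 => affineFeedback S α₁ α₂ (X z.2 z.1) := by
        simp only [affineFeedback_eq]
        exact (hXm.const_mul _).add_const _
      have hu : MemLp (fun z : Ω × ℝ≥0 => affineFeedback S α₁ α₂ (X z.2 z.1)) 2
          (pathMeasure P t) := by
        simp only [affineFeedback_eq]
        exact ((hc.ito.memLp_path hW t).const_mul _).add (memLp_const _)
      have hm2 : Measurable fun z : Ω × ℝ≥0 =>
          ENNReal.ofReal (affineFeedback S α₁ α₂ (X z.2 z.1) ^ 2) +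
            (S.gibbsVariance α₂ lam : ℝ≥0∞) :=
        (hum.pow_const 2).ennreal_ofReal.add_const _
      have e2 := lintegral_prod (μ := P) (ν := timeMeasure.restrict (Set.Iic t)) _
        hm2.aemeasurable
      rw [← e2]
      change ∫⁻ z, _ ∂(pathMeasure P t) < ∞
      rw [lintegral_add_right _ measurable_const, ← eLpNorm_two_sq, lintegral_const]
      have := hu.eLpNorm_ne_top
      have hfin : pathMeasure P t Set.univ ≠ ∞ := by
        unfold pathMeasure
        exact measure_ne_top _ _
      finiteness
    · obtain ⟨q₂, q₁, q₀, hq⟩ := exists_runningReward_quadratic hρ hn hlam α₁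
      simp only [hq]
      exact hc.integrable_quadratic hW hρ hS.rate_lt q₂ q₁ q₀
  refine ⟨hadm, ?_⟩
  rw [hadm.payoff_eq_integral]
  refine hc.ito.payoff_eq hW hρ hadm.transversality hadm.reward_integrable α₂ α₁ α₀ _
    (Eventually.of_forall fun z => ?_)
  rw [runningReward_gaussianFeedback_add hρ hn hlam, hS.equation, zero_add]

/-- Sufficiency of the Hamilton–Jacobi–Bellman equation for the exploratory problem. -/
theorem LQData.SolvesHJB.exploratorySolution [IsProbabilityMeasure P]
    (hW : IsBrownianBasis P 𝓕 W) (hρ : 0 < S.ρ) (hn : 0 < S.curvature α₂) (hlam : 0 < lam)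
    (hS : S.SolvesHJB α₀ α₁ α₂) : ExploratorySolution P 𝓕 W S α₀ α₁ α₂ lam := by
  have key : ∀ x : ℝ, ∃ X, IsExploratoryState P 𝓕 W S x
      (fun t ω => (gaussianFeedback S α₁ α₂ lam (X t ω) : Measure ℝ)) X := fun x => by
    obtain ⟨X, hX⟩ := exists_isItoProcess hW x (S.A + S.B * S.slope α₂) (S.B * S.intercept α₁ α₂)
      (lipschitzWith_gaussianVol S α₁ α₂ lam)
    exact ⟨X, isExploratoryState_gaussianFeedback_iff.2 hX⟩
  have hval : ∀ x : ℝ, exploratoryValue P 𝓕 W S lam x =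
      (((1 / 2 * α₂ * x ^ 2 + α₁ * x + α₀) + S.bonus α₂ lam : ℝ) : EReal) := fun x => by
    refine le_antisymm (sSup_le ?_) ?_
    · rintro J ⟨π, X, hadm, rfl⟩
      exact EReal.coe_le_coe_iff.2 (hadm.payoff_le hW hρ hn hlam hS)
    · obtain ⟨X, hX⟩ := key x
      obtain ⟨hadm, hpay⟩ := hX.admissible hW hρ hn hlam hS
      exact le_sSup ⟨_, X, hadm, by rw [hpay]⟩
  refine ⟨hval, fun y => ⟨inferInstance,
    gaussianReal_absolutelyContinuous _ (LQData.gibbsVariance_ne_zero hn hlam)⟩, fun x => ?_⟩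
  obtain ⟨X, hX⟩ := key x
  obtain ⟨hadm, hpay⟩ := hX.admissible hW hρ hn hlam hS
  refine ⟨X, hX, fun Y hY => ?_, hadm, by rw [hpay, hval]⟩
  exact (isExploratoryState_gaussianFeedback_iff.1 hX).unique hW
    (lipschitzWith_gaussianVol S α₁ α₂ lam) (isExploratoryState_gaussianFeedback_iff.1 hY)

/-- Necessity of the Hamilton–Jacobi–Bellman equation for the exploratory problem. -/
theorem ExploratorySolution.solvesHJB [IsProbabilityMeasure P] (hW : IsBrownianBasis P 𝓕 W)
    (hρ : 0 < S.ρ) (hn : 0 < S.curvature α₂) (hlam : 0 < lam)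
    (h : ExploratorySolution P 𝓕 W S α₀ α₁ α₂ lam) : S.SolvesHJB α₀ α₁ α₂ := by
  have hκ := IsClosedLoop.rate_lt hW hρ fun x => by
    obtain ⟨X, hX, -, hadm, -⟩ := h.2.2 x
    exact ⟨_, X, hX.isClosedLoop, hadm.transversality⟩
  refine ⟨?_, hκ⟩
  obtain ⟨g₂, g₁, g₀, hg⟩ := S.exists_hamiltonian_quadratic α₀ α₁ α₂
  obtain ⟨rfl, rfl, rfl⟩ := IsClosedLoop.residual_eq_zero (p₂ := α₂) (p₁ := α₁) (p₀ := α₀)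
    (g₂ := g₂) (g₁ := g₁) (g₀ := g₀) (q := S.bonus α₂ lam) hW hρ hκ fun x => by
      obtain ⟨X, hX, -, hadm, hval⟩ := h.2.2 x
      refine ⟨_, X, fun z => S.runningReward lam (X z.2 z.1)
        (gaussianFeedback S α₁ α₂ lam (X z.2 z.1) : Measure ℝ),
        hX.isClosedLoop, hadm.transversality, hadm.reward_integrable, fun z => ?_, ?_⟩
      · rw [runningReward_gaussianFeedback_add hρ hn hlam, hg]
      · rw [← hadm.payoff_eq_integral]
        rw [h.1 x] at hval
        exact EReal.coe_eq_coe_iff.1 hval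
  intro y
  rw [hg]
  ring

/-! ### Vanishing exploration -/

lemma tendsto_bonus (S : LQData) {α₂ : ℝ} (hn : 0 < S.curvature α₂) :
    Tendsto (fun lam : ℝ => S.bonus α₂ lam) (𝓝[>] 0) (𝓝 0) := by
  have h0 : Tendsto (fun lam : ℝ => lam) (𝓝[>] 0) (𝓝 0) :=
    tendsto_id.mono_left nhdsWithin_le_nhds
  have h1 : Tendsto (fun lam : ℝ => lam * Real.log lam) (𝓝[>] 0) (𝓝 0) := by
    simpa using (Real.continuous_mul_log.tendsto 0).mono_left
      (nhdsWithin_le_nhds (s := Set.Ioi (0 : ℝ)))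
  set c : ℝ := Real.log (2 * Real.pi * Real.exp 1 / S.curvature α₂) - 1
  have h2 : Tendsto (fun lam : ℝ => 1 / (2 * S.ρ) * (lam * c + lam * Real.log lam)) (𝓝[>] 0)
      (𝓝 (1 / (2 * S.ρ) * (0 * c + 0))) := ((h0.mul_const c).add h1).const_mul _
  rw [zero_mul, add_zero, mul_zero] at h2
  refine h2.congr' ?_
  filter_upwards [self_mem_nhdsWithin] with lam hlam
  have hlam : 0 < lam := hlam
  have e : 2 * Real.pi * Real.exp 1 * lam / S.curvature α₂ =
      2 * Real.pi * Real.exp 1 / S.curvature α₂ * lam := by ring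
  rw [LQData.bonus, e, Real.log_mul (by positivity) hlam.ne']
  ring

/-- Gaussian measures with fixed mean and vanishing variance converge weakly to the Dirac measure:
write them as images of the standard Gaussian and use dominated convergence. -/
lemma tendsto_gaussianFeedback (S : LQData) (α₁ α₂ x : ℝ) :
    Tendsto (fun lam : ℝ => gaussianFeedback S α₁ α₂ lam x) (𝓝[>] 0)
      (𝓝 (⟨Measure.dirac (affineFeedback S α₁ α₂ x), inferInstance⟩ : ProbabilityMeasure ℝ)) := by
  refine ProbabilityMeasure.tendsto_iff_forall_integral_tendsto.2 fun f => ?_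
  set w := affineFeedback S α₁ α₂ x
  have hmap : ∀ lam, ∫ u, f u ∂(gaussianFeedback S α₁ α₂ lam x : Measure ℝ) =
      ∫ u, f (w + √(S.gibbsVariance α₂ lam) * u) ∂(gaussianReal 0 1) := fun lam => by
    have e : gaussianReal w (S.gibbsVariance α₂ lam) =
        (gaussianReal 0 1).map (fun u => w + √(S.gibbsVariance α₂ lam) * u) := by
      have h1 := gaussianReal_map_const_mul (μ := 0) (v := 1) (√(S.gibbsVariance α₂ lam : ℝ))
      have h2 := gaussianReal_map_const_add (μ := 0) (v := S.gibbsVariance α₂ lam) w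
      have h3 : NNReal.mk (√(S.gibbsVariance α₂ lam : ℝ) ^ 2) (sq_nonneg _) * 1 =
          S.gibbsVariance α₂ lam := by
        ext
        rw [mul_one]
        exact Real.sq_sqrt (NNReal.coe_nonneg _)
      rw [mul_zero, h3] at h1
      rw [← h1, Measure.map_map (by fun_prop) (by fun_prop), zero_add] at h2
      exact h2.symm
    rw [coe_gaussianFeedback]
    change ∫ u, f u ∂(gaussianReal w (S.gibbsVariance α₂ lam)) = _
    rw [e, integral_map (by fun_prop) f.continuous.aestronglyMeasurable]
  simp only [hmap]
  rw [ProbabilityMeasure.coe_mk, integral_dirac]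
  have hlim : Tendsto (fun lam : ℝ => √(S.gibbsVariance α₂ lam : ℝ)) (𝓝[>] 0) (𝓝 0) := by
    have : Continuous fun lam : ℝ => √(S.gibbsVariance α₂ lam : ℝ) := by
      simp only [LQData.gibbsVariance]
      fun_prop
    have h := (this.tendsto 0).mono_left (nhdsWithin_le_nhds (s := Set.Ioi 0))
    simpa [LQData.gibbsVariance] using h
  have h := tendsto_integral_filter_of_dominated_convergence (μ := gaussianReal 0 1)
    (l := 𝓝[>] (0 : ℝ)) (F := fun lam u => f (w + √(S.gibbsVariance α₂ lam : ℝ) * u))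
    (f := fun _ => f w) (fun _ => ‖f‖)
    (Eventually.of_forall fun lam => (f.continuous.comp (by fun_prop)).aestronglyMeasurable)
    (Eventually.of_forall fun lam => Eventually.of_forall fun u => f.norm_coe_le_norm _)
    (integrable_const _) (Eventually.of_forall fun u => by
      refine (f.continuous.tendsto w).comp ?_
      simpa using tendsto_const_nhds.add (hlim.mul_const u))
  simpa using h

end LQExploration

end

theorem theorem9 {Ω : Type*} [MeasurableSpace Ω] (P : Measure Ω) [IsProbabilityMeasure P]
    (𝓕 : Filtration ℝ≥0 ‹MeasurableSpace Ω›) (W : ℝ≥0 → Ω → ℝ)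
    (hW : LQExploration.IsBrownianBasis P 𝓕 W)
    (S : LQExploration.LQData) (hM : 0 ≤ S.M) (hN : 0 < S.N) (hρ : 0 < S.ρ)
    (α₀ α₁ α₂ : ℝ) (hα₂ : α₂ < 0)
    (h : (∃ lam : ℝ, 0 < lam ∧ LQExploration.ExploratorySolution P 𝓕 W S α₀ α₁ α₂ lam) ∨
      LQExploration.ClassicalSolution P 𝓕 W S α₀ α₁ α₂) :
    (∀ lam : ℝ, 0 < lam → LQExploration.ExploratorySolution P 𝓕 W S α₀ α₁ α₂ lam) ∧
    LQExploration.ClassicalSolution P 𝓕 W S α₀ α₁ α₂ ∧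
    (∀ x : ℝ, Tendsto (fun lam : ℝ => LQExploration.gaussianFeedback S α₁ α₂ lam x) (𝓝[>] 0)
      (𝓝 (⟨Measure.dirac (LQExploration.affineFeedback S α₁ α₂ x), inferInstance⟩ :
        ProbabilityMeasure ℝ))) ∧
    (∀ x : ℝ, Tendsto (fun lam : ℝ =>
      |(LQExploration.exploratoryValue P 𝓕 W S lam x).toReal -
        (LQExploration.classicalValue P 𝓕 W S x).toReal|) (𝓝[>] 0) (𝓝 0)) := by
  have hn := LQExploration.LQData.curvature_pos hN hα₂
  have hS : S.SolvesHJB α₀ α₁ α₂ := by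
    rcases h with ⟨lam, hlam, h⟩ | h
    · exact h.solvesHJB hW hρ hn hlam
    · exact h.solvesHJB hW hρ
  have hcl := hS.classicalSolution hW hρ hn
  have hex : ∀ lam : ℝ, 0 < lam → LQExploration.ExploratorySolution P 𝓕 W S α₀ α₁ α₂ lam :=
    fun lam hlam => hS.exploratorySolution hW hρ hn hlam
  refine ⟨hex, hcl, LQExploration.tendsto_gaussianFeedback S α₁ α₂, fun x => ?_⟩
  have hb := (LQExploration.tendsto_bonus S hn).abs
  rw [abs_zero] at hb
  refine hb.congr' ?_
  filter_upwards [self_mem_nhdsWithin] with lam hlam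
  rw [(hex lam hlam).1 x, hcl.1 x, EReal.toReal_coe, EReal.toReal_coe, LQExploration.LQData.bonus,
    LQExploration.LQData.curvature]
  congr 1
  ring
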